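/- **Setting.** Let $\mathbf d\in\mathbb N^{n\times n}$ be an expanding degree matrix: $\mathbf d_{ij}>0\Rightarrow \mathbf d_{ji}>0$; $\frac{\mathbf d_{ij}}{\mathbf d_{ji}}\frac{\mathbf d_{j\ell}}{\mathbf d_{\ell j}}=\frac{\mathbf d_{i\ell}}{\mathbf d_{\ell i}}$ whenever $\mathbf d_{ji},\mathbf d_{\ell j},\mathbf d_{\ell i}\ne0$; $\mathbf d$ is irreducible; $\max_i\sum_j\mathbf d_{ij}\ge3$ and $\min_i\sum_j\mathbf d_{ij}\ge2$. Let $q$ be a probability vector on $[n]$ with $q_i\mathbf d_{ij}=q_j\mathbf d_{ji}$ for all $i,j$ (the law of the type of a uniform vertex in the associated configuration model). Let $\mathcal T=\mathcal T_{\mathbf d}$ be the universal cover, i.e. the infinite tree, with vertex set $V$ and types in $[n]$, in which every vertex of type $i$ has exactly $\mathbf d_{ij}$ neighbours of type $j$. We write $\mathbb E_o$ for the average over a root vertex $o$ whose type has law $q$. Let $A$ be the adjacency operator on $\ell^2(V)$, $G^z=(A-z)^{-1}$ for $\Im z>0$, $G^\lambda=\lim_{\eta\to0^+}G^{\lambda+\mathrm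 i\eta}$ entrywise for real $\lambda$, and $G^z_u=G^z\delta_u$. Let $\lambda\in\mathrm{spec}(A)\setminus\mathfrak D_{\mathbf d}$, that is, $\lambda\in\mathrm{spec}(A)$ and for every edge $(x,y)$ the limits $G^\lambda_{xx}$ and $(G^{(y)})^\lambda_{xx}$ exist and are finite, and $\Im (G^{(y)})^\lambda_{xx}>0$, where $G^{(y)}$ is the Green's function of the graph with $y$ removed. Let $\mu$ be the law on $\mathbb R^V$ of the Gaussian wave $\Psi^\lambda$: the automorphism-invariant centered Gaussian process with $\mathbb E[\Psi^\lambda_x\Psi^\lambda_y]=\Im G^\lambda_{xy}$. For $\eta>0$ put $g^\eta_u=-\mathrm i\eta\, G_u^{\lambda+\mathrm i\eta}\in\ell^2(V)$, and let $\mu^\eta$ be the law on $\mathbb R^V$ of the process $$Y^\eta_u=-\mathrm i\eta\langle\Psi^\lambda,G_u^{\lambda+\mathrm i\eta}\rangle=\sum_{v\in V}\Psi^\lambda_v\, g^\eta_u(v),\qquad u\in V .$$ **Entropy.** For finite $\Gamma\subset V$ let $\partial\Gamma$ be the set of $u\in\Gamma$ adjacent to $V\setminus\Gamma$, and let $E_\Gamma\subset\mathbb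 R^\Gamma$ be the space of vectors orthogonal to $\lambda\delta_u-\sum_{v\sim u}\delta_v$ for all $u\in\Gamma\setminus\partial\Gamma$. The pairing $\langle Y^\eta,\chi\rangle=\sum_u\chi(u)Y^\eta_u$ is the pairing of $\Psi^\lambda$ with the vector $\sum_u\chi(u)g^\eta_u$. Choose a basis $\chi_1,\dots,\chi_{|\partial\Gamma|}$ of $E_\Gamma$ for which the vectors $\sum_u\chi_j(u)g^\eta_u$, $1\le j\le|\partial\Gamma|$, are orthonormal in $\ell^2(V)$ (thus the entropy of $\mu^\eta$ is taken relative to the Gram matrix of the vectors $g^\eta_u$). For $a>0$ let $\mu^\eta_{\Gamma,a}$ be the law of $\frac1a\big(\lfloor a\langle Y^\eta,\chi_1\rangle\rfloor,\dots,\lfloor a\langle Y^\eta,\chi_{|\partial\Gamma|}\rangle\rfloor\big)$, let $\mathbb H$ be the Shannon entropy, and for $k\in\mathbb N=\{0,1,\dots\}$ let $$\Delta_k(\mu^\eta)=\lim_{a\to\infty}\mathbb E_o\Big[\mathbb H\big(\mu^\eta_{B_k(C_o),a}\big)-\tfrac12\sum_{i\sim o}\mathbb H\big(\mu^\eta_{B_k(e_{oi}),a}\big)\Big],$$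 where $C_o$ is the star consisting of $o$ and its neighbours, $e_{oi}=\{o,i\}$, and $B_k(\Gamma)$ is the set of vertices at distance at most $k$ from $\Gamma$. **Claim.** For every $\eta>0$ the series defining $Y^\eta_u$ converges unconditionally in $L^2$ to a real random variable. For every $\eta>0$ and $k\in\mathbb N$, bases as above exist for all the sets $B_k(C_v)$, $v\in V$, and $B_k(e_{uv})$, $u\sim v$; the entropies are finite; the limit defining $\Delta_k(\mu^\eta)$ exists in $\mathbb R$ and does not depend on the choice of the bases; and for every $k\in\mathbb N$ $$\lim_{\eta\to0^+}\Delta_k(\mu^\eta)=0 .$$ -/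

import Mathlib

open MeasureTheory ProbabilityTheory Filter Topology
open scoped ENNReal

namespace GaussianWave

/-! ### Degree matrices and the tree they determine -/

/-- Expanding degree matrices. -/
structure IsExpanding {n : ℕ} (d : Matrix (Fin n) (Fin n) ℕ) : Prop where
  symm_support : ∀ i j, 0 < d i j → 0 < d j i
  consistent : ∀ i j l, d j i ≠ 0 → d l j ≠ 0 → d l i ≠ 0 →
    ((d i j : ℚ) / d j i) * ((d j l : ℚ) / d l j) = (d i l : ℚ) / d l i
  irreducible : (d.map (fun m : ℕ => (m : ℤ))).IsIrreducible
  exists_three_le : ∃ i, 3 ≤ ∑ j, d i j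
  two_le : ∀ i, 2 ≤ ∑ j, d i j

/-- `q` is the law of the type of a uniformly random vertex of a finite graph in which every
vertex of type `i` has `d i j` neighbours of type `j`: the relation `q i * d i j = q j * d j i`
counts the edges between the types `i` and `j` from both sides. -/
structure IsRootLaw {n : ℕ} (d : Matrix (Fin n) (Fin n) ℕ) (q : Fin n → ℝ) : Prop where
  nonneg : ∀ i, 0 ≤ q i
  sum_eq_one : ∑ i, q i = 1
  balance : ∀ i j, q i * d i j = q j * d j i

/-- The tree `T` with the types `τ` is the universal cover determined by `d`: it is a tree in
which every vertex of type `i` has exactly `d i j` neighbours of type `j`. (The type of one vertex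
and these numbers determine `T` and `τ` up to isomorphism.) -/
structure IsUniversalCover {V : Type*} {n : ℕ} (d : Matrix (Fin n) (Fin n) ℕ)
    (T : SimpleGraph V) (τ : V → Fin n) : Prop where
  isTree : T.IsTree
  encard_neighbors : ∀ v j, {w | T.Adj v w ∧ τ w = j}.encard = d (τ v) j

/-! ### The adjacency operator of a graph of bounded degree -/

/-- The vertex degrees of `H` are bounded. -/
def BoundedDegree {W : Type*} (H : SimpleGraph W) : Prop :=
  ∃ D : ℕ, ∀ v, (H.neighborSet v).encard ≤ D

theorem IsUniversalCover.boundedDegree {V : Type*} {n : ℕ} {d : Matrix (Fin n) (Fin n) ℕ}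
    {T : SimpleGraph V} {τ : V → Fin n} (hT : IsUniversalCover d T τ) : BoundedDegree T := by
  refine ⟨∑ i, ∑ j, d i j, fun v => ?_⟩
  have hU : T.neighborSet v = ⋃ j ∈ (Finset.univ : Finset (Fin n)),
      {w | T.Adj v w ∧ τ w = j} := by
    ext w
    simp
  have hS : ∀ s : Finset (Fin n), (⋃ j ∈ s, {w | T.Adj v w ∧ τ w = j}).encard
      ≤ ((∑ j ∈ s, d (τ v) j : ℕ) : ℕ∞) := by
    classical
    intro s
    induction s using Finset.induction_on with
    | empty => simp
    | insert a s ha ih =>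
      rw [Finset.set_biUnion_insert, Finset.sum_insert ha, Nat.cast_add]
      refine (Set.encard_union_le _ _).trans ?_
      rw [hT.encard_neighbors v a]
      gcongr
  rw [hU]
  refine (hS _).trans ?_
  exact_mod_cast Finset.single_le_sum (f := fun i => ∑ j, d i j) (fun i _ => Nat.zero_le _)
    (Finset.mem_univ (τ v))

theorem BoundedDegree.induce {W : Type*} {H : SimpleGraph W} (h : BoundedDegree H) (s : Set W) :
    BoundedDegree (H.induce s) := by
  obtain ⟨D, hD⟩ := h
  refine ⟨D, fun v => ?_⟩
  refine le_trans ?_ (hD v)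
  rw [← Subtype.val_injective.encard_image]
  refine Set.encard_le_encard ?_
  rintro _ ⟨w, hw, rfl⟩
  exact hw

theorem BoundedDegree.finite {W : Type*} {H : SimpleGraph W} (h : BoundedDegree H) (v : W) :
    (H.neighborSet v).Finite := by
  obtain ⟨D, hD⟩ := h
  exact Set.finite_of_encard_le_coe (hD v)

/-- The finite set of neighbours of `v`. -/
noncomputable def nbrs {W : Type*} (H : SimpleGraph W) (h : BoundedDegree H) (v : W) : Finset W :=
  (h.finite v).toFinset

theorem mem_nbrs {W : Type*} {H : SimpleGraph W} (h : BoundedDegree H) {v w : W} :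
    w ∈ nbrs H h v ↔ H.Adj v w := by
  simp [nbrs]

/-- The Hilbert space of square-summable complex functions on `W`. -/
noncomputable abbrev L2 (W : Type*) := lp (fun _ : W => ℂ) 2

theorem exists_adj_bound {W : Type*} (H : SimpleGraph W) (h : BoundedDegree H) :
    ∃ D : ℕ, ∀ (f : L2 W) (s : Finset W),
      ∑ v ∈ s, ‖∑ w ∈ nbrs H h v, f w‖ ^ (2 : ℝ≥0∞).toReal
        ≤ ((D : ℝ) * ‖f‖) ^ (2 : ℝ≥0∞).toReal := by
  classical
  obtain ⟨D, hD⟩ := id h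
  have hcard : ∀ v, (nbrs H h v).card ≤ D := by
    intro v
    have h1 := hD v
    rw [← (h.finite v).coe_toFinset, Set.encard_coe_eq_coe_finsetCard] at h1
    exact_mod_cast h1
  refine ⟨D, fun f s => ?_⟩
  have h2 : (2 : ℝ≥0∞).toReal = ((2 : ℕ) : ℝ) := by simp
  have hf := fun t : Finset W => lp.sum_rpow_le_norm_rpow (p := 2) (by simp) f t
  simp only [h2, Real.rpow_natCast] at hf ⊢
  have hcs : ∀ v, ‖∑ w ∈ nbrs H h v, f w‖ ^ 2 ≤ (D : ℝ) * ∑ w ∈ nbrs H h v, ‖f w‖ ^ 2 := by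
    intro v
    calc ‖∑ w ∈ nbrs H h v, f w‖ ^ 2 ≤ (∑ w ∈ nbrs H h v, ‖f w‖) ^ 2 := by
          gcongr
          exact norm_sum_le _ _
      _ ≤ ((nbrs H h v).card : ℝ) * ∑ w ∈ nbrs H h v, ‖f w‖ ^ 2 := sq_sum_le_card_mul_sum_sq
      _ ≤ (D : ℝ) * ∑ w ∈ nbrs H h v, ‖f w‖ ^ 2 := by
          gcongr
          exact_mod_cast hcard v
  set U : Finset W := s.biUnion (nbrs H h) with hU
  have hswap : ∑ v ∈ s, ∑ w ∈ nbrs H h v, ‖f w‖ ^ 2 ≤ ∑ w ∈ U, (D : ℝ) * ‖f w‖ ^ 2 := by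
    calc ∑ v ∈ s, ∑ w ∈ nbrs H h v, ‖f w‖ ^ 2
        = ∑ w ∈ U, ∑ v ∈ s.filter (fun v => w ∈ nbrs H h v), ‖f w‖ ^ 2 := by
          refine Finset.sum_comm' ?_
          intro v w
          simp only [hU, Finset.mem_biUnion, Finset.mem_filter]
          constructor
          · rintro ⟨hv, hw⟩
            exact ⟨⟨hv, hw⟩, v, hv, hw⟩
          · rintro ⟨⟨hv, hw⟩, _⟩
            exact ⟨hv, hw⟩
      _ ≤ ∑ w ∈ U, (D : ℝ) * ‖f w‖ ^ 2 := by
          refine Finset.sum_le_sum fun w _ => ?_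
          rw [Finset.sum_const, nsmul_eq_mul]
          gcongr
          refine le_trans (Finset.card_le_card ?_) (hcard w)
          intro v hv
          rw [Finset.mem_filter, mem_nbrs] at hv
          rw [mem_nbrs]
          exact hv.2.symm
  calc ∑ v ∈ s, ‖∑ w ∈ nbrs H h v, f w‖ ^ 2
      ≤ ∑ v ∈ s, (D : ℝ) * ∑ w ∈ nbrs H h v, ‖f w‖ ^ 2 := Finset.sum_le_sum fun v _ => hcs v
    _ = (D : ℝ) * ∑ v ∈ s, ∑ w ∈ nbrs H h v, ‖f w‖ ^ 2 := by rw [Finset.mul_sum]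
    _ ≤ (D : ℝ) * ∑ w ∈ U, (D : ℝ) * ‖f w‖ ^ 2 := by gcongr
    _ = (D : ℝ) ^ 2 * ∑ w ∈ U, ‖f w‖ ^ 2 := by rw [← Finset.mul_sum]; ring
    _ ≤ (D : ℝ) ^ 2 * ‖f‖ ^ 2 := by
        gcongr
        exact hf U
    _ = ((D : ℝ) * ‖f‖) ^ 2 := by ring

/-- The adjacency operator on `ℓ²`: `(A f) v = ∑ w ∼ v, f w`. -/
noncomputable def adjOp {W : Type*} (H : SimpleGraph W) (h : BoundedDegree H) :
    L2 W →L[ℂ] L2 W :=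
  LinearMap.mkContinuousOfExistsBound
    { toFun := fun f => ⟨fun v => ∑ w ∈ nbrs H h v, f w,
        memℓp_gen' ((exists_adj_bound H h).choose_spec f)⟩
      map_add' := fun f g => by
        ext v
        exact Finset.sum_add_distrib
      map_smul' := fun c f => by
        ext v
        simp [Finset.mul_sum] }
    ⟨((exists_adj_bound H h).choose : ℝ), fun f =>
      lp.norm_le_of_forall_sum_le (by simp) (by positivity)
        ((exists_adj_bound H h).choose_spec f)⟩

theorem adjOp_apply {W : Type*} (H : SimpleGraph W) (h : BoundedDegree H) (f : L2 W) (v : W) :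
    adjOp H h f v = ∑ w ∈ nbrs H h v, f w := rfl

/-! ### The Green's function -/

open Classical in
/-- The indicator vector of the vertex `x`. -/
noncomputable def delta {W : Type*} (x : W) : L2 W := lp.single 2 x 1

/-- The column `G^z_x = (A - z)⁻¹ δ_x` of the Green's function. -/
noncomputable def greenCol {W : Type*} (H : SimpleGraph W) (h : BoundedDegree H) (z : ℂ) (x : W) :
    L2 W :=
  Ring.inverse (adjOp H h - z • (1 : L2 W →L[ℂ] L2 W)) (delta x)

/-- The kernel `G^z_{xy} = ⟨δ_x, (A - z)⁻¹ δ_y⟩`. -/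
noncomputable def green {W : Type*} (H : SimpleGraph W) (h : BoundedDegree H) (z : ℂ) (x y : W) :
    ℂ :=
  greenCol H h z y x

/-- The point `lam + i η`. -/
noncomputable def pt (lam η : ℝ) : ℂ := (lam : ℂ) + (η : ℂ) * Complex.I

/-- The boundary value `G^λ_{xy} = lim_{η → 0⁺} G^{λ + i η}_{xy}`. -/
noncomputable def greenReal {W : Type*} (H : SimpleGraph W) (h : BoundedDegree H) (lam : ℝ)
    (x y : W) : ℂ :=
  limUnder (𝓝[>] (0 : ℝ)) (fun η : ℝ => green H h (pt lam η) x y)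

/-- For every edge `(x, y)` the boundary values at `lam` of `G_{xx}`, and of `G^{(y)}_{xx}` for the
graph with the vertex `y` removed, exist and are finite, and the latter has positive imaginary
part. -/
def IsRegularPoint {W : Type*} (H : SimpleGraph W) (h : BoundedDegree H) (lam : ℝ) : Prop :=
  ∀ (x y : W) (hxy : H.Adj x y),
    (∃ g : ℂ, Tendsto (fun η : ℝ => green H h (pt lam η) x x) (𝓝[>] (0 : ℝ)) (𝓝 g)) ∧
    (∃ g : ℂ, Tendsto (fun η : ℝ =>
        green (H.induce {y}ᶜ) (h.induce {y}ᶜ) (pt lam η) ⟨x, hxy.ne⟩ ⟨x, hxy.ne⟩)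
        (𝓝[>] (0 : ℝ)) (𝓝 g) ∧ 0 < g.im)

/-- The real points of the spectrum of the (self-adjoint) adjacency operator. -/
def spec {W : Type*} (H : SimpleGraph W) (h : BoundedDegree H) : Set ℝ :=
  {lam | (lam : ℂ) ∈ spectrum ℂ (adjOp H h)}

/-- The smallest set outside of which all points of the spectrum are regular. -/
def exceptionalSet {W : Type*} (H : SimpleGraph W) (h : BoundedDegree H) : Set ℝ :=
  {lam | lam ∈ spec H h ∧ ¬ IsRegularPoint H h lam}

/-! ### Eigenvector processes and the Gaussian wave -/

/-- `μ` is the law of an eigenvector process on `T` at `lam`. -/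
structure IsEigenvectorProcess {V : Type*} (T : SimpleGraph V) (h : BoundedDegree T) (lam : ℝ)
    (μ : Measure (V → ℝ)) : Prop where
  isProbabilityMeasure : IsProbabilityMeasure μ
  invariant : ∀ e : T ≃g T, μ.map (fun φ v => φ (e v)) = μ
  memLp : ∀ v, MemLp (fun φ : V → ℝ => φ v) 2 μ
  centered : ∀ v, ∫ φ, φ v ∂μ = 0
  covariance : ∀ x y, ∫ φ, φ x * φ y ∂μ = (greenReal T h lam x y).im

/-- `μ` is the law of the Gaussian wave on `T` at `lam`. -/
structure IsGaussianWave {V : Type*} (T : SimpleGraph V) (h : BoundedDegree T) (lam : ℝ)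
    (μ : Measure (V → ℝ)) : Prop extends IsEigenvectorProcess T h lam μ where
  gaussian : IsGaussianProcess (fun (v : V) (φ : V → ℝ) => φ v) μ

/-- The vector `-i η G^{λ + i η}_u`, against which the process is tested at the vertex `u`. -/
noncomputable def testVector {V : Type*} (T : SimpleGraph V) (h : BoundedDegree T) (lam η : ℝ)
    (u : V) : L2 V :=
  (-(Complex.I * (η : ℂ))) • greenCol T h (pt lam η) u

/-- `ν` is the law on `V → ℝ` of the process whose value at `u` is `⟨φ, g u⟩ = ∑ v, φ v * g u v`
with `φ` distributed according to `μ`, where the series converges unconditionally in `L²(μ)` and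
its sum `Y u` is real. -/
def IsTransform {V : Type*} (μ : Measure (V → ℝ)) (g : V → L2 V) (ν : Measure (V → ℝ)) : Prop :=
  ∃ Y : V → (V → ℝ) → ℝ,
    (∀ u, Measurable (Y u)) ∧ (∀ u, MemLp (Y u) 2 μ) ∧
    (∀ u, Tendsto (fun F : Finset V =>
        eLpNorm (fun φ => (Y u φ : ℂ) - ∑ v ∈ F, (φ v : ℂ) * g u v) 2 μ) atTop (𝓝 0)) ∧
    ν = μ.map (fun φ u => Y u φ)

/-! ### Discretization and entropy -/

/-- The vertices of `Γ` that are adjacent to the complement of `Γ`. -/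
def boundary {V : Type*} (T : SimpleGraph V) (Γ : Set V) : Set V :=
  {u | u ∈ Γ ∧ ∃ v, v ∉ Γ ∧ T.Adj u v}

/-- The vertices at distance at most `k` from `Γ`. -/
def ball {V : Type*} (T : SimpleGraph V) (k : ℕ) (Γ : Set V) : Set V :=
  {v | ∃ u ∈ Γ, T.dist u v ≤ k}

/-- The star of `o`: the vertex `o` and its neighbours. -/
def star {V : Type*} (T : SimpleGraph V) (o : V) : Set V := insert o (T.neighborSet o)

/-- The vectors `χ` supported in `Γ` that are orthogonal to `lam δ_u - ∑ v ∼ u, δ_v` for every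
`u ∈ Γ` outside of the boundary. -/
def eigenSpace {V : Type*} (T : SimpleGraph V) (h : BoundedDegree T) (lam : ℝ) (Γ : Set V) :
    Submodule ℝ (V →₀ ℝ) where
  carrier := {χ | (∀ v, v ∉ Γ → χ v = 0) ∧
    ∀ u, u ∈ Γ \ boundary T Γ → lam * χ u - ∑ v ∈ nbrs T h u, χ v = 0}
  zero_mem' := by simp
  add_mem' := by
    rintro χ ψ ⟨h1, h2⟩ ⟨h3, h4⟩
    refine ⟨fun v hv => by simp [h1 v hv, h3 v hv], fun u hu => ?_⟩
    have h5 := h2 u hu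
    have h6 := h4 u hu
    simp only [Finsupp.add_apply, Finset.sum_add_distrib]
    linear_combination h5 + h6
  smul_mem' := by
    rintro c χ ⟨h1, h2⟩
    refine ⟨fun v hv => by simp [h1 v hv], fun u hu => ?_⟩
    have h5 := h2 u hu
    simp only [Finsupp.smul_apply, smul_eq_mul, ← Finset.mul_sum]
    linear_combination c * h5

/-- The vector `∑ u, χ u • g u` of `ℓ²`. For `g = delta` this is `χ` itself. If the value of a
process at `u` is `⟨φ, g u⟩`, then the pairing of that process with `χ` is
`⟨φ, comb g χ⟩`. -/
noncomputable def comb {V : Type*} (g : V → L2 V) (χ : V →₀ ℝ) : L2 V :=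
  χ.sum (fun u c => (c : ℂ) • g u)

theorem comb_delta_apply {V : Type*} (χ : V →₀ ℝ) (v : V) : comb delta χ v = χ v := by
  classical
  have h1 : ∀ s : Finset V, (∑ u ∈ s, (χ u : ℂ) • (delta u : L2 V)) v
      = ∑ u ∈ s, (χ u : ℂ) * (if v = u then 1 else 0) := by
    intro s
    rw [lp.coeFn_sum, Finset.sum_apply]
    refine Finset.sum_congr rfl fun u _ => ?_
    rw [lp.coeFn_smul, Pi.smul_apply, smul_eq_mul, delta, lp.coeFn_single, Pi.single_apply]
  rw [comb, Finsupp.sum, h1]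
  simp only [mul_ite, mul_one, mul_zero, Finset.sum_ite_eq, Finsupp.mem_support_iff]
  split_ifs with h <;> simp_all

/-- A basis of `eigenSpace T h lam Γ`, indexed by a set of the size of the boundary, along which
the process with values `⟨φ, g u⟩` is discretized on `Γ`. It is orthonormal when `χ` is measured
by the `ℓ²` norm of the vector `comb g χ` with which `φ` is paired; for `g = delta` this is the
usual norm of `χ`. -/
structure IsDiscretizationBasis {V : Type*} (T : SimpleGraph V) (h : BoundedDegree T) (lam : ℝ)
    (g : V → L2 V) (Γ : Set V) (χ : Fin (boundary T Γ).ncard → (V →₀ ℝ)) : Prop where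
  orthonormal : Orthonormal ℂ (fun j => comb g (χ j))
  span_eq : Submodule.span ℝ (Set.range χ) = eigenSpace T h lam Γ

/-- The law of `a⁻¹ (⌊a ⟨Y, χ_1⟩⌋, …, ⌊a ⟨Y, χ_m⟩⌋)` for a process `Y` with law `ν`. -/
noncomputable def discretize {V : Type*} {m : ℕ} (ν : Measure (V → ℝ)) (χ : Fin m → (V →₀ ℝ))
    (a : ℝ) : Measure (Fin m → ℝ) :=
  ν.map (fun φ j => (⌊a * (χ j).sum (fun u c => c * φ u)⌋ : ℝ) / a)

/-- The surprisal of a point under a discrete probability measure. -/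
noncomputable def surprisal {E : Type*} [MeasurableSpace E] (ρ : Measure E) (x : E) : ℝ :=
  -Real.log (ρ.real {x})

/-- The Shannon entropy `𝔼[-log ρ(X)]` of a discrete probability measure `ρ`. -/
noncomputable def shannonEntropy {E : Type*} [MeasurableSpace E] (ρ : Measure E) : ℝ :=
  ∫ x, surprisal ρ x ∂ρ

/-- The balls of radius `k` around stars and edges. -/
def localSets {V : Type*} (T : SimpleGraph V) (k : ℕ) : Set (Set V) :=
  {Γ | (∃ v, Γ = ball T k (star T v)) ∨ ∃ u v, T.Adj u v ∧ Γ = ball T k {u, v}}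

/-- The quantity `𝔼_o[H(ν_{B_k(C_o), a}) - ½ ∑_{x ∼ o} H(ν_{B_k(e_{ox}), a})]` for given
discretization bases `χ`. The type of the root has law `q`, and `o i` is a vertex of type `i`. -/
noncomputable def discreteDelta {V : Type*} {n : ℕ} (T : SimpleGraph V) (h : BoundedDegree T)
    (q : Fin n → ℝ) (o : Fin n → V) (k : ℕ) (ν : Measure (V → ℝ))
    (χ : ∀ Γ : Set V, Fin (boundary T Γ).ncard → (V →₀ ℝ)) (a : ℝ) : ℝ :=
  ∑ i, q i * (shannonEntropy (discretize ν (χ (ball T k (star T (o i)))) a)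
    - 1 / 2 * ∑ x ∈ nbrs T h (o i),
        shannonEntropy (discretize ν (χ (ball T k {o i, x})) a))

/-- `Δ_k = L` for the process with law `ν` and values `⟨φ, g u⟩`: discretization bases exist, and
for every choice of them the entropies are finite and the difference of entropies tends to `L` as
the scale `a` tends to infinity. -/
def HasDelta {V : Type*} {n : ℕ} (T : SimpleGraph V) (h : BoundedDegree T) (lam : ℝ)
    (q : Fin n → ℝ) (o : Fin n → V) (k : ℕ) (g : V → L2 V) (ν : Measure (V → ℝ)) (L : ℝ) : Prop :=
  (∀ Γ ∈ localSets T k, ∃ χ, IsDiscretizationBasis T h lam g Γ χ) ∧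
  ∀ χ : (∀ Γ : Set V, Fin (boundary T Γ).ncard → (V →₀ ℝ)),
    (∀ Γ ∈ localSets T k, IsDiscretizationBasis T h lam g Γ (χ Γ)) →
    (∀ Γ ∈ localSets T k, ∀ a : ℝ, 0 < a →
      Integrable (surprisal (discretize ν (χ Γ) a)) (discretize ν (χ Γ) a)) ∧
    Tendsto (discreteDelta T h q o k ν χ) atTop (𝓝 L)

end GaussianWave

/-!
The process `Y^η` is the Gaussian wave `Ψ` itself. Formally `A Ψ = λ Ψ`, hence
`⟨Ψ, -iη (A - z)⁻¹ δ_u⟩ = ⟨-iη (A - z)⁻¹ Ψ, δ_u⟩ = Ψ_u` for `z = λ + iη`. To make sense of this one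
needs `∑_{v,w} |G^z_{uv}| |G^z_{uw}| |G^λ_{vw}| < ∞`. On a tree, Green's functions factorize along
geodesics; splitting at the median of `u, v, w` reduces the bound to
`sup_x ∑_v |G^z_{xv}| |G^λ_{xv}| < ∞`, which follows from the Cauchy–Schwarz inequality and from the
identity `Im m = |m|² (Im z + ∑ Im m')` for the Green's functions `m` of the branches
(`exists_sum_norm_mul_norm_le`, `summable_kernel_prod`, `IsUniversalCover.isTransform_self`). The
lower bound for `Im m` on the real axis is uniform since the branch Green's functions depend on the
types of their root edges only (`IsUniversalCover.cutGreen_eq`).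

Therefore `η` enters the entropies only through the bases. Let `b` be a fixed basis of `E_Γ`, and
write `K = Im G^λ`. Along a discretization basis `χ` the pairings are a Gaussian vector whose
covariance matrix has the determinant `det(K on b) / det(η Im G^z on b)`
(`IsDiscretizationBasis.det_gram_mul`). With `m = |∂Γ|`, the entropy at scale `a` is
`m log a + m (log (2π) + 1) / 2 + ½ log det + o(1)`
(`integrable_surprisal_and_tendsto_shannonEntropy`). All terms proportional to `|∂Γ|`, among them
`log a` and `log η`, cancel in `𝔼_o[F(B_k(C_o)) - ½ ∑_{x ∼ o} F(B_k(e_{ox}))]` by the edge balance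
`q_i d_ij = q_j d_ji` (`IsUniversalCover.sum_ncard_boundary`). What remains is the same average of
`½ (log det(K on b) - log det(Im G^z on b))`, which tends to `0` since `Im G^z → K` entrywise.

The last step requires that `K` is positive definite on `E_Γ`
(`IsUniversalCover.kernelForm_cov_pos`). If `⟨χ, K χ⟩ = 0` for some `χ ∈ E_Γ`, then `u = G^λ χ` has
no flux to infinity, so that it vanishes at every vertex from which a branch leaves `Γ`. Then `u` is
supported in the interior of `Γ`, and `χ = (A - λ) u` is orthogonal to `χ` by the definition of
`E_Γ`. The dimension of `E_Γ` is `|∂Γ|` because there are no finitely supported eigenvectors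
(`IsUniversalCover.exists_basis_eigenSpace`).
-/

namespace GaussianWave

/-! ### Resolvent identities for graphs of bounded degree -/

section Resolvent

variable {W : Type*} {H : SimpleGraph W} {h : BoundedDegree H}

theorem delta_apply [inst : DecidableEq W] (x v : W) :
    (delta x : L2 W) v = if v = x then 1 else 0 := by
  unfold delta
  generalize (fun a b => Classical.propDecidable (a = b) : DecidableEq W) = i1
  obtain rfl := Subsingleton.elim (α := DecidableEq W) i1 inst
  rw [lp.coeFn_single, Pi.single_apply]

theorem inner_delta_left (x : W) (f : L2 W) : inner ℂ (delta x) f = f x := by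
  classical
  rw [delta, lp.inner_single_left]
  simp

theorem inner_delta_right (x : W) (f : L2 W) : inner ℂ f (delta x) = starRingEnd ℂ (f x) := by
  rw [← inner_delta_left x f, inner_conj_symm]

theorem norm_apply_le (f : L2 W) (x : W) : ‖f x‖ ≤ ‖f‖ :=
  lp.norm_apply_le_norm (by simp) f x

theorem summable_norm_sq (f : L2 W) : Summable fun v => ‖f v‖ ^ 2 := by
  have := (lp.memℓp f).summable (by simp)
  simpa using this

theorem norm_sq_eq_tsum (f : L2 W) : ‖f‖ ^ 2 = ∑' v, ‖f v‖ ^ 2 := by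
  have := lp.norm_rpow_eq_tsum (p := 2) (by simp) f
  simpa using this

theorem adjOp_delta_inner (x : W) (g : L2 W) :
    inner ℂ (adjOp H h (delta x)) g = inner ℂ (delta x) (adjOp H h g) := by
  classical
  have h1 : adjOp H h (delta x) = ∑ v ∈ nbrs H h x, delta v := by
    ext v
    rw [adjOp_apply, lp.coeFn_sum, Finset.sum_apply]
    simp only [delta_apply]
    rw [Finset.sum_ite_eq' , Finset.sum_ite_eq]
    simp [mem_nbrs, SimpleGraph.adj_comm]
  rw [h1, sum_inner, inner_delta_left, adjOp_apply]
  exact Finset.sum_congr rfl fun v _ => inner_delta_left v g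

theorem isSelfAdjoint_adjOp : IsSelfAdjoint (adjOp H h) := by
  classical
  rw [ContinuousLinearMap.isSelfAdjoint_iff_isSymmetric]
  intro f g
  have hf : HasSum (fun i => f i • (delta i : L2 W)) f := by
    have := lp.hasSum_single (p := 2) (by simp) f
    refine this.congr_fun ?_
    intro i
    ext v
    simp [delta_apply, Pi.single_apply]
  have h1 : HasSum (fun i => inner ℂ (adjOp H h (f i • delta i)) g) (inner ℂ (adjOp H h f) g) := by
    have := (hf.mapL (adjOp H h)).mapL (innerSLFlip ℂ g)
    simpa [mul_comm] using this
  have h2 : HasSum (fun i => inner ℂ (f i • delta i) (adjOp H h g)) (inner ℂ f (adjOp H h g)) := by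
    have := hf.mapL (innerSLFlip ℂ (adjOp H h g))
    simpa [mul_comm] using this
  refine h1.unique (h2.congr_fun ?_)
  intro i
  simp only [map_smul, inner_smul_left, adjOp_delta_inner]

theorem isUnit_adjOp_sub {z : ℂ} (hz : 0 < z.im) :
    IsUnit (adjOp H h - z • (1 : L2 W →L[ℂ] L2 W)) := by
  have h1 : z ∉ spectrum ℂ (adjOp H h) := fun hmem => by
    have := isSelfAdjoint_adjOp.mem_spectrum_eq_re hmem
    rw [this] at hz
    simp at hz
  rw [spectrum.notMem_iff] at h1
  rw [← IsUnit.neg_iff]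
  convert h1 using 1
  rw [neg_sub, Algebra.algebraMap_eq_smul_one]

theorem sub_smul_apply (z : ℂ) (f : L2 W) (v : W) :
    (adjOp H h - z • (1 : L2 W →L[ℂ] L2 W)) f v = ∑ w ∈ nbrs H h v, f w - z * f v := by
  rw [← adjOp_apply H h, sub_apply, smul_apply, one_apply_eq_self, lp.coeFn_sub, Pi.sub_apply,
    lp.coeFn_smul, Pi.smul_apply, smul_eq_mul]

theorem sub_greenCol {z : ℂ} (hz : 0 < z.im) (x : W) :
    (adjOp H h - z • (1 : L2 W →L[ℂ] L2 W)) (greenCol H h z x) = delta x := by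
  rw [greenCol, ← mul_apply_eq_comp (F := L2 W →L[ℂ] L2 W),
    Ring.mul_inverse_cancel _ (isUnit_adjOp_sub hz)]
  simp

/-- The equation `(A - z) G_x = δ_x` at the vertex `v`. -/
theorem sum_greenCol [DecidableEq W] {z : ℂ} (hz : 0 < z.im) (x v : W) :
    ∑ w ∈ nbrs H h v, greenCol H h z x w - z * greenCol H h z x v = if v = x then 1 else 0 := by
  rw [← sub_smul_apply, sub_greenCol hz, delta_apply]

theorem sub_injective {z : ℂ} (hz : 0 < z.im) :
    Function.Injective (adjOp H h - z • (1 : L2 W →L[ℂ] L2 W)) := by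
  intro f g hfg
  have h1 := congrArg (fun f => Ring.inverse (adjOp H h - z • (1 : L2 W →L[ℂ] L2 W)) f) hfg
  rw [← mul_apply_eq_comp (F := L2 W →L[ℂ] L2 W), ← mul_apply_eq_comp (F := L2 W →L[ℂ] L2 W),
    Ring.inverse_mul_cancel _ (isUnit_adjOp_sub hz)] at h1
  simpa using h1

theorem eq_smul_greenCol [DecidableEq W] {z : ℂ} (hz : 0 < z.im) {f : L2 W} {c : ℂ} {x : W}
    (hf : ∀ v, ∑ w ∈ nbrs H h v, f w - z * f v = if v = x then c else 0) :
    f = c • greenCol H h z x := by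
  apply sub_injective (h := h) hz
  rw [map_smul, sub_greenCol hz]
  ext v
  rw [sub_smul_apply, hf]
  simp [delta_apply]

theorem inner_sub (z : ℂ) (f g : L2 W) :
    inner ℂ f ((adjOp H h - z • (1 : L2 W →L[ℂ] L2 W)) g)
      = inner ℂ ((adjOp H h - z • (1 : L2 W →L[ℂ] L2 W)) f) g
        + (starRingEnd ℂ z - z) * inner ℂ f g := by
  have h1 : inner ℂ (adjOp H h f) g = inner ℂ f (adjOp H h g) :=
    (ContinuousLinearMap.isSelfAdjoint_iff_isSymmetric.1 isSelfAdjoint_adjOp) f g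
  simp only [sub_apply, smul_apply,
    one_apply_eq_self,
    inner_sub_right, inner_sub_left, inner_smul_right, inner_smul_left, h1]
  ring

theorem green_symm {z : ℂ} (hz : 0 < z.im) (x y : W) : green H h z x y = green H h z y x := by
  classical
  have hs : (adjOp H h - (starRingEnd ℂ z) • (1 : L2 W →L[ℂ] L2 W)) (Star.star (greenCol H h z x))
      = delta x := by
    ext v
    rw [sub_smul_apply, delta_apply]
    have := congrArg (starRingEnd ℂ) (sum_greenCol (H := H) (h := h) hz x v)
    simp only [map_sub, map_sum, map_mul, apply_ite (starRingEnd ℂ), map_one, map_zero] at this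
    simpa using this
  have h1 := inner_sub (H := H) (h := h) (starRingEnd ℂ z) (greenCol H h z y)
    (Star.star (greenCol H h z x))
  have h2 := inner_sub (H := H) (h := h) z (Star.star (greenCol H h z x)) (greenCol H h z y)
  rw [hs, inner_delta_right] at h1
  rw [sub_greenCol hz, inner_delta_right] at h2
  have h3 : (adjOp H h - (starRingEnd ℂ z) • (1 : L2 W →L[ℂ] L2 W)) (Star.star (greenCol H h z x))
      = (adjOp H h - z • (1 : L2 W →L[ℂ] L2 W)) (Star.star (greenCol H h z x))
        + (z - starRingEnd ℂ z) • Star.star (greenCol H h z x) := by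
    simp only [sub_apply, smul_apply,
      one_apply_eq_self, sub_smul]
    abel
  rw [← sub_eq_iff_eq_add, hs] at h3
  rw [← h3, inner_sub_left, inner_delta_left, inner_smul_left] at h2
  simp only [map_sub, Complex.conj_conj, lp.star_apply, RCLike.star_def] at h2
  rw [green, green]
  linear_combination -h2

/-- `⟨G_u, G_v⟩ = η⁻¹ Im G_{uv}`, a form of the resolvent identity. -/
theorem inner_greenCol {z : ℂ} (hz : 0 < z.im) (u v : W) :
    (z.im : ℂ) * inner ℂ (greenCol H h z u) (greenCol H h z v) = (green H h z u v).im := by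
  have h1 := inner_sub (H := H) (h := h) z (greenCol H h z u) (greenCol H h z v)
  rw [sub_greenCol hz, sub_greenCol hz, inner_delta_right, inner_delta_left] at h1
  have h2 : greenCol H h z u v = green H h z u v := green_symm hz v u
  have h3 : greenCol H h z v u = green H h z u v := rfl
  rw [h2, h3] at h1
  have h4 := Complex.sub_conj (green H h z u v)
  have h5 := Complex.sub_conj z
  have h6 : (2 * Complex.I : ℂ) ≠ 0 := by simp
  apply mul_left_cancel₀ h6
  push_cast at h4 h5
  linear_combination h1 + h4 - inner ℂ (greenCol H h z u) (greenCol H h z v) * h5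

theorem im_green_self {z : ℂ} (hz : 0 < z.im) (u : W) :
    (green H h z u u).im = z.im * ‖greenCol H h z u‖ ^ 2 := by
  have h1 := inner_greenCol (H := H) (h := h) hz u u
  rw [inner_self_eq_norm_sq_to_K] at h1
  have := congrArg Complex.re h1
  rw [Complex.ofReal_re] at this
  rw [← this, Complex.re_ofReal_mul]
  norm_cast

theorem greenCol_ne_zero {z : ℂ} (hz : 0 < z.im) (u : W) : greenCol H h z u ≠ 0 := by
  classical
  intro h0
  have h1 := sum_greenCol (H := H) (h := h) hz u u
  rw [h0] at h1
  simp at h1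

theorem im_green_pos {z : ℂ} (hz : 0 < z.im) (u : W) : 0 < (green H h z u u).im := by
  rw [im_green_self hz]
  have := norm_pos_iff.2 (greenCol_ne_zero (H := H) (h := h) hz u)
  positivity

theorem norm_green_self_le {z : ℂ} (hz : 0 < z.im) (u : W) : ‖green H h z u u‖ ≤ 1 / z.im := by
  have h1 := im_green_self (H := H) (h := h) hz u
  have h2 : ‖green H h z u u‖ ≤ ‖greenCol H h z u‖ := norm_apply_le _ _
  have h3 := Complex.abs_im_le_norm (green H h z u u)
  have h4 := le_abs_self (green H h z u u).im
  have h5 := norm_nonneg (greenCol H h z u)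
  rw [le_div_iff₀ hz]
  rcases h5.eq_or_lt with h6 | h6
  · rw [← h6] at h2; nlinarith [norm_nonneg (green H h z u u)]
  · have h7 : z.im * ‖greenCol H h z u‖ * ‖greenCol H h z u‖ ≤ 1 * ‖greenCol H h z u‖ := by
      nlinarith
    have := le_of_mul_le_mul_right h7 h6
    nlinarith

/-- The lower bound comes from `η ‖G_u‖² ≥ η |G_{uu}|²`. -/
theorem mul_norm_sq_le_im_green {z : ℂ} (hz : 0 < z.im) (u : W) :
    z.im * ‖green H h z u u‖ ^ 2 ≤ (green H h z u u).im := by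
  rw [im_green_self hz]
  have h2 : ‖green H h z u u‖ ≤ ‖greenCol H h z u‖ := norm_apply_le _ _
  gcongr

end Resolvent

/-! ### Branches of a tree -/

section Tree

variable {V : Type*} {T : SimpleGraph V}

/-- For an edge `(x, y)` of a tree, the branch of `y` seen from `x`: the vertices that are closer
to `y` than to `x`. -/
def branch (T : SimpleGraph V) (x y : V) : Set V := {w | T.dist x w = T.dist y w + 1}

theorem mem_branch {x y w : V} : w ∈ branch T x y ↔ T.dist x w = T.dist y w + 1 := Iff.rfl

theorem dist_of_notMem_branch (hT : T.IsTree) {x y w : V} (hxy : T.Adj x y)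
    (hw : w ∉ branch T x y) : T.dist y w = T.dist x w + 1 := by
  have h1 := hT.dist_eq_dist_add_one_of_adj w hxy
  rw [mem_branch] at hw
  rw [T.dist_comm (u := w) (v := x), T.dist_comm (u := w) (v := y)] at h1
  tauto

theorem notMem_branch_iff (hT : T.IsTree) {x y w : V} (hxy : T.Adj x y) :
    w ∉ branch T x y ↔ w ∈ branch T y x := by
  refine ⟨fun hw => dist_of_notMem_branch hT hxy hw, fun hw h2 => ?_⟩
  rw [mem_branch] at hw h2
  omega

theorem snd_mem_branch {x y : V} (hxy : T.Adj x y) : y ∈ branch T x y := by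
  rw [mem_branch, T.dist_self, SimpleGraph.dist_eq_one_iff_adj.2 hxy]

theorem fst_notMem_branch {x y : V} : x ∉ branch T x y := by
  rw [mem_branch, T.dist_self]
  omega

/-- A vertex of a tree has at most one neighbour in the direction of another vertex. -/
theorem eq_of_mem_branch (hT : T.IsTree) {v a b w : V} (ha : T.Adj v a) (hb : T.Adj v b)
    (hwa : w ∈ branch T v a) (hwb : w ∈ branch T v b) : a = b := by
  have key : ∀ c, T.Adj v c → w ∈ branch T v c →
      ∃ p : T.Walk v w, p.IsPath ∧ p.snd = c := by
    intro c hc hw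
    obtain ⟨p, hp⟩ := (hT.connected c w).exists_walk_length_eq_dist
    refine ⟨SimpleGraph.Walk.cons hc p, ?_, by simp⟩
    apply SimpleGraph.Walk.isPath_of_length_eq_dist
    rw [SimpleGraph.Walk.length_cons, hp]
    exact hw.symm
  obtain ⟨p, hp, rfl⟩ := key a ha hwa
  obtain ⟨p', hp', rfl⟩ := key b hb hwb
  have := (hT.isAcyclic.subsingleton_path v w).elim ⟨p, hp⟩ ⟨p', hp'⟩
  rw [Subtype.mk.injEq] at this
  rw [this]

theorem exists_adj_mem_branch (hT : T.IsTree) {v w : V} (hvw : v ≠ w) :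
    ∃ a, T.Adj v a ∧ w ∈ branch T v a := by
  obtain ⟨p, hp⟩ := (hT.connected v w).exists_walk_length_eq_dist
  cases p with
  | nil => exact absurd rfl hvw
  | @cons _ a _ hadj p =>
    refine ⟨a, hadj, ?_⟩
    by_contra hn
    have h1 := dist_of_notMem_branch hT hadj hn
    have h2 := SimpleGraph.dist_le p
    rw [SimpleGraph.Walk.length_cons] at hp
    omega

/-- The only edge that enters the branch of `y` seen from `x` is `(x, y)`. -/
theorem eq_of_adj_branch (hT : T.IsTree) {x y s t : V} (hxy : T.Adj x y) (hst : T.Adj s t)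
    (hs : s ∈ branch T x y) (ht : t ∉ branch T x y) : s = y ∧ t = x := by
  have h1 := dist_of_notMem_branch hT hxy ht
  rw [mem_branch] at hs
  have h2 := hT.dist_eq_dist_add_one_of_adj x hst
  have h3 := hT.dist_eq_dist_add_one_of_adj y hst
  by_cases hsy : s = y
  · subst hsy
    refine ⟨rfl, ?_⟩
    rw [T.dist_self] at *
    have : T.dist x t = 0 := by omega
    exact ((hT.connected.dist_eq_zero_iff).1 this).symm
  · exfalso
    obtain ⟨a, ha, hya⟩ := exists_adj_mem_branch hT hsy
    have h4 : a ≠ t := by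
      rintro rfl
      rw [mem_branch, T.dist_comm, T.dist_comm (u := a)] at hya
      omega
    apply h4
    have h5 := hT.dist_eq_dist_add_one_of_adj x ha
    have h6 := hT.connected.dist_triangle (u := x) (v := y) (w := a)
    rw [SimpleGraph.dist_eq_one_iff_adj.2 hxy] at h6
    rw [mem_branch, T.dist_comm, T.dist_comm (u := a)] at hya
    refine eq_of_mem_branch hT (w := x) ha hst ?_ ?_ <;>
    · rw [mem_branch, T.dist_comm, T.dist_comm (v := x)]
      omega

/-- A geodesic that ends in the branch of `y` seen from `x` and starts outside of it runs through
the edge `(x, y)`. -/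
theorem dist_eq_of_mem_branch (hT : T.IsTree) {x y u w : V} (hxy : T.Adj x y)
    (hu : u ∉ branch T x y) (hw : w ∈ branch T x y) :
    T.dist u w = T.dist u x + 1 + T.dist y w := by
  obtain ⟨p, hp⟩ := (hT.connected u w).exists_walk_length_eq_dist
  have key : ∀ (u w : V) (p : T.Walk u w), w ∈ branch T x y → u ∉ branch T x y →
      T.dist u x + 1 + T.dist y w ≤ p.length := by
    intro u w p hw
    induction p with
    | nil => exact fun h => absurd hw h
    | @cons u a w hadj p ih =>
      intro hu
      rw [SimpleGraph.Walk.length_cons]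
      by_cases ha : a ∈ branch T x y
      · obtain ⟨rfl, rfl⟩ := eq_of_adj_branch hT hxy hadj.symm ha hu
        have := SimpleGraph.dist_le p
        rw [T.dist_self]
        omega
      · have h1 := ih hw ha
        have h2 := hT.connected.dist_triangle (u := u) (v := a) (w := x)
        rw [SimpleGraph.dist_eq_one_iff_adj.2 hadj] at h2
        omega
  have h1 := key u w p hw hu
  have h2 := hT.connected.dist_triangle (u := u) (v := x) (w := w)
  rw [mem_branch] at hw
  omega

/-- Any three vertices of a tree have a median. -/
theorem exists_median (hT : T.IsTree) (u v w : V) : ∃ x,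
    T.dist u v = T.dist u x + T.dist x v ∧ T.dist u w = T.dist u x + T.dist x w ∧
      T.dist v w = T.dist v x + T.dist x w := by
  induction hk : T.dist v u using Nat.strong_induction_on generalizing v with
  | _ k ih =>
  by_cases hb : T.dist u w = T.dist u v + T.dist v w
  · exact ⟨v, by simp, hb, by simp⟩
  · have hvu : v ≠ u := by
      rintro rfl
      simp at hb
    have hvw : v ≠ w := by
      rintro rfl
      simp at hb
    obtain ⟨a, ha, hua⟩ := exists_adj_mem_branch hT hvu
    have hwa : w ∈ branch T v a := by
      by_contra hwa
      apply hb
      have h1 := dist_eq_of_mem_branch hT ha hwa hua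
      rw [mem_branch] at hua
      rw [T.dist_comm, h1, T.dist_comm (u := u), hua, T.dist_comm (u := w)]
      omega
    rw [mem_branch] at hua hwa
    obtain ⟨x, h1, h2, h3⟩ := ih (T.dist a u) (by omega) a rfl
    have h4 := hT.connected.dist_triangle (u := u) (v := x) (w := v)
    have h5 := hT.connected.dist_triangle (u := v) (v := x) (w := w)
    have h6 := hT.connected.dist_triangle (u := v) (v := a) (w := x)
    have h7 := SimpleGraph.dist_eq_one_iff_adj.2 ha
    rw [T.dist_comm (u := u) (v := a)] at h1
    rw [T.dist_comm (u := u) (v := v)] at h4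
    rw [T.dist_comm (u := x) (v := a)] at h1
    rw [T.dist_comm (u := x) (v := v)] at h4
    refine ⟨x, ?_⟩
    rw [T.dist_comm (u := u) (v := v), T.dist_comm (u := x) (v := v)]
    exact ⟨by omega, by omega, by omega⟩

end Tree

/-! ### The Green's function of a tree -/

section TreeGreen

variable {V : Type*} {T : SimpleGraph V} {h : BoundedDegree T}

open Classical in
/-- The Green's function `G^{(x)}_{yy}` at `y` of the graph with the vertex `x` removed (and `0` if
`x = y`). -/
noncomputable def cutGreen (T : SimpleGraph V) (h : BoundedDegree T) (z : ℂ) (x y : V) : ℂ :=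
  if hyx : y ≠ x then green (T.induce {x}ᶜ) (h.induce {x}ᶜ) z ⟨y, hyx⟩ ⟨y, hyx⟩ else 0

theorem cutGreen_of_ne {z : ℂ} {x y : V} (hyx : y ≠ x) :
    cutGreen T h z x y = green (T.induce {x}ᶜ) (h.induce {x}ᶜ) z ⟨y, hyx⟩ ⟨y, hyx⟩ :=
  dif_pos hyx

theorem sum_nbrs_induce [DecidableEq V] (x : V) (s : ({x}ᶜ : Set V)) (F : V → ℂ) :
    ∑ t ∈ nbrs (T.induce {x}ᶜ) (h.induce {x}ᶜ) s, F t = ∑ t ∈ (nbrs T h s).erase x, F t := by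
  refine Finset.sum_bij (fun t _ => (t : V)) ?_ ?_ ?_ ?_
  · intro t ht
    rw [mem_nbrs] at ht
    rw [Finset.mem_erase, mem_nbrs]
    exact ⟨t.2, ht⟩
  · intro a _ b _ hab
    exact Subtype.ext hab
  · intro t ht
    rw [Finset.mem_erase, mem_nbrs] at ht
    refine ⟨⟨t, ht.1⟩, ?_, rfl⟩
    rw [mem_nbrs]
    exact ht.2
  · intro t _
    rfl

/-- A square-summable solution of `(A - z) f = 0` on the branch of `y` seen from `x` is there the
multiple `-f x` of the Green's function of the graph without `x`. -/
theorem eq_greenCol_on_branch (hT : T.IsTree) {z : ℂ} (hz : 0 < z.im) {x y : V} (hxy : T.Adj x y)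
    {f : L2 V} (hf : ∀ v ∈ branch T x y, ∑ w ∈ nbrs T h v, f w - z * f v = 0) :
    ∃ φ : L2 ({x}ᶜ : Set V),
      φ = (-f x) • greenCol (T.induce {x}ᶜ) (h.induce {x}ᶜ) z ⟨y, hxy.ne'⟩ ∧
      φ ⟨y, hxy.ne'⟩ = f y ∧ ‖φ‖ ≤ ‖f‖ := by
  classical
  set F : V → ℂ := fun v => if v ∈ branch T x y then f v else 0 with hF
  have hle : ∀ v, ‖F v‖ ^ 2 ≤ ‖f v‖ ^ 2 := by
    intro v
    simp only [hF]
    split_ifs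
    · exact le_rfl
    · simp
  have hsum : Summable fun v : ({x}ᶜ : Set V) => ‖f v‖ ^ 2 :=
    (summable_norm_sq f).comp_injective Subtype.val_injective
  have hsum' : Summable fun v : ({x}ᶜ : Set V) => ‖F v‖ ^ 2 :=
    Summable.of_nonneg_of_le (fun v => by positivity) (fun v => hle v) hsum
  let φ : L2 ({x}ᶜ : Set V) := ⟨fun v => F v, memℓp_gen (by simpa using hsum')⟩
  have hφ : ∀ v, φ v = F v := fun v => rfl
  refine ⟨φ, ?_, ?_, ?_⟩
  · apply eq_smul_greenCol hz
    rintro ⟨v, hv⟩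
    have h1 : ∑ w ∈ nbrs (T.induce {x}ᶜ) (h.induce {x}ᶜ) ⟨v, hv⟩, φ w
        = ∑ t ∈ (nbrs T h v).erase x, F t := sum_nbrs_induce x ⟨v, hv⟩ F
    rw [h1, hφ]
    by_cases hvb : v ∈ branch T x y
    · have h2 : ∑ t ∈ (nbrs T h v).erase x, F t = ∑ t ∈ (nbrs T h v).erase x, f t := by
        refine Finset.sum_congr rfl fun t ht => ?_
        rw [Finset.mem_erase, mem_nbrs] at ht
        refine if_pos ?_
        by_contra htb
        exact ht.1 (eq_of_adj_branch hT hxy ht.2 hvb htb).2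
      have h3 := hf v hvb
      rw [h2]
      have h4 : F v = f v := if_pos hvb
      rw [h4]
      by_cases hvy : v = y
      · subst hvy
        rw [if_pos rfl, Finset.sum_erase_eq_sub (mem_nbrs h |>.2 hxy.symm)]
        linear_combination h3
      · rw [if_neg fun h0 => hvy (congrArg Subtype.val h0), Finset.erase_eq_of_notMem, h3]
        rw [mem_nbrs]
        intro hvx
        exact hvy (eq_of_adj_branch hT hxy hvx hvb fst_notMem_branch).1
    · have h2 : ∑ t ∈ (nbrs T h v).erase x, F t = 0 := by
        refine Finset.sum_eq_zero fun t ht => ?_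
        rw [Finset.mem_erase, mem_nbrs] at ht
        refine if_neg fun htb => ?_
        exact hv (eq_of_adj_branch hT hxy ht.2.symm htb hvb).2
      have h4 : F v = 0 := if_neg hvb
      rw [h2, h4, if_neg]
      · simp
      · intro h0
        obtain rfl : v = y := congrArg Subtype.val h0
        exact hvb (snd_mem_branch hxy)
  · rw [hφ]
    exact if_pos (snd_mem_branch hxy)
  · refine le_of_sq_le_sq ?_ (norm_nonneg _)
    rw [norm_sq_eq_tsum, norm_sq_eq_tsum]
    calc ∑' v, ‖φ v‖ ^ 2 ≤ ∑' v : ({x}ᶜ : Set V), ‖f v‖ ^ 2 :=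
          hsum'.tsum_le_tsum (fun v => hle v) hsum
      _ ≤ ∑' v, ‖f v‖ ^ 2 := Summable.tsum_subtype_le (fun v => ‖f v‖ ^ 2) _
          (fun v => by positivity) (summable_norm_sq f)

theorem apply_snd_eq (hT : T.IsTree) {z : ℂ} (hz : 0 < z.im) {x y : V} (hxy : T.Adj x y)
    {f : L2 V} (hf : ∀ v ∈ branch T x y, ∑ w ∈ nbrs T h v, f w - z * f v = 0) :
    f y = -cutGreen T h z x y * f x := by
  obtain ⟨φ, h1, h2, -⟩ := eq_greenCol_on_branch hT hz hxy hf
  rw [← h2, h1, cutGreen_of_ne hxy.ne', green, lp.coeFn_smul, Pi.smul_apply, smul_eq_mul]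
  ring

/-- A bound for the flux of `f` through the edge `(x, y)` into the branch of `y`. The left-hand side
is `Im z` times the part of `‖f‖²` that lies in that branch. -/
theorem norm_sq_mul_im_le (hT : T.IsTree) {z : ℂ} (hz : 0 < z.im) {x y : V} (hxy : T.Adj x y)
    {f : L2 V} (hf : ∀ v ∈ branch T x y, ∑ w ∈ nbrs T h v, f w - z * f v = 0) :
    ‖f x‖ ^ 2 * (cutGreen T h z x y).im ≤ z.im * ‖f‖ ^ 2 := by
  obtain ⟨φ, h1, -, h2⟩ := eq_greenCol_on_branch hT hz hxy hf
  rw [cutGreen_of_ne hxy.ne', im_green_self hz]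
  rw [h1, norm_smul, norm_neg] at h2
  calc _ = z.im * (‖f x‖ * ‖greenCol (T.induce {x}ᶜ) (h.induce {x}ᶜ) z ⟨y, hxy.ne'⟩‖) ^ 2 := by
        ring
    _ ≤ _ := by gcongr

/-- The algebraic relations between the Green's function `g` of a tree and the Green's functions
`m x y` at `y` of the tree without the neighbour `x` of `y`. They hold for the spectral parameters
`z` in the upper half plane and pass to the limit on the real axis. -/
structure IsTreeKernel (T : SimpleGraph V) (h : BoundedDegree T) (z : ℂ) (g m : V → V → ℂ) :
    Prop where
  symm : ∀ x y, g x y = g y x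
  step : ∀ x y u, T.Adj x y → u ∉ branch T x y → g y u = -m x y * g x u
  cut_mul : ∀ x y, T.Adj x y → m x y * (z + (∑ c ∈ nbrs T h y, m y c - m y x)) = -1
  self_mul : ∀ x, g x x * (z + ∑ c ∈ nbrs T h x, m x c) = -1

theorem isTreeKernel_green (hT : T.IsTree) {z : ℂ} (hz : 0 < z.im) :
    IsTreeKernel T h z (green T h z) (cutGreen T h z) := by
  classical
  have hstep : ∀ x y u, T.Adj x y → u ∉ branch T x y →
      green T h z y u = -cutGreen T h z x y * green T h z x u := by
    intro x y u hxy hu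
    refine apply_snd_eq hT hz hxy fun v hv => ?_
    rw [sum_greenCol hz, if_neg]
    rintro rfl
    exact hu hv
  have hne : ∀ x, green T h z x x ≠ 0 := fun x h0 => by
    have := im_green_pos (H := T) (h := h) hz x
    rw [h0] at this
    simp at this
  refine ⟨green_symm hz, hstep, fun x y hxy => ?_, fun x => ?_⟩
  · have h1 : ∑ c ∈ (nbrs T h y).erase x, green T h z c x
        = -(∑ c ∈ nbrs T h y, cutGreen T h z y c - cutGreen T h z y x) * green T h z y x := by
      rw [← Finset.sum_erase_eq_sub ((mem_nbrs h).2 hxy.symm), ← Finset.sum_neg_distrib,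
        Finset.sum_mul]
      refine Finset.sum_congr rfl fun c hc => ?_
      rw [Finset.mem_erase, mem_nbrs] at hc
      refine hstep y c x hc.2 fun hx => ?_
      exact hc.1 (eq_of_mem_branch hT hc.2 hxy.symm hx (snd_mem_branch hxy.symm))
    have h2 : ∑ c ∈ nbrs T h y, green T h z c x - z * green T h z y x = if y = x then 1 else 0 :=
      sum_greenCol hz x y
    rw [if_neg hxy.ne'] at h2
    rw [Finset.sum_erase_eq_sub ((mem_nbrs h).2 hxy.symm)] at h1
    rw [hstep x y x hxy fst_notMem_branch] at h1 h2
    apply mul_right_cancel₀ (hne x)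
    linear_combination h2 - h1
  · have h1 : ∑ c ∈ nbrs T h x, green T h z c x
        = -(∑ c ∈ nbrs T h x, cutGreen T h z x c) * green T h z x x := by
      rw [← Finset.sum_neg_distrib, Finset.sum_mul]
      refine Finset.sum_congr rfl fun c hc => ?_
      rw [mem_nbrs] at hc
      exact hstep x c x hc fst_notMem_branch
    have h2 : ∑ c ∈ nbrs T h x, green T h z c x - z * green T h z x x = if x = x then 1 else 0 :=
      sum_greenCol hz x x
    rw [if_pos rfl] at h2
    linear_combination -h2 + h1

theorem norm_cutGreen_le {z : ℂ} (hz : 0 < z.im) {x y : V} (hxy : T.Adj x y) :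
    ‖cutGreen T h z x y‖ ≤ 1 / z.im := by
  rw [cutGreen_of_ne hxy.ne']
  exact norm_green_self_le hz _

theorem mul_norm_sq_le_im_cutGreen {z : ℂ} (hz : 0 < z.im) {x y : V} (hxy : T.Adj x y) :
    z.im * ‖cutGreen T h z x y‖ ^ 2 ≤ (cutGreen T h z x y).im := by
  rw [cutGreen_of_ne hxy.ne']
  exact mul_norm_sq_le_im_green hz _

theorem exists_card_nbrs_le {W : Type*} {H : SimpleGraph W} (h : BoundedDegree H) :
    ∃ D : ℕ, ∀ v, (nbrs H h v).card ≤ D := by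
  obtain ⟨D, hD⟩ := id h
  refine ⟨D, fun v => ?_⟩
  have h1 := hD v
  rw [← (h.finite v).coe_toFinset, Set.encard_coe_eq_coe_finsetCard] at h1
  exact_mod_cast h1

theorem norm_sum_sub_le {D : ℕ} (hD : ∀ v, (nbrs T h v).card ≤ D) {m : V → V → ℂ} {B : ℝ}
    (hB : ∀ x y, T.Adj x y → ‖m x y‖ ≤ B) {x y : V} (hxy : T.Adj x y) :
    ‖∑ c ∈ nbrs T h y, m y c - m y x‖ ≤ D * B := by
  classical
  rw [← Finset.sum_erase_eq_sub ((mem_nbrs h).2 hxy.symm)]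
  have hB0 : 0 ≤ B := (norm_nonneg _).trans (hB x y hxy)
  calc _ ≤ ∑ c ∈ (nbrs T h y).erase x, ‖m y c‖ := norm_sum_le _ _
    _ ≤ ∑ c ∈ (nbrs T h y).erase x, B := Finset.sum_le_sum fun c hc =>
        hB y c ((mem_nbrs h).1 (Finset.mem_of_mem_erase hc))
    _ ≤ D * B := by
        rw [Finset.sum_const, nsmul_eq_mul]
        gcongr
        exact (Finset.card_le_card (Finset.erase_subset _ _)).trans (hD y)

/-- At a fixed spectral parameter in the upper half plane, the imaginary parts are uniformly
bounded from below. -/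
theorem exists_le_im_cutGreen (hT : T.IsTree) {z : ℂ} (hz : 0 < z.im) :
    ∃ c > 0, ∀ x y, T.Adj x y → c ≤ (cutGreen T h z x y).im := by
  obtain ⟨D, hD⟩ := exists_card_nbrs_le h
  set R : ℝ := ‖z‖ + D * (1 / z.im) with hR
  have hz0 : 0 < ‖z‖ := norm_pos_iff.2 (by rintro rfl; simp at hz)
  have hR0 : 0 < R := by positivity
  refine ⟨z.im * (1 / R) ^ 2, by positivity, fun x y hxy => ?_⟩
  refine le_trans ?_ (mul_norm_sq_le_im_cutGreen hz hxy)
  have h1 := congrArg norm ((isTreeKernel_green (h := h) hT hz).cut_mul x y hxy)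
  rw [norm_mul, norm_neg, norm_one] at h1
  have h2 := norm_sum_sub_le (h := h) (m := cutGreen T h z) hD
    (fun x y hxy => norm_cutGreen_le hz hxy) hxy
  have h3 : ‖z + (∑ c ∈ nbrs T h y, cutGreen T h z y c - cutGreen T h z y x)‖ ≤ R :=
    (norm_add_le _ _).trans (add_le_add le_rfl h2)
  gcongr
  rw [div_le_iff₀ hR0, ← h1]
  gcongr

end TreeGreen

/-! ### Estimates for the kernels -/

section Kernel

variable {V : Type*} {T : SimpleGraph V} {h : BoundedDegree T}

namespace IsTreeKernel

variable {z : ℂ} {g m : V → V → ℂ} (hk : IsTreeKernel T h z g m)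
include hk

theorem im_cut {x y : V} (hxy : T.Adj x y) :
    (m x y).im = ‖m x y‖ ^ 2 * (z.im + (∑ c ∈ nbrs T h y, m y c - m y x).im) := by
  have h1 := hk.cut_mul x y hxy
  set M := ∑ c ∈ nbrs T h y, m y c - m y x
  have h2 : (starRingEnd ℂ (m x y)) * (m x y) * (z + M) = -starRingEnd ℂ (m x y) := by
    rw [mul_assoc, h1]; ring
  rw [mul_comm (starRingEnd ℂ (m x y)), Complex.mul_conj, Complex.normSq_eq_norm_sq] at h2
  have h3 := congrArg Complex.im h2
  rw [Complex.im_ofReal_mul] at h3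
  simpa using h3.symm

theorem im_self (x : V) :
    (g x x).im = ‖g x x‖ ^ 2 * (z.im + (∑ c ∈ nbrs T h x, m x c).im) := by
  have h1 := hk.self_mul x
  set M := ∑ c ∈ nbrs T h x, m x c
  have h2 : (starRingEnd ℂ (g x x)) * (g x x) * (z + M) = -starRingEnd ℂ (g x x) := by
    rw [mul_assoc, h1]; ring
  rw [mul_comm (starRingEnd ℂ (g x x)), Complex.mul_conj, Complex.normSq_eq_norm_sq] at h2
  have h3 := congrArg Complex.im h2
  rw [Complex.im_ofReal_mul] at h3
  simpa using h3.symm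

omit hk in
theorem le_im_sum_sub (hmin : ∀ v, 2 ≤ (nbrs T h v).card) {c : ℝ} (hc : 0 < c)
    (hm : ∀ x y, T.Adj x y → c ≤ (m x y).im) {x y : V} (hxy : T.Adj x y) :
    c ≤ (∑ c ∈ nbrs T h y, m y c - m y x).im := by
  classical
  have hx : x ∈ nbrs T h y := (mem_nbrs h).2 hxy.symm
  rw [← Finset.sum_erase_eq_sub hx, Complex.im_sum]
  have hne : ((nbrs T h y).erase x).Nonempty := by
    rw [← Finset.card_pos, Finset.card_erase_of_mem hx]
    have := hmin y
    omega
  obtain ⟨t, ht⟩ := hne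
  have hnn : ∀ t ∈ (nbrs T h y).erase x, c ≤ (m y t).im := fun t ht =>
    hm y t ((mem_nbrs h).1 (Finset.mem_of_mem_erase ht))
  exact (hnn t ht).trans (Finset.single_le_sum (f := fun t => (m y t).im)
    (fun t ht => hc.le.trans (hnn t ht)) ht)

omit hk in
theorem le_im_sum (hmin : ∀ v, 2 ≤ (nbrs T h v).card) {c : ℝ} (hc : 0 < c)
    (hm : ∀ x y, T.Adj x y → c ≤ (m x y).im) (y : V) :
    c ≤ (∑ c ∈ nbrs T h y, m y c).im := by
  have hne : (nbrs T h y).Nonempty := by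
    rw [← Finset.card_pos]
    have := hmin y
    omega
  obtain ⟨x, hx⟩ := hne
  have h1 := le_im_sum_sub hmin hc hm ((mem_nbrs h).1 hx).symm
  have h2 := hm y x ((mem_nbrs h).1 hx)
  rw [Complex.sub_im] at h1
  linarith

variable (hz : 0 ≤ z.im) (hmin : ∀ v, 2 ≤ (nbrs T h v).card) {c : ℝ} (hc : 0 < c)
  (hm : ∀ x y, T.Adj x y → c ≤ (m x y).im)
include hz hmin hc hm

theorem norm_cut_le {x y : V} (hxy : T.Adj x y) : ‖m x y‖ ≤ 1 / c := by
  have h1 := hk.im_cut hxy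
  have h2 := le_im_sum_sub hmin hc hm hxy
  have h3 := (le_abs_self _).trans (Complex.abs_im_le_norm (m x y))
  have h4 : 0 < ‖m x y‖ := (hc.trans_le (hm x y hxy)).trans_le h3
  rw [le_div_iff₀ hc]
  have h5 : ‖m x y‖ ^ 2 * c ≤ (m x y).im := by
    rw [h1]; gcongr; linarith
  have h6 : ‖m x y‖ * (‖m x y‖ * c) ≤ ‖m x y‖ * 1 := by nlinarith
  exact le_of_mul_le_mul_left h6 h4

omit hz hmin hc hm in
theorem self_ne_zero (x : V) : g x x ≠ 0 := by
  intro h0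
  have := hk.self_mul x
  rw [h0] at this
  simp at this

theorem norm_self_le (x : V) : ‖g x x‖ ≤ 1 / c := by
  have h1 := hk.im_self x
  have h2 := le_im_sum hmin hc hm x
  have h3 := (le_abs_self _).trans (Complex.abs_im_le_norm (g x x))
  have h4 : 0 < ‖g x x‖ := norm_pos_iff.2 (hk.self_ne_zero x)
  rw [le_div_iff₀ hc]
  have h5 : ‖g x x‖ ^ 2 * c ≤ (g x x).im := by
    rw [h1]; gcongr; linarith
  have h6 : ‖g x x‖ * (‖g x x‖ * c) ≤ ‖g x x‖ * 1 := by nlinarith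
  exact le_of_mul_le_mul_left h6 h4

theorem exists_le_norm_self : ∃ b > 0, ∀ x, b ≤ ‖g x x‖ := by
  obtain ⟨D, hD⟩ := exists_card_nbrs_le h
  refine ⟨1 / (‖z‖ + D * (1 / c) + 1), by positivity, fun x => ?_⟩
  have h1 := congrArg norm (hk.self_mul x)
  rw [norm_mul, norm_neg, norm_one] at h1
  have h2 : ‖∑ c ∈ nbrs T h x, m x c‖ ≤ D * (1 / c) := by
    calc _ ≤ ∑ c ∈ nbrs T h x, ‖m x c‖ := norm_sum_le _ _
      _ ≤ ∑ t ∈ nbrs T h x, 1 / c := Finset.sum_le_sum fun t ht =>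
          hk.norm_cut_le hz hmin hc hm ((mem_nbrs h).1 ht)
      _ ≤ D * (1 / c) := by
          rw [Finset.sum_const, nsmul_eq_mul]
          gcongr
          exact hD x
  rw [div_le_iff₀ (by positivity)]
  refine h1.symm.le.trans ?_
  gcongr
  refine (norm_add_le _ _).trans ?_
  linarith

omit hz hmin hc hm in
/-- The Green's function is multiplicative along geodesics. -/
theorem mul_self_eq (hT : T.IsTree) {u x w : V}
    (hx : T.dist u w = T.dist u x + T.dist x w) : g u w * g x x = g u x * g x w := by
  induction hn : T.dist x w generalizing w with
  | zero =>
    obtain rfl := (hT.connected.dist_eq_zero_iff).1 hn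
    ring
  | succ k ih =>
    have hxw : w ≠ x := by
      rintro rfl
      simp at hn
    obtain ⟨a, ha, hxa⟩ := exists_adj_mem_branch hT hxw
    have hxa' : x ∉ branch T a w := (notMem_branch_iff hT ha.symm).2 hxa
    have h1 := hxa
    rw [mem_branch, T.dist_comm (u := w), T.dist_comm (u := a)] at h1
    have hua : u ∈ branch T w a := by
      by_contra hua
      have h2 := dist_of_notMem_branch hT ha hua
      have h3 := hT.connected.dist_triangle (u := u) (v := x) (w := a)
      rw [T.dist_comm (u := a), T.dist_comm (u := w)] at h2
      omega
    have h2 := hua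
    rw [mem_branch, T.dist_comm (u := w), T.dist_comm (u := a)] at h2
    have h3 := ih (w := a) (by omega) (by omega)
    rw [hk.symm u w, hk.symm x w, hk.step a w u ha.symm ((notMem_branch_iff hT ha.symm).2 hua),
      hk.step a w x ha.symm hxa', hk.symm a u, hk.symm a x]
    linear_combination (-m a w) * h3

omit hz hmin in
theorem ne_zero (hT : T.IsTree) (u w : V) : g u w ≠ 0 := by
  induction hn : T.dist u w generalizing w with
  | zero =>
    obtain rfl := (hT.connected.dist_eq_zero_iff).1 hn
    exact hk.self_ne_zero u
  | succ k ih =>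
    have hwu : w ≠ u := by
      rintro rfl
      simp at hn
    obtain ⟨a, ha, hua⟩ := exists_adj_mem_branch hT hwu
    have h1 := hua
    rw [mem_branch, T.dist_comm (u := w), T.dist_comm (u := a)] at h1
    rw [hk.symm u w, hk.step a w u ha.symm ((notMem_branch_iff hT ha.symm).2 hua)]
    refine mul_ne_zero (neg_ne_zero.2 fun h0 => ?_) ?_
    · have := hm a w ha.symm
      rw [h0] at this
      simp at this
      linarith
    · rw [hk.symm]
      exact ih a (by omega)

theorem exists_norm_le_of_adj (hT : T.IsTree) :
    ∃ C > 0, ∀ x v w, T.Adj v w → ‖g x v‖ ≤ C * ‖g x w‖ := by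
  refine ⟨1 / c, by positivity, fun x v w hvw => ?_⟩
  by_cases hx : x ∈ branch T v w
  · have hx' : x ∉ branch T w v := fun h1 => (notMem_branch_iff hT hvw.symm).2 hx h1
    rw [hk.symm x v, hk.step w v x hvw.symm hx', hk.symm w x, norm_mul, norm_neg]
    gcongr
    exact hk.norm_cut_le hz hmin hc hm hvw.symm
  · rw [hk.symm x w, hk.step v w x hvw hx, hk.symm v x, norm_mul, norm_neg, ← mul_assoc]
    have h1 : 1 ≤ 1 / c * ‖m v w‖ := by
      rw [one_div, ← div_eq_inv_mul, le_div_iff₀ hc, one_mul]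
      exact (hm v w hvw).trans ((le_abs_self _).trans (Complex.abs_im_le_norm _))
    exact le_mul_of_one_le_left (norm_nonneg _) h1

omit hm in
theorem norm_mul_sqrt_le {x y : V} (hxy : T.Adj x y)
    (hm : ∀ x y, T.Adj x y → c ≤ (m x y).im) :
    ‖m x y‖ * √(∑ t ∈ nbrs T h y, m y t - m y x).im ≤ √(m x y).im := by
  have l := le_im_sum_sub hmin hc hm hxy
  rw [← Real.sqrt_sq (norm_nonneg (m x y)), ← Real.sqrt_mul (by positivity), hk.im_cut hxy]
  apply Real.sqrt_le_sqrt
  gcongr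
  linarith

omit hz in
/-- The recursion `Im m = |m|² (Im z + ∑ Im m)` is contracting when `Im z > 0`. -/
theorem exists_norm_mul_sqrt_le (hz : 0 < z.im) : ∃ r : ℝ, 0 ≤ r ∧ r < 1 ∧ ∀ x y, T.Adj x y →
    ‖m x y‖ * √(∑ t ∈ nbrs T h y, m y t - m y x).im ≤ r * √(m x y).im := by
  obtain ⟨D, hD⟩ := exists_card_nbrs_le h
  set B : ℝ := D * (1 / c) with hB
  have hB0 : 0 ≤ B := by positivity
  refine ⟨√(B / (z.im + B)), by positivity, ?_, fun x y hxy => ?_⟩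
  · rw [Real.sqrt_lt' one_pos, one_pow, div_lt_one (by positivity)]
    linarith
  have l := le_im_sum_sub hmin hc hm hxy
  have u : (∑ t ∈ nbrs T h y, m y t - m y x).im ≤ B :=
    (le_abs_self _).trans ((Complex.abs_im_le_norm _).trans
      (norm_sum_sub_le (m := m) hD (fun x y hxy => hk.norm_cut_le hz.le hmin hc hm hxy) hxy))
  rw [← Real.sqrt_sq (norm_nonneg (m x y)), ← Real.sqrt_mul (by positivity),
    ← Real.sqrt_mul (by positivity), hk.im_cut hxy]
  apply Real.sqrt_le_sqrt
  rw [mul_left_comm]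
  gcongr
  rw [div_mul_eq_mul_div, le_div_iff₀ (by positivity)]
  nlinarith

end IsTreeKernel

theorem sum_erase_im [DecidableEq V] {m : V → V → ℂ} {x y : V} (hxy : T.Adj x y) :
    (∑ t ∈ nbrs T h y, m y t - m y x).im = ∑ t ∈ (nbrs T h y).erase x, (m y t).im := by
  rw [← Finset.sum_erase_eq_sub ((mem_nbrs h).2 hxy.symm), Complex.im_sum]

theorem sum_sqrt_mul_sqrt_le_of_nonneg {ι : Type*} (s : Finset ι) {a b : ι → ℝ}
    (ha : ∀ i ∈ s, 0 ≤ a i) (hb : ∀ i ∈ s, 0 ≤ b i) :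
    ∑ i ∈ s, √(a i) * √(b i) ≤ √(∑ i ∈ s, a i) * √(∑ i ∈ s, b i) := by
  refine (Real.sum_mul_le_sqrt_mul_sqrt s (fun i => √(a i)) (fun i => √(b i))).trans (le_of_eq ?_)
  congr 2 <;> refine Finset.sum_congr rfl fun t ht => Real.sq_sqrt ?_
  · exact ha t ht
  · exact hb t ht

theorem exists_norm_mul_sum_sqrt_le {z₁ z₂ : ℂ} {g₁ m₁ g₂ m₂ : V → V → ℂ}
    (h₁ : IsTreeKernel T h z₁ g₁ m₁) (h₂ : IsTreeKernel T h z₂ g₂ m₂)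
    (hz₁ : 0 < z₁.im) (hz₂ : 0 ≤ z₂.im) (hmin : ∀ v, 2 ≤ (nbrs T h v).card)
    {c : ℝ} (hc : 0 < c) (hm₁ : ∀ x y, T.Adj x y → c ≤ (m₁ x y).im)
    (hm₂ : ∀ x y, T.Adj x y → c ≤ (m₂ x y).im) :
    ∃ r : ℝ, 0 ≤ r ∧ r < 1 ∧ ∀ x y, T.Adj x y →
      ‖m₁ x y‖ * ‖m₂ x y‖ * (∑ t ∈ nbrs T h y, √(m₁ y t).im * √(m₂ y t).im
          - √(m₁ y x).im * √(m₂ y x).im)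
        ≤ r * (√(m₁ x y).im * √(m₂ x y).im) := by
  classical
  obtain ⟨r, hr0, hr1, hr⟩ := h₁.exists_norm_mul_sqrt_le hmin hc hm₁ hz₁
  refine ⟨r, hr0, hr1, fun x y hxy => ?_⟩
  have h0 : ∀ t ∈ (nbrs T h y).erase x, T.Adj y t := fun t ht =>
    (mem_nbrs h).1 (Finset.mem_of_mem_erase ht)
  have hcs := sum_sqrt_mul_sqrt_le_of_nonneg ((nbrs T h y).erase x)
    (fun t ht => hc.le.trans (hm₁ y t (h0 t ht))) (fun t ht => hc.le.trans (hm₂ y t (h0 t ht)))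
  rw [← sum_erase_im hxy, ← sum_erase_im hxy] at hcs
  rw [← Finset.sum_erase_eq_sub (f := fun t => √(m₁ y t).im * √(m₂ y t).im)
    ((mem_nbrs h).2 hxy.symm)]
  have q₁ := hr x y hxy
  have q₂ := h₂.norm_mul_sqrt_le hz₂ hmin hc hxy hm₂
  set S₁ := (∑ t ∈ nbrs T h y, m₁ y t - m₁ y x).im
  set S₂ := (∑ t ∈ nbrs T h y, m₂ y t - m₂ y x).im
  calc _ ≤ ‖m₁ x y‖ * ‖m₂ x y‖ * (√S₁ * √S₂) := by gcongr
    _ = (‖m₁ x y‖ * √S₁) * (‖m₂ x y‖ * √S₂) := by ring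
    _ ≤ (r * √(m₁ x y).im) * √(m₂ x y).im := by gcongr
    _ = _ := by ring

/-- The product of two kernels is summable, uniformly in the base point, as soon as one of the
spectral parameters is in the open upper half plane. -/
theorem exists_sum_norm_mul_norm_le (hT : T.IsTree) {z₁ z₂ : ℂ} {g₁ m₁ g₂ m₂ : V → V → ℂ}
    (h₁ : IsTreeKernel T h z₁ g₁ m₁) (h₂ : IsTreeKernel T h z₂ g₂ m₂)
    (hz₁ : 0 < z₁.im) (hz₂ : 0 ≤ z₂.im) (hmin : ∀ v, 2 ≤ (nbrs T h v).card)
    {c : ℝ} (hc : 0 < c) (hm₁ : ∀ x y, T.Adj x y → c ≤ (m₁ x y).im)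
    (hm₂ : ∀ x y, T.Adj x y → c ≤ (m₂ x y).im) :
    ∃ C : ℝ, ∀ (u : V) (F : Finset V), ∑ v ∈ F, ‖g₁ u v‖ * ‖g₂ u v‖ ≤ C := by
  classical
  obtain ⟨D, hD⟩ := exists_card_nbrs_le h
  obtain ⟨r, hr0, hr1, hr⟩ := exists_norm_mul_sum_sqrt_le h₁ h₂ hz₁ hz₂ hmin hc hm₁ hm₂
  set w : V → V → ℝ := fun x y => √(m₁ x y).im * √(m₂ x y).im with hw
  have hwc : ∀ x y, T.Adj x y → c ≤ w x y := fun x y hxy => by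
    rw [← Real.mul_self_sqrt hc.le]
    exact mul_le_mul (Real.sqrt_le_sqrt (hm₁ x y hxy)) (Real.sqrt_le_sqrt (hm₂ x y hxy))
      (by positivity) (by positivity)
  have n₁ : ∀ x y, T.Adj x y → ‖m₁ x y‖ ≤ 1 / c := fun x y => h₁.norm_cut_le hz₁.le hmin hc hm₁
  have n₂ : ∀ x y, T.Adj x y → ‖m₂ x y‖ ≤ 1 / c := fun x y => h₂.norm_cut_le hz₂ hmin hc hm₂
  have hwC : ∀ x y, T.Adj x y → w x y ≤ 1 / c := fun x y hxy => by
    have h0 : (0 : ℝ) ≤ 1 / c := by positivity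
    rw [← Real.mul_self_sqrt h0]
    refine mul_le_mul (Real.sqrt_le_sqrt ?_) (Real.sqrt_le_sqrt ?_)
      (by positivity) (by positivity)
    · exact ((le_abs_self _).trans (Complex.abs_im_le_norm _)).trans (n₁ x y hxy)
    · exact ((le_abs_self _).trans (Complex.abs_im_le_norm _)).trans (n₂ x y hxy)
  -- `K` is chosen such that `|m₁ m₂| + K r w ≤ K w`.
  set K : ℝ := 1 / c * (1 / c) / ((1 - r) * c) with hK
  have h1r : 0 < 1 - r := by linarith
  have hK0 : 0 ≤ K := by positivity
  have hKw : ∀ x y, T.Adj x y → ‖m₁ x y‖ * ‖m₂ x y‖ + K * (r * w x y) ≤ K * w x y := by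
    intro x y hxy
    have e1 : K * ((1 - r) * c) = 1 / c * (1 / c) := by
      rw [hK]; field_simp
    have e2 : K * ((1 - r) * c) ≤ K * ((1 - r) * w x y) := by
      have := hwc x y hxy
      gcongr
    have e3 : ‖m₁ x y‖ * ‖m₂ x y‖ ≤ 1 / c * (1 / c) :=
      mul_le_mul (n₁ x y hxy) (n₂ x y hxy) (norm_nonneg _) (by positivity)
    linarith
  have key : ∀ (u : V) (F : Finset V) (k : ℕ) (x y : V), T.Adj x y → u ∉ branch T x y →
      ∑ v ∈ F, (if v ∈ branch T x y ∧ T.dist y v < k then ‖g₁ u v‖ * ‖g₂ u v‖ else 0)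
        ≤ K * w x y * (‖g₁ u x‖ * ‖g₂ u x‖) := by
    intro u F k
    induction k with
    | zero =>
      intro x y hxy _
      have := hc.trans_le (hwc x y hxy)
      simp only [not_lt_zero, and_false, if_false, Finset.sum_const_zero]
      positivity
    | succ k ih =>
      intro x y hxy hu
      have hx : x ∈ nbrs T h y := (mem_nbrs h).2 hxy.symm
      have huy : u ∈ branch T y x := (notMem_branch_iff hT hxy).1 hu
      have hpt : ∀ v, (if v ∈ branch T x y ∧ T.dist y v < k + 1 then ‖g₁ u v‖ * ‖g₂ u v‖ else 0)
          ≤ (if v = y then ‖g₁ u v‖ * ‖g₂ u v‖ else 0) + ∑ t ∈ (nbrs T h y).erase x,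
            (if v ∈ branch T y t ∧ T.dist t v < k then ‖g₁ u v‖ * ‖g₂ u v‖ else 0) := by
        intro v
        have hnn : ∀ t ∈ (nbrs T h y).erase x, (0 : ℝ) ≤
            (if v ∈ branch T y t ∧ T.dist t v < k then ‖g₁ u v‖ * ‖g₂ u v‖ else 0) :=
          fun t _ => by split_ifs <;> positivity
        by_cases hv : v ∈ branch T x y ∧ T.dist y v < k + 1
        · rw [if_pos hv]
          by_cases hvy : v = y
          · rw [if_pos hvy]
            exact le_add_of_nonneg_right (Finset.sum_nonneg hnn)
          · rw [if_neg hvy, zero_add]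
            obtain ⟨t, ht, hvt⟩ := exists_adj_mem_branch hT (Ne.symm hvy)
            have htx : t ≠ x := by
              rintro rfl
              exact (notMem_branch_iff hT ht).2 hv.1 hvt
            have hmem : t ∈ (nbrs T h y).erase x := Finset.mem_erase.2 ⟨htx, (mem_nbrs h).2 ht⟩
            refine le_trans (le_of_eq ?_) (Finset.single_le_sum hnn hmem)
            rw [if_pos]
            refine ⟨hvt, ?_⟩
            rw [mem_branch] at hvt
            omega
        · rw [if_neg hv]
          refine add_nonneg ?_ (Finset.sum_nonneg hnn)
          split_ifs <;> positivity
      have hyg : ‖g₁ u y‖ * ‖g₂ u y‖ = ‖m₁ x y‖ * ‖m₂ x y‖ * (‖g₁ u x‖ * ‖g₂ u x‖) := by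
        rw [h₁.symm u y, h₂.symm u y, h₁.step x y u hxy hu, h₂.step x y u hxy hu, h₁.symm x u,
          h₂.symm x u, norm_mul, norm_mul, norm_neg, norm_neg]
        ring
      calc _ ≤ ∑ v ∈ F, ((if v = y then ‖g₁ u v‖ * ‖g₂ u v‖ else 0)
              + ∑ t ∈ (nbrs T h y).erase x,
                (if v ∈ branch T y t ∧ T.dist t v < k then ‖g₁ u v‖ * ‖g₂ u v‖ else 0)) :=
            Finset.sum_le_sum fun v _ => hpt v
        _ = (∑ v ∈ F, if v = y then ‖g₁ u v‖ * ‖g₂ u v‖ else 0)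
              + ∑ t ∈ (nbrs T h y).erase x, ∑ v ∈ F,
                (if v ∈ branch T y t ∧ T.dist t v < k then ‖g₁ u v‖ * ‖g₂ u v‖ else 0) := by
            rw [Finset.sum_add_distrib, Finset.sum_comm]
        _ ≤ ‖g₁ u y‖ * ‖g₂ u y‖
              + ∑ t ∈ (nbrs T h y).erase x, K * w y t * (‖g₁ u y‖ * ‖g₂ u y‖) := by
            refine add_le_add ?_ (Finset.sum_le_sum fun t ht => ?_)
            · rw [Finset.sum_ite_eq']
              split_ifs
              · exact le_rfl
              · positivity
            · rw [Finset.mem_erase, mem_nbrs] at ht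
              refine ih y t ht.2 fun hut => ?_
              exact ht.1 (eq_of_mem_branch hT ht.2 hxy.symm hut huy)
        _ = (‖m₁ x y‖ * ‖m₂ x y‖ + K * (‖m₁ x y‖ * ‖m₂ x y‖ *
              (∑ t ∈ nbrs T h y, w y t - w y x))) * (‖g₁ u x‖ * ‖g₂ u x‖) := by
            rw [← Finset.sum_mul, ← Finset.mul_sum, hyg, Finset.sum_erase_eq_sub hx]
            ring
        _ ≤ (‖m₁ x y‖ * ‖m₂ x y‖ + K * (r * w x y)) * (‖g₁ u x‖ * ‖g₂ u x‖) := by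
            have := hr x y hxy
            gcongr
        _ ≤ _ := by
            have := hKw x y hxy
            gcongr
  refine ⟨1 / c * (1 / c) + D * (K * (1 / c) * (1 / c * (1 / c))), fun u F => ?_⟩
  have hgu : ‖g₁ u u‖ * ‖g₂ u u‖ ≤ 1 / c * (1 / c) :=
    mul_le_mul (h₁.norm_self_le hz₁.le hmin hc hm₁ u) (h₂.norm_self_le hz₂ hmin hc hm₂ u)
      (norm_nonneg _) (by positivity)
  set k : ℕ := F.sup (fun v => T.dist u v) with hkk
  have hpt : ∀ v ∈ F, ‖g₁ u v‖ * ‖g₂ u v‖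
      ≤ (if v = u then ‖g₁ u v‖ * ‖g₂ u v‖ else 0) + ∑ t ∈ nbrs T h u,
        (if v ∈ branch T u t ∧ T.dist t v < k then ‖g₁ u v‖ * ‖g₂ u v‖ else 0) := by
    intro v hvF
    have hnn : ∀ t ∈ nbrs T h u, (0 : ℝ) ≤
        (if v ∈ branch T u t ∧ T.dist t v < k then ‖g₁ u v‖ * ‖g₂ u v‖ else 0) :=
      fun t _ => by split_ifs <;> positivity
    by_cases hvu : v = u
    · rw [if_pos hvu]
      exact le_add_of_nonneg_right (Finset.sum_nonneg hnn)
    · rw [if_neg hvu, zero_add]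
      obtain ⟨t, ht, hvt⟩ := exists_adj_mem_branch hT (Ne.symm hvu)
      refine le_trans (le_of_eq ?_) (Finset.single_le_sum hnn ((mem_nbrs h).2 ht))
      rw [if_pos]
      refine ⟨hvt, ?_⟩
      rw [mem_branch] at hvt
      have : T.dist u v ≤ k := Finset.le_sup (f := fun v => T.dist u v) hvF
      omega
  calc _ ≤ ∑ v ∈ F, ((if v = u then ‖g₁ u v‖ * ‖g₂ u v‖ else 0) + ∑ t ∈ nbrs T h u,
        (if v ∈ branch T u t ∧ T.dist t v < k then ‖g₁ u v‖ * ‖g₂ u v‖ else 0)) :=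
        Finset.sum_le_sum hpt
    _ = (∑ v ∈ F, if v = u then ‖g₁ u v‖ * ‖g₂ u v‖ else 0) + ∑ t ∈ nbrs T h u, ∑ v ∈ F,
        (if v ∈ branch T u t ∧ T.dist t v < k then ‖g₁ u v‖ * ‖g₂ u v‖ else 0) := by
        rw [Finset.sum_add_distrib, Finset.sum_comm]
    _ ≤ ‖g₁ u u‖ * ‖g₂ u u‖ + ∑ t ∈ nbrs T h u, K * w u t * (‖g₁ u u‖ * ‖g₂ u u‖) := by
        refine add_le_add ?_ (Finset.sum_le_sum fun t ht => ?_)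
        · rw [Finset.sum_ite_eq']
          split_ifs
          · exact le_rfl
          · positivity
        · exact key u F k u t ((mem_nbrs h).1 ht) fst_notMem_branch
    _ ≤ 1 / c * (1 / c) + ∑ t ∈ nbrs T h u, K * (1 / c) * (1 / c * (1 / c)) := by
        refine add_le_add hgu (Finset.sum_le_sum fun t ht => ?_)
        have := hwC u t ((mem_nbrs h).1 ht)
        gcongr
    _ ≤ _ := by
        rw [Finset.sum_const, nsmul_eq_mul]
        have := hD u
        gcongr

end Kernel

/-! ### Dependence on types -/

section Types

variable {V : Type*} {n : ℕ} {d : Matrix (Fin n) (Fin n) ℕ} {T : SimpleGraph V} {τ : V → Fin n}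
  {h : BoundedDegree T}

theorem IsUniversalCover.card_filter_nbrs (hT : IsUniversalCover d T τ) (v : V) (j : Fin n) :
    ((nbrs T h v).filter (fun w => τ w = j)).card = d (τ v) j := by
  have h1 := hT.encard_neighbors v j
  have h2 : {w | T.Adj v w ∧ τ w = j} = ((nbrs T h v).filter (fun w => τ w = j) : Finset V) := by
    ext w
    simp [mem_nbrs]
  rw [h2, Set.encard_coe_eq_coe_finsetCard] at h1
  exact_mod_cast h1

theorem IsUniversalCover.sum_nbrs (hT : IsUniversalCover d T τ) {M : Type*} [AddCommMonoid M]
    (F : Fin n → M) (v : V) : ∑ w ∈ nbrs T h v, F (τ w) = ∑ j, d (τ v) j • F j := by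
  rw [← Finset.sum_fiberwise (nbrs T h v) τ]
  refine Finset.sum_congr rfl fun j _ => ?_
  rw [← hT.card_filter_nbrs (h := h) v j, ← Finset.sum_const]
  exact Finset.sum_congr rfl fun w hw => by rw [(Finset.mem_filter.1 hw).2]

theorem IsUniversalCover.two_le_card_nbrs (hd : IsExpanding d) (hT : IsUniversalCover d T τ)
    (v : V) : 2 ≤ (nbrs T h v).card := by
  have := hT.sum_nbrs (h := h) (fun _ => 1) v
  simp only [Finset.sum_const, smul_eq_mul, mul_one] at this
  rw [this]
  exact hd.two_le _

/-- Edges with the same types have the same numbers of continuations of every type. -/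
theorem IsUniversalCover.exists_equiv_erase [DecidableEq V] (hT : IsUniversalCover d T τ)
    {x y x' y' : V} (hxy : T.Adj x y) (hxy' : T.Adj x' y') (hx : τ x = τ x') (hy : τ y = τ y') :
    ∃ e : {t // t ∈ (nbrs T h y).erase x} ≃ {t // t ∈ (nbrs T h y').erase x'},
      ∀ t, τ (e t) = τ t := by
  have hcard : ∀ (x y : V), T.Adj x y → ∀ j,
      Fintype.card {t : {t // t ∈ (nbrs T h y).erase x} // τ t = j}
        = d (τ y) j - if τ x = j then 1 else 0 := by
    intro x y hxy j
    rw [← hT.card_filter_nbrs (h := h) y j, Fintype.card_subtype,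
      ← Finset.card_map (Function.Embedding.subtype _)]
    have h1 : Finset.map (Function.Embedding.subtype _)
        (Finset.univ.filter fun t : {t // t ∈ (nbrs T h y).erase x} => τ t = j)
        = ((nbrs T h y).filter (fun w => τ w = j)).erase x := by
      ext w
      simp only [Finset.mem_map, Finset.mem_filter, Finset.mem_univ, true_and,
        Function.Embedding.subtype_apply, Subtype.exists, Finset.mem_erase, exists_and_left,
        exists_prop]
      constructor
      · rintro ⟨a, ha, ⟨h1, h2⟩, rfl⟩
        exact ⟨h1, h2, ha⟩
      · rintro ⟨h1, h2, h3⟩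
        exact ⟨w, h3, ⟨h1, h2⟩, rfl⟩
    rw [h1]
    split_ifs with hj
    · rw [Finset.card_erase_of_mem]
      exact Finset.mem_filter.2 ⟨(mem_nbrs h).2 hxy.symm, hj⟩
    · rw [Finset.erase_eq_of_notMem, Nat.sub_zero]
      exact fun h2 => hj (Finset.mem_filter.1 h2).2
  have heq : ∀ j, Fintype.card {t : {t // t ∈ (nbrs T h y).erase x} // τ t = j}
      = Fintype.card {t : {t // t ∈ (nbrs T h y').erase x'} // τ t = j} := fun j => by
    rw [hcard x y hxy j, hcard x' y' hxy' j, hx, hy]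
  refine ⟨(Equiv.sigmaFiberEquiv (fun t : {t // t ∈ (nbrs T h y).erase x} => τ t)).symm.trans
    ((Equiv.sigmaCongrRight fun j => Fintype.equivOfCardEq (heq j)).trans
    (Equiv.sigmaFiberEquiv (fun t : {t // t ∈ (nbrs T h y').erase x'} => τ t))), fun t => ?_⟩
  simp only [Equiv.trans_apply]
  exact (Fintype.equivOfCardEq (heq (τ t)) ⟨t, rfl⟩).2

/-- The Green's function of a branch depends on the types of its root edge only, since the
recursion satisfied by these functions is a contraction (for a hyperbolic distance). -/
theorem IsUniversalCover.cutGreen_eq (hd : IsExpanding d) (hT : IsUniversalCover d T τ) {z : ℂ}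
    (hz : 0 < z.im) {x y x' y' : V} (hxy : T.Adj x y) (hxy' : T.Adj x' y') (hx : τ x = τ x')
    (hy : τ y = τ y') : cutGreen T h z x y = cutGreen T h z x' y' := by
  classical
  have hk := isTreeKernel_green (h := h) hT.isTree hz
  obtain ⟨c, hc, hm⟩ := exists_le_im_cutGreen (h := h) hT.isTree hz
  have hmin := hT.two_le_card_nbrs (h := h) hd
  obtain ⟨r, hr0, hr1, hr⟩ := hk.exists_norm_mul_sqrt_le hmin hc hm hz
  set m := cutGreen T h z
  set Q : ℝ := (1 / c + 1 / c) / c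
  have hQ : 0 ≤ Q := by positivity
  have key : ∀ (k : ℕ) (x y x' y' : V), T.Adj x y → T.Adj x' y' → τ x = τ x' → τ y = τ y' →
      ‖m x y - m x' y'‖ ≤ Q * (r ^ 2) ^ k * (√(m x y).im * √(m x' y').im) := by
    intro k
    induction k with
    | zero =>
      intro x y x' y' hxy hxy' _ _
      have h1 : c ≤ √(m x y).im * √(m x' y').im := by
        rw [← Real.mul_self_sqrt hc.le]
        exact mul_le_mul (Real.sqrt_le_sqrt (hm x y hxy)) (Real.sqrt_le_sqrt (hm x' y' hxy'))
          (by positivity) (by positivity)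
      calc _ ≤ ‖m x y‖ + ‖m x' y'‖ := norm_sub_le _ _
        _ ≤ 1 / c + 1 / c := add_le_add (hk.norm_cut_le hz.le hmin hc hm hxy)
            (hk.norm_cut_le hz.le hmin hc hm hxy')
        _ = Q * (r ^ 2) ^ 0 * c := by
            rw [pow_zero, mul_one, div_mul_cancel₀ _ hc.ne']
        _ ≤ _ := by gcongr
    | succ k ih =>
      intro x y x' y' hxy hxy' hx hy
      have e1 := hk.cut_mul x y hxy
      have e2 := hk.cut_mul x' y' hxy'
      have q1 := hr x y hxy
      have q2 := hr x' y' hxy'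
      rw [sum_erase_im hxy] at q1
      rw [sum_erase_im hxy'] at q2
      rw [← Finset.sum_erase_eq_sub ((mem_nbrs h).2 hxy.symm)] at e1
      rw [← Finset.sum_erase_eq_sub ((mem_nbrs h).2 hxy'.symm)] at e2
      obtain ⟨e, he⟩ := hT.exists_equiv_erase (h := h) hxy hxy' hx hy
      have adj1 : ∀ t : {t // t ∈ (nbrs T h y).erase x}, T.Adj y t := fun t =>
        (mem_nbrs h).1 (Finset.mem_of_mem_erase t.2)
      have adj2 : ∀ t : {t // t ∈ (nbrs T h y').erase x'}, T.Adj y' t := fun t =>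
        (mem_nbrs h).1 (Finset.mem_of_mem_erase t.2)
      have hS : ‖∑ t ∈ (nbrs T h y).erase x, m y t - ∑ t ∈ (nbrs T h y').erase x', m y' t‖
          ≤ Q * (r ^ 2) ^ k * (√(∑ t ∈ (nbrs T h y).erase x, (m y t).im)
            * √(∑ t ∈ (nbrs T h y').erase x', (m y' t).im)) := by
        have s2 : ∀ {M : Type} [AddCommMonoid M] (F : V → M), ∑ t ∈ (nbrs T h y').erase x', F t
            = ∑ t : {t // t ∈ (nbrs T h y).erase x}, F (e t) := fun F => by
          rw [← Finset.sum_coe_sort ((nbrs T h y').erase x'), ← e.sum_comp]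
        rw [s2, s2, ← Finset.sum_coe_sort ((nbrs T h y).erase x),
          ← Finset.sum_coe_sort ((nbrs T h y).erase x), ← Finset.sum_sub_distrib]
        calc _ ≤ ∑ t : {t // t ∈ (nbrs T h y).erase x}, ‖m y t - m y' (e t)‖ := norm_sum_le _ _
          _ ≤ ∑ t : {t // t ∈ (nbrs T h y).erase x},
              Q * (r ^ 2) ^ k * (√(m y t).im * √(m y' (e t)).im) :=
              Finset.sum_le_sum fun t _ => ih y t y' (e t) (adj1 t) (adj2 _) hy (he t).symm
          _ = Q * (r ^ 2) ^ k * ∑ t : {t // t ∈ (nbrs T h y).erase x},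
              √(m y t).im * √(m y' (e t)).im := by rw [Finset.mul_sum]
          _ ≤ _ := by
              gcongr
              exact sum_sqrt_mul_sqrt_le_of_nonneg _
                (fun t _ => hc.le.trans (hm y t (adj1 t)))
                (fun t _ => hc.le.trans (hm y' (e t) (adj2 _)))
      have hdiff : m x y - m x' y' = m x y * m x' y' *
          (∑ t ∈ (nbrs T h y).erase x, m y t - ∑ t ∈ (nbrs T h y').erase x', m y' t) := by
        linear_combination (-m x' y') * e1 + m x y * e2
      rw [hdiff, norm_mul, norm_mul]
      set S1 := ∑ t ∈ (nbrs T h y).erase x, (m y t).im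
      set S2 := ∑ t ∈ (nbrs T h y').erase x', (m y' t).im
      calc _ ≤ ‖m x y‖ * ‖m x' y'‖ * (Q * (r ^ 2) ^ k * (√S1 * √S2)) := by gcongr
        _ = Q * (r ^ 2) ^ k * ((‖m x y‖ * √S1) * (‖m x' y'‖ * √S2)) := by ring
        _ ≤ Q * (r ^ 2) ^ k * ((r * √(m x y).im) * (r * √(m x' y').im)) := by gcongr
        _ = _ := by ring
  have hlim : Tendsto (fun k : ℕ => Q * (r ^ 2) ^ k * (√(m x y).im * √(m x' y').im)) atTop
      (𝓝 (Q * 0 * (√(m x y).im * √(m x' y').im))) :=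
    ((tendsto_pow_atTop_nhds_zero_of_lt_one (by positivity) (by nlinarith)).const_mul Q).mul_const _
  rw [mul_zero, zero_mul] at hlim
  have h1 := ge_of_tendsto' hlim fun k => key k x y x' y' hxy hxy' hx hy
  exact sub_eq_zero.1 (norm_le_zero_iff.1 h1)

/-! ### Boundary values on the real axis -/

theorem pt_im (lam η : ℝ) : (pt lam η).im = η := by simp [pt]

theorem tendsto_pt (lam : ℝ) : Tendsto (pt lam) (𝓝[>] 0) (𝓝 (lam : ℂ)) := by
  have : Continuous (pt lam) := by
    unfold pt
    fun_prop
  have h1 := (this.tendsto 0).mono_left (nhdsWithin_le_nhds (s := Set.Ioi 0))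
  simpa [pt] using h1

/-- At a regular point the Green's function has boundary values, which satisfy the relations of a
tree kernel with imaginary parts that are uniformly bounded from below. -/
theorem IsUniversalCover.exists_boundary_kernel (hd : IsExpanding d) (hT : IsUniversalCover d T τ)
    {lam : ℝ} (hreg : IsRegularPoint T h lam) :
    ∃ m : V → V → ℂ, IsTreeKernel T h lam (greenReal T h lam) m ∧
      (∃ c > 0, ∀ x y, T.Adj x y → c ≤ (m x y).im) ∧
      (∀ x y, T.Adj x y →
        Tendsto (fun η => cutGreen T h (pt lam η) x y) (𝓝[>] 0) (𝓝 (m x y))) ∧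
      ∀ x y, Tendsto (fun η => green T h (pt lam η) x y) (𝓝[>] 0) (𝓝 (greenReal T h lam x y)) := by
  classical
  have hpos : ∀ᶠ η : ℝ in 𝓝[>] 0, 0 < (pt lam η).im := by
    filter_upwards [self_mem_nhdsWithin] with η hη
    rw [pt_im]
    exact hη
  have hker : ∀ᶠ η : ℝ in 𝓝[>] 0,
      IsTreeKernel T h (pt lam η) (green T h (pt lam η)) (cutGreen T h (pt lam η)) := by
    filter_upwards [hpos] with η hη
    exact isTreeKernel_green hT.isTree hη
  have hex : ∀ x y, ∃ m : ℂ, T.Adj x y →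
      Tendsto (fun η => cutGreen T h (pt lam η) x y) (𝓝[>] 0) (𝓝 m) ∧ 0 < m.im := by
    intro x y
    by_cases hxy : T.Adj x y
    · obtain ⟨-, m, hm, hm0⟩ := hreg y x hxy.symm
      refine ⟨m, fun _ => ⟨?_, hm0⟩⟩
      simpa only [cutGreen_of_ne hxy.ne'] using hm
    · exact ⟨0, fun h0 => absurd h0 hxy⟩
  choose m hm using hex
  have hgex : ∀ x y, ∃ g : ℂ, Tendsto (fun η => green T h (pt lam η) x y) (𝓝[>] 0) (𝓝 g) := by
    intro x y
    induction hn : T.dist x y generalizing y with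
    | zero =>
      obtain rfl := (hT.isTree.connected.dist_eq_zero_iff).1 hn
      have hne : (nbrs T h x).Nonempty := by
        rw [← Finset.card_pos]
        have := hT.two_le_card_nbrs (h := h) hd x
        omega
      obtain ⟨t, ht⟩ := hne
      exact (hreg x t ((mem_nbrs h).1 ht)).1
    | succ k ih =>
      have hyx : y ≠ x := by
        rintro rfl
        simp at hn
      obtain ⟨a, ha, hxa⟩ := exists_adj_mem_branch hT.isTree hyx
      have h1 := hxa
      rw [mem_branch, T.dist_comm (u := y), T.dist_comm (u := a)] at h1
      obtain ⟨g, hg⟩ := ih a (by omega)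
      refine ⟨-m a y * g, (((hm a y ha.symm).1.neg).mul hg).congr' ?_⟩
      filter_upwards [hker] with η hη
      rw [hη.symm x y, hη.step a y x ha.symm ((notMem_branch_iff hT.isTree ha.symm).2 hxa),
        hη.symm x a]
  have hg : ∀ x y, Tendsto (fun η => green T h (pt lam η) x y) (𝓝[>] 0)
      (𝓝 (greenReal T h lam x y)) := fun x y => by
    obtain ⟨g, hg⟩ := hgex x y
    have : greenReal T h lam x y = g := hg.limUnder_eq
    rwa [this]
  refine ⟨m, ⟨fun x y => ?_, fun x y u hxy hu => ?_, fun x y hxy => ?_, fun x => ?_⟩, ?_,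
    fun x y hxy => (hm x y hxy).1, hg⟩
  · refine tendsto_nhds_unique (hg x y) ((hg y x).congr' ?_)
    filter_upwards [hker] with η hη using hη.symm y x
  · refine tendsto_nhds_unique (hg y u) ((((hm x y hxy).1.neg).mul (hg x u)).congr' ?_)
    filter_upwards [hker] with η hη using (hη.step x y u hxy hu).symm
  · have hs : Tendsto (fun η => ∑ c ∈ nbrs T h y, cutGreen T h (pt lam η) y c) (𝓝[>] 0)
        (𝓝 (∑ c ∈ nbrs T h y, m y c)) :=
      tendsto_finsetSum _ fun c hc => (hm y c ((mem_nbrs h).1 hc)).1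
    refine tendsto_nhds_unique ((hm x y hxy).1.mul
      ((tendsto_pt lam).add (hs.sub (hm y x hxy.symm).1))) (tendsto_const_nhds.congr' ?_)
    filter_upwards [hker] with η hη using (hη.cut_mul x y hxy).symm
  · have hs : Tendsto (fun η => ∑ c ∈ nbrs T h x, cutGreen T h (pt lam η) x c) (𝓝[>] 0)
        (𝓝 (∑ c ∈ nbrs T h x, m x c)) :=
      tendsto_finsetSum _ fun c hc => (hm x c ((mem_nbrs h).1 hc)).1
    refine tendsto_nhds_unique ((hg x x).mul ((tendsto_pt lam).add hs))
      (tendsto_const_nhds.congr' ?_)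
    filter_upwards [hker] with η hη using (hη.self_mul x).symm
  · -- The values depend on the types only, so that there are finitely many of them.
    have htype : ∀ x y x' y', T.Adj x y → T.Adj x' y' → τ x = τ x' → τ y = τ y' →
        m x y = m x' y' := fun x y x' y' hxy hxy' hx hy => by
      refine tendsto_nhds_unique (hm x y hxy).1 ((hm x' y' hxy').1.congr' ?_)
      filter_upwards [hpos] with η hη using (hT.cutGreen_eq hd hη hxy hxy' hx hy).symm
    have hfin : ∀ p : Fin n × Fin n, ∃ c : ℝ, 0 < c ∧
        ∀ x y, T.Adj x y → τ x = p.1 → τ y = p.2 → c ≤ (m x y).im := by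
      intro p
      by_cases hp : ∃ x y, T.Adj x y ∧ τ x = p.1 ∧ τ y = p.2
      · obtain ⟨x, y, hxy, hx, hy⟩ := hp
        refine ⟨(m x y).im, (hm x y hxy).2, fun x' y' hxy' hx' hy' => ?_⟩
        rw [htype x y x' y' hxy hxy' (hx.trans hx'.symm) (hy.trans hy'.symm)]
      · refine ⟨1, one_pos, fun x y hxy hx hy => absurd ⟨x, y, hxy, hx, hy⟩ hp⟩
    choose c hc0 hc using hfin
    have hV : Nonempty V := hT.isTree.connected.nonempty
    have : Nonempty (Fin n × Fin n) := hV.map fun v => (τ v, τ v)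
    obtain ⟨p0, hp0⟩ := Finite.exists_min c
    exact ⟨c p0, hc0 p0, fun x y hxy => (hp0 (τ x, τ y)).trans (hc (τ x, τ y) x y hxy rfl rfl)⟩

end Types

/-! ### The test vectors reproduce the Gaussian wave -/

section Transform

variable {V : Type*} {T : SimpleGraph V} {h : BoundedDegree T}

/-- The median `x` of `u`, `v`, `w` factorizes the summand through three kernels that are based at
`x`, and the sums over `v` and over `w` are bounded uniformly in `x`. -/
theorem summable_kernel_prod (hT : T.IsTree) {z₁ z₂ : ℂ} {g₁ m₁ g₂ m₂ : V → V → ℂ}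
    (h₁ : IsTreeKernel T h z₁ g₁ m₁) (h₂ : IsTreeKernel T h z₂ g₂ m₂)
    (hz₁ : 0 < z₁.im) (hz₂ : 0 ≤ z₂.im) (hmin : ∀ v, 2 ≤ (nbrs T h v).card)
    {c : ℝ} (hc : 0 < c) (hm₁ : ∀ x y, T.Adj x y → c ≤ (m₁ x y).im)
    (hm₂ : ∀ x y, T.Adj x y → c ≤ (m₂ x y).im) (u : V) (hu : Summable fun v => ‖g₁ u v‖ ^ 2) :
    Summable fun p : V × V => ‖g₁ u p.1‖ * ‖g₁ u p.2‖ * ‖g₂ p.1 p.2‖ := by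
  classical
  obtain ⟨C, hC⟩ := exists_sum_norm_mul_norm_le hT h₁ h₂ hz₁ hz₂ hmin hc hm₁ hm₂
  obtain ⟨b₁, hb₁, hg₁⟩ := h₁.exists_le_norm_self hz₁.le hmin hc hm₁
  obtain ⟨b₂, hb₂, hg₂⟩ := h₂.exists_le_norm_self hz₂ hmin hc hm₂
  have hC0 : 0 ≤ C := by simpa using hC u ∅
  choose x hxuv hxuw hxvw using fun p : V × V => exists_median hT u p.1 p.2
  set t : V → V → V → ℝ := fun x v w =>
    (1 / b₁ * (1 / b₁) * (1 / b₂)) * (‖g₁ u x‖ ^ 2) * ((‖g₁ x v‖ * ‖g₂ x v‖) *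
      (‖g₁ x w‖ * ‖g₂ x w‖)) with ht
  have ht0 : ∀ x v w, 0 ≤ t x v w := fun x v w => by positivity
  have hle : ∀ p : V × V, ‖g₁ u p.1‖ * ‖g₁ u p.2‖ * ‖g₂ p.1 p.2‖ ≤ t (x p) p.1 p.2 := by
    have fact : ∀ {z : ℂ} {g m : V → V → ℂ} {b : ℝ}, IsTreeKernel T h z g m → 0 < b →
        (∀ x, b ≤ ‖g x x‖) → ∀ u x w, T.dist u w = T.dist u x + T.dist x w →
        ‖g u w‖ ≤ 1 / b * (‖g u x‖ * ‖g x w‖) := by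
      intro z g m b hk hb hg u x w hx
      have h1 := congrArg norm (hk.mul_self_eq hT hx)
      rw [norm_mul, norm_mul] at h1
      rw [← h1, one_div, ← div_eq_inv_mul, le_div_iff₀ hb]
      have := hg x
      gcongr
    intro p
    have f1 := fact h₁ hb₁ hg₁ u (x p) p.1 (hxuv p)
    have f2 := fact h₁ hb₁ hg₁ u (x p) p.2 (hxuw p)
    have f3 := fact h₂ hb₂ hg₂ p.1 (x p) p.2 (hxvw p)
    rw [h₂.symm p.1 (x p)] at f3
    calc _ ≤ (1 / b₁ * (‖g₁ u (x p)‖ * ‖g₁ (x p) p.1‖)) *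
          (1 / b₁ * (‖g₁ u (x p)‖ * ‖g₁ (x p) p.2‖)) *
          (1 / b₂ * (‖g₂ (x p) p.1‖ * ‖g₂ (x p) p.2‖)) := by gcongr
      _ = _ := by rw [ht]; ring
  refine summable_of_sum_le (c := (1 / b₁ * (1 / b₁) * (1 / b₂)) * (∑' x, ‖g₁ u x‖ ^ 2) * (C * C))
    (fun p => by positivity) fun F => ?_
  calc _ ≤ ∑ p ∈ F, ∑ y ∈ F.image x, t y p.1 p.2 := by
        refine Finset.sum_le_sum fun p hp => (hle p).trans ?_
        exact Finset.single_le_sum (f := fun y => t y p.1 p.2) (fun y _ => ht0 _ _ _)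
          (Finset.mem_image_of_mem x hp)
    _ ≤ ∑ p ∈ F.image Prod.fst ×ˢ F.image Prod.snd, ∑ y ∈ F.image x, t y p.1 p.2 := by
        refine Finset.sum_le_sum_of_subset_of_nonneg Finset.subset_product
          fun p _ _ => Finset.sum_nonneg fun y _ => ht0 _ _ _
    _ = ∑ y ∈ F.image x, (1 / b₁ * (1 / b₁) * (1 / b₂)) * (‖g₁ u y‖ ^ 2) *
          ((∑ v ∈ F.image Prod.fst, ‖g₁ y v‖ * ‖g₂ y v‖) *
            (∑ v ∈ F.image Prod.snd, ‖g₁ y v‖ * ‖g₂ y v‖)) := by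
        rw [Finset.sum_comm]
        refine Finset.sum_congr rfl fun y _ => ?_
        rw [← Finset.mul_sum, Finset.sum_mul_sum, Finset.sum_product]
    _ ≤ ∑ y ∈ F.image x, (1 / b₁ * (1 / b₁) * (1 / b₂)) * (‖g₁ u y‖ ^ 2) * (C * C) := by
        refine Finset.sum_le_sum fun y _ => ?_
        have e1 := hC y (F.image Prod.fst)
        have e2 := hC y (F.image Prod.snd)
        gcongr
    _ ≤ _ := by
        rw [← Finset.sum_mul, ← Finset.mul_sum]
        gcongr
        exact hu.sum_le_tsum _ fun v _ => by positivity

/-- Summation by parts for the adjacency operator, for functions that need not be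
square-summable. -/
theorem tsum_mul_sum_nbrs {f k : V → ℂ} {p : V → ℝ} (hkp : ∀ v, ‖k v‖ ≤ p v) {C : ℝ}
    (hC : 0 ≤ C) (hp : ∀ v w, T.Adj v w → p v ≤ C * p w)
    (hs : Summable fun v => p v * ‖f v‖) :
    ∑' v, k v * ∑ w ∈ nbrs T h v, f w = ∑' v, (∑ w ∈ nbrs T h v, k w) * f v := by
  classical
  obtain ⟨D, hD⟩ := exists_card_nbrs_le h
  have hp0 : ∀ v, 0 ≤ p v := fun v => (norm_nonneg _).trans (hkp v)
  set F : V × V → ℂ := fun q => if T.Adj q.1 q.2 then k q.1 * f q.2 else 0 with hF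
  have hsum : Summable F := by
    apply Summable.of_norm
    refine summable_of_sum_le (c := D * C * ∑' v, p v * ‖f v‖) (fun q => norm_nonneg _)
      fun S => ?_
    calc _ ≤ ∑ q ∈ S.image Prod.fst ×ˢ S.image Prod.snd, ‖F q‖ :=
          Finset.sum_le_sum_of_subset_of_nonneg Finset.subset_product fun _ _ _ => norm_nonneg _
      _ = ∑ w ∈ S.image Prod.snd, ∑ v ∈ S.image Prod.fst, ‖F (v, w)‖ := by
          rw [Finset.sum_product_right]
      _ ≤ ∑ w ∈ S.image Prod.snd, D * (C * (p w * ‖f w‖)) := by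
          refine Finset.sum_le_sum fun w _ => ?_
          calc _ ≤ ∑ v ∈ S.image Prod.fst,
                (if v ∈ nbrs T h w then C * (p w * ‖f w‖) else 0) := by
                refine Finset.sum_le_sum fun v _ => ?_
                simp only [hF, mem_nbrs]
                by_cases hvw : T.Adj v w
                · rw [if_pos hvw, if_pos hvw.symm, norm_mul, ← mul_assoc]
                  have := (hkp v).trans (hp v w hvw)
                  gcongr
                · rw [if_neg hvw, if_neg (fun h0 => hvw h0.symm), norm_zero]
            _ ≤ ∑ v ∈ nbrs T h w, C * (p w * ‖f w‖) := by
                rw [← Finset.sum_filter]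
                refine Finset.sum_le_sum_of_subset_of_nonneg ?_ fun v _ _ => ?_
                · intro v hv
                  exact (Finset.mem_filter.1 hv).2
                · have := hp0 w
                  positivity
            _ ≤ _ := by
                rw [Finset.sum_const, nsmul_eq_mul]
                have := hD w
                have := hp0 w
                gcongr
      _ ≤ _ := by
          rw [← Finset.mul_sum, ← Finset.mul_sum, ← mul_assoc]
          gcongr
          exact hs.sum_le_tsum _ fun v _ => mul_nonneg (hp0 v) (norm_nonneg _)
  have h1 : ∀ v, ∑' w, F (v, w) = k v * ∑ w ∈ nbrs T h v, f w := by
    intro v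
    rw [tsum_eq_sum (s := nbrs T h v), Finset.mul_sum]
    · refine Finset.sum_congr rfl fun w hw => if_pos ((mem_nbrs h).1 hw)
    · intro w hw
      exact if_neg fun h0 => hw ((mem_nbrs h).2 h0)
  have h2 : ∀ w, ∑' v, F (v, w) = (∑ v ∈ nbrs T h w, k v) * f w := by
    intro w
    rw [tsum_eq_sum (s := nbrs T h w), Finset.sum_mul]
    · refine Finset.sum_congr rfl fun v hv => if_pos ((mem_nbrs h).1 hv).symm
    · intro v hv
      exact if_neg fun h0 => hv ((mem_nbrs h).2 h0.symm)
  simp_rw [← h1, ← h2]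
  exact Summable.tsum_comm (f := fun w v => F (v, w)) hsum.prod_symm

theorem testVector_apply (lam η : ℝ) (u v : V) :
    testVector T h lam η u v = -(Complex.I * η) * green T h (pt lam η) v u := by
  rw [testVector, lp.coeFn_smul, Pi.smul_apply, smul_eq_mul, green]

variable {n : ℕ} {d : Matrix (Fin n) (Fin n) ℕ} {τ : V → Fin n}

theorem IsUniversalCover.sum_greenReal (hd : IsExpanding d) (hT : IsUniversalCover d T τ)
    {lam : ℝ} (hreg : IsRegularPoint T h lam) [DecidableEq V] (x v : V) :
    ∑ w ∈ nbrs T h v, greenReal T h lam w x - lam * greenReal T h lam v x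
      = if v = x then 1 else 0 := by
  obtain ⟨m, -, -, -, hg⟩ := hT.exists_boundary_kernel hd hreg
  have hs : Tendsto (fun η => ∑ w ∈ nbrs T h v, green T h (pt lam η) w x) (𝓝[>] 0)
      (𝓝 (∑ w ∈ nbrs T h v, greenReal T h lam w x)) := tendsto_finsetSum _ fun w _ => hg w x
  refine tendsto_nhds_unique (hs.sub ((tendsto_pt lam).mul (hg v x)))
    (tendsto_const_nhds.congr' ?_)
  filter_upwards [self_mem_nhdsWithin] with η hη
  have hη' : 0 < (pt lam η).im := by rw [pt_im]; exact hη
  exact (sum_greenCol hη' x v).symm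

/-- The summability on which the transform of the wave rests, and the reproducing property
`∑ v, K_{xv} g_u(v) = K_{xu}` of the covariance `K = Im G^λ`. The latter holds since the columns of
`K` are eigenvectors and `(A - z) G_u = δ_u`. -/
theorem IsUniversalCover.hasSum_cov_mul_testVector (hd : IsExpanding d)
    (hT : IsUniversalCover d T τ) {lam : ℝ} (hreg : IsRegularPoint T h lam) {η : ℝ} (hη : 0 < η)
    (u : V) :
    (Summable fun p : V × V => ‖testVector T h lam η u p.1‖ * ‖testVector T h lam η u p.2‖ *
      ‖greenReal T h lam p.1 p.2‖) ∧
    ∀ x, HasSum (fun v => ((greenReal T h lam x v).im : ℂ) * testVector T h lam η u v)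
      ((greenReal T h lam x u).im : ℂ) := by
  classical
  have hz : 0 < (pt lam η).im := by rwa [pt_im]
  have h₁ := isTreeKernel_green (h := h) hT.isTree hz
  have hmin := hT.two_le_card_nbrs (h := h) hd
  obtain ⟨m, h₂, ⟨c₂, hc₂, hm₂⟩, -, -⟩ := hT.exists_boundary_kernel hd hreg
  obtain ⟨c₁, hc₁, hm₁⟩ := exists_le_im_cutGreen (h := h) hT.isTree hz
  have hc : 0 < min c₁ c₂ := lt_min hc₁ hc₂
  have hm₁' := fun x y hxy => (min_le_left c₁ c₂).trans (hm₁ x y hxy)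
  have hm₂' := fun x y hxy => (min_le_right c₁ c₂).trans (hm₂ x y hxy)
  have hz₂ : (0 : ℝ) ≤ ((lam : ℂ)).im := by simp
  have hl2 : Summable fun v => ‖green T h (pt lam η) u v‖ ^ 2 := by
    simp_rw [h₁.symm u]
    exact summable_norm_sq (greenCol T h (pt lam η) u)
  have hs := summable_kernel_prod hT.isTree h₁ h₂ hz hz₂ hmin hc hm₁' hm₂' u hl2
  refine ⟨?_, fun x => ?_⟩
  · refine (hs.mul_left (η * η)).congr fun p => ?_
    rw [testVector_apply, testVector_apply, norm_mul, norm_mul, norm_neg, norm_mul,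
      Complex.norm_I, Complex.norm_real, Real.norm_of_nonneg hη.le, h₁.symm p.1, h₁.symm p.2]
    ring
  · set p : V → ℝ := fun v => ‖greenReal T h lam x v‖
    set k : V → ℂ := fun v => ((greenReal T h lam x v).im : ℂ) with hk
    set f : V → ℂ := fun v => green T h (pt lam η) v u with hf
    have hkp : ∀ v, ‖k v‖ ≤ p v := fun v => by
      rw [hk, Complex.norm_real]
      exact Complex.abs_im_le_norm _
    obtain ⟨C, hC, hCp⟩ := h₂.exists_norm_le_of_adj hz₂ hmin hc hm₂' hT.isTree
    have hsp : Summable fun v => p v * ‖f v‖ := by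
      have h3 := hs.prod_factor x
      have h4 : ‖green T h (pt lam η) u x‖ ≠ 0 :=
        norm_ne_zero_iff.2 (h₁.ne_zero hc hm₁' hT.isTree u x)
      refine (h3.mul_left (‖green T h (pt lam η) u x‖)⁻¹).congr fun v => ?_
      simp only [hf, p]
      rw [h₁.symm v u]
      field_simp
    have hsk : Summable fun v => k v * f v :=
      Summable.of_norm_bounded hsp fun v => by
        rw [norm_mul]
        exact mul_le_mul_of_nonneg_right (hkp v) (norm_nonneg _)
    have hparts := tsum_mul_sum_nbrs (h := h) hkp hC.le (fun v w hvw => hCp x v w hvw) hsp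
    have e1 : ∀ v, ∑ w ∈ nbrs T h v, f w = pt lam η * f v + if v = u then 1 else 0 := by
      intro v
      rw [← sum_greenCol (h := h) hz u v]
      simp only [hf, green]
      ring
    have e2 : ∀ v, ∑ w ∈ nbrs T h v, k w = lam * k v := by
      intro v
      have h5 := congrArg Complex.im (hT.sum_greenReal hd hreg x v)
      have h6 : (if v = x then (1 : ℂ) else 0).im = 0 := by split_ifs <;> simp
      rw [h6, Complex.sub_im, Complex.im_sum, Complex.im_ofReal_mul, sub_eq_zero] at h5
      simp only [hk, h₂.symm x]
      rw [← Complex.ofReal_sum, h5, Complex.ofReal_mul]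
    simp_rw [e1, e2] at hparts
    have e3 : HasSum (fun v => k v * (pt lam η * f v + if v = u then 1 else 0))
        (pt lam η * (∑' v, k v * f v) + k u) := by
      have a1 := hsk.hasSum.mul_left (pt lam η)
      have a2 : HasSum (fun v => if v = u then k v else 0) (k u) :=
        (hasSum_ite_eq u (k u)).congr_fun (fun v => by split_ifs with h0 <;> simp [h0])
      refine (a1.add a2).congr_fun fun v => ?_
      split_ifs <;> ring
    rw [e3.tsum_eq] at hparts
    simp_rw [mul_assoc] at hparts
    rw [tsum_mul_left] at hparts
    have e4 : k u = -(Complex.I * η) * ∑' v, k v * f v := by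
      have : pt lam η = lam + η * Complex.I := rfl
      rw [this] at hparts
      linear_combination hparts
    have e5 := hsk.hasSum.mul_left (-(Complex.I * η))
    rw [← e4] at e5
    refine e5.congr_fun fun v => ?_
    rw [testVector_apply]
    ring

theorem tendsto_product_self_atTop [DecidableEq V] :
    Tendsto (fun F : Finset V => F ×ˢ F) atTop atTop := by
  refine tendsto_atTop.2 fun S => ?_
  filter_upwards [eventually_ge_atTop (S.image Prod.fst ∪ S.image Prod.snd)] with F hF
  intro p hp
  rw [Finset.mem_product]
  exact ⟨hF (Finset.mem_union_left _ (Finset.mem_image_of_mem _ hp)),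
    hF (Finset.mem_union_right _ (Finset.mem_image_of_mem _ hp))⟩

theorem IsEigenvectorProcess.integral_norm_sq {lam : ℝ} {μ : Measure (V → ℝ)}
    (hμ : IsEigenvectorProcess T h lam μ) (u : V) (g : V → ℂ) (F : Finset V) :
    ∫ φ, ‖(φ u : ℂ) - ∑ v ∈ F, (φ v : ℂ) * g v‖ ^ 2 ∂μ
      = (greenReal T h lam u u).im - 2 * ∑ v ∈ F, (g v).re * (greenReal T h lam u v).im
        + ∑ p ∈ F ×ˢ F, ((g p.1).re * (g p.2).re + (g p.1).im * (g p.2).im)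
            * (greenReal T h lam p.1 p.2).im := by
  have hint : ∀ v w, Integrable (fun φ : V → ℝ => φ v * φ w) μ := fun v w =>
    (hμ.memLp v).integrable_mul (hμ.memLp w)
  have hpt : ∀ φ : V → ℝ, ‖(φ u : ℂ) - ∑ v ∈ F, (φ v : ℂ) * g v‖ ^ 2
      = φ u * φ u - 2 * ∑ v ∈ F, (g v).re * (φ u * φ v)
        + ∑ p ∈ F ×ˢ F, ((g p.1).re * (g p.2).re + (g p.1).im * (g p.2).im)
            * (φ p.1 * φ p.2) := by
    intro φ
    have hre : (∑ v ∈ F, (φ v : ℂ) * g v).re = ∑ v ∈ F, φ v * (g v).re := by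
      rw [Complex.re_sum]; simp
    have him : (∑ v ∈ F, (φ v : ℂ) * g v).im = ∑ v ∈ F, φ v * (g v).im := by
      rw [Complex.im_sum]; simp
    rw [← Complex.normSq_eq_norm_sq, Complex.normSq_apply, Complex.sub_re, Complex.sub_im, hre,
      him, Complex.ofReal_re, Complex.ofReal_im]
    have e1 : ∑ v ∈ F, (g v).re * (φ u * φ v) = φ u * ∑ v ∈ F, φ v * (g v).re := by
      rw [Finset.mul_sum]
      exact Finset.sum_congr rfl fun v _ => by ring
    have e2 : ∑ p ∈ F ×ˢ F, ((g p.1).re * (g p.2).re + (g p.1).im * (g p.2).im)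
        * (φ p.1 * φ p.2) = (∑ v ∈ F, φ v * (g v).re) * (∑ v ∈ F, φ v * (g v).re)
          + (∑ v ∈ F, φ v * (g v).im) * (∑ v ∈ F, φ v * (g v).im) := by
      rw [Finset.sum_mul_sum, Finset.sum_mul_sum, ← Finset.sum_product', ← Finset.sum_product',
        ← Finset.sum_add_distrib]
      exact Finset.sum_congr rfl fun v _ => by ring
    rw [e1, e2]
    ring
  simp_rw [hpt]
  have i1 : Integrable (fun φ : V → ℝ => ∑ v ∈ F, (g v).re * (φ u * φ v)) μ :=
    integrable_finsetSum _ fun v _ => (hint u v).const_mul _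
  have i2 : Integrable (fun φ : V → ℝ => ∑ p ∈ F ×ˢ F,
      ((g p.1).re * (g p.2).re + (g p.1).im * (g p.2).im) * (φ p.1 * φ p.2)) μ :=
    integrable_finsetSum _ fun p _ => (hint p.1 p.2).const_mul _
  have i3 : Integrable (fun φ : V → ℝ => φ u * φ u - 2 * ∑ v ∈ F, (g v).re * (φ u * φ v)) μ :=
    (hint u u).sub (i1.const_mul 2)
  rw [integral_add i3 i2, integral_sub (hint u u) (i1.const_mul 2),
    integral_const_mul, integral_finsetSum _ fun v _ => (hint u v).const_mul _,
    integral_finsetSum _ fun p _ => (hint p.1 p.2).const_mul _]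
  simp_rw [integral_const_mul, hμ.covariance]

/-- The process with values `⟨Ψ, g_u⟩` is the Gaussian wave `Ψ` itself: formally
`⟨Ψ, -iη (A - z)⁻¹ δ_u⟩ = ⟨-iη (A - z)⁻¹ Ψ, δ_u⟩ = Ψ_u`, since `A Ψ = λ Ψ`. -/
theorem IsUniversalCover.isTransform_self (hd : IsExpanding d) (hT : IsUniversalCover d T τ)
    {lam : ℝ} (hreg : IsRegularPoint T h lam) {μ : Measure (V → ℝ)}
    (hμ : IsEigenvectorProcess T h lam μ) {η : ℝ} (hη : 0 < η) :
    IsTransform μ (testVector T h lam η) μ := by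
  classical
  refine ⟨fun u φ => φ u, fun u => measurable_pi_apply u, hμ.memLp, fun u => ?_, ?_⟩
  swap
  · exact Measure.map_id.symm
  have := hμ.isProbabilityMeasure
  obtain ⟨m, h₂, -, -, -⟩ := hT.exists_boundary_kernel hd hreg
  obtain ⟨hs, hrep⟩ := hT.hasSum_cov_mul_testVector hd hreg hη u
  set g : V → ℂ := fun v => testVector T h lam η u v with hg
  set K : V → V → ℝ := fun x y => (greenReal T h lam x y).im with hK
  have hKs : ∀ x y, K x y = K y x := fun x y => by simp only [hK, h₂.symm x y]
  -- The three terms of the second moment converge to `K_uu`, `2 K_uu` and `K_uu`.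
  have l1 : HasSum (fun v => (g v).re * K u v) (K u u) := by
    have h1 := Complex.hasSum_re (hrep u)
    refine h1.congr_fun fun v => ?_
    rw [Complex.re_ofReal_mul, mul_comm]
  have l2 : HasSum (fun p : V × V => ((g p.1).re * (g p.2).re + (g p.1).im * (g p.2).im)
      * K p.1 p.2) (K u u) := by
    have hsc : Summable fun p : V × V => (g p.1) * (starRingEnd ℂ) (g p.2) * (K p.1 p.2 : ℂ) := by
      refine Summable.of_norm_bounded hs fun p => ?_
      rw [norm_mul, norm_mul, Complex.norm_conj, Complex.norm_real]
      have := Complex.abs_im_le_norm (greenReal T h lam p.1 p.2)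
      gcongr
      exact this
    have e1 : HasSum (fun p : V × V => (starRingEnd ℂ) (g p.1) * ((K p.1 p.2 : ℂ) * g p.2))
        (∑' p : V × V, (starRingEnd ℂ) (g p.1) * ((K p.1 p.2 : ℂ) * g p.2)) := by
      apply Summable.hasSum
      refine hsc.prod_symm.congr fun p => ?_
      simp only [Prod.fst_swap, Prod.snd_swap]
      rw [hKs p.2 p.1]
      ring
    have e2 := e1.prod_fiberwise fun v => (hrep v).mul_left ((starRingEnd ℂ) (g v))
    have e3 : HasSum (fun v => (starRingEnd ℂ) (g v) * (K v u : ℂ)) (K u u : ℂ) := by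
      have := Complex.hasSum_conj'.2 (hrep u)
      rw [Complex.conj_ofReal] at this
      refine this.congr_fun fun v => ?_
      rw [map_mul, Complex.conj_ofReal, mul_comm, hKs v u]
    have e4 := e2.unique e3
    rw [e4] at e1
    refine (Complex.hasSum_re e1).congr_fun fun p => ?_
    simp
    ring
  have l3 := l2.comp tendsto_product_self_atTop
  have hlim : Tendsto (fun F : Finset V => ∫ φ, ‖(φ u : ℂ) - ∑ v ∈ F, (φ v : ℂ) * g v‖ ^ 2 ∂μ)
      atTop (𝓝 0) := by
    have h1 := ((l1.const_mul 2).const_sub (K u u)).add l3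
    have h2 : K u u - 2 * K u u + K u u = 0 := by ring
    rw [h2] at h1
    refine h1.congr fun F => ?_
    rw [hμ.integral_norm_sq u g F]
    rfl
  have hmem : ∀ F : Finset V, MemLp (fun φ : V → ℝ => (φ u : ℂ) - ∑ v ∈ F, (φ v : ℂ) * g v) 2 μ :=
    fun F => ((hμ.memLp u).ofReal).sub
      (memLp_finsetSum _ fun v _ => ((hμ.memLp v).ofReal (K := ℂ)).mul_const (g v))
  have hrt : Tendsto (fun F : Finset V => ENNReal.ofReal
      ((∫ φ, ‖(φ u : ℂ) - ∑ v ∈ F, (φ v : ℂ) * g v‖ ^ 2 ∂μ) ^ (2⁻¹ : ℝ))) atTop (𝓝 0) := by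
    have h1 := (Real.continuousAt_rpow_const 0 (2⁻¹ : ℝ) (Or.inr (by norm_num))).tendsto.comp hlim
    rw [Real.zero_rpow (by norm_num)] at h1
    have h2 := (ENNReal.continuous_ofReal.tendsto 0).comp h1
    rwa [ENNReal.ofReal_zero] at h2
  refine hrt.congr fun F => ?_
  rw [(hmem F).eLpNorm_eq_integral_rpow_norm (by simp) (by simp)]
  simp

end Transform

/-! ### Quadratic forms on finitely supported functions -/

section Forms

variable {V : Type*}

/-- The bilinear form `∑ u, ∑ v, χ u * ψ v * k u v` of a kernel `k`. -/
noncomputable def kernelForm (k : V → V → ℝ) : (V →₀ ℝ) →ₗ[ℝ] (V →₀ ℝ) →ₗ[ℝ] ℝ :=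
  Finsupp.linearCombination ℝ fun u => Finsupp.linearCombination ℝ fun v => k u v

theorem kernelForm_apply (k : V → V → ℝ) (χ ψ : V →₀ ℝ) :
    kernelForm k χ ψ = ∑ u ∈ χ.support, ∑ v ∈ ψ.support, χ u * (ψ v * k u v) := by
  simp only [kernelForm, Finsupp.linearCombination_apply, Finsupp.sum, LinearMap.sum_apply,
    LinearMap.smul_apply, smul_eq_mul, Finset.mul_sum]

theorem kernelForm_comm {k : V → V → ℝ} (hk : ∀ u v, k u v = k v u) (χ ψ : V →₀ ℝ) :
    kernelForm k χ ψ = kernelForm k ψ χ := by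
  rw [kernelForm_apply, kernelForm_apply, Finset.sum_comm]
  refine Finset.sum_congr rfl fun v _ => Finset.sum_congr rfl fun u _ => ?_
  rw [hk u v]
  ring

theorem tendsto_kernelForm {ι : Type*} {l : Filter ι} {k : ι → V → V → ℝ} {k₀ : V → V → ℝ}
    (hk : ∀ u v, Tendsto (fun i => k i u v) l (𝓝 (k₀ u v))) (χ ψ : V →₀ ℝ) :
    Tendsto (fun i => kernelForm (k i) χ ψ) l (𝓝 (kernelForm k₀ χ ψ)) := by
  simp only [kernelForm_apply]
  exact tendsto_finsetSum _ fun u _ => tendsto_finsetSum _ fun v _ =>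
    ((hk u v).const_mul _).const_mul _

/-- The Gram matrix of a family with respect to the form of a kernel. -/
noncomputable def gram (k : V → V → ℝ) {m : ℕ} (χ : Fin m → (V →₀ ℝ)) :
    Matrix (Fin m) (Fin m) ℝ :=
  Matrix.of fun i j => kernelForm k (χ i) (χ j)

theorem gram_apply (k : V → V → ℝ) {m : ℕ} (χ : Fin m → (V →₀ ℝ)) (i j : Fin m) :
    gram k χ i j = kernelForm k (χ i) (χ j) := rfl

theorem gram_linearCombination (k : V → V → ℝ) {m : ℕ} {χ ψ : Fin m → (V →₀ ℝ)}
    {P : Matrix (Fin m) (Fin m) ℝ} (h : ∀ i, χ i = ∑ j, P i j • ψ j) :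
    gram k χ = P * gram k ψ * P.transpose := by
  ext i j
  rw [gram_apply, h i, h j, Matrix.mul_apply]
  simp only [map_sum, map_smul, LinearMap.sum_apply, LinearMap.smul_apply, smul_eq_mul,
    Matrix.mul_apply, Matrix.transpose_apply, gram_apply, Finset.sum_mul]
  refine Finset.sum_congr rfl fun a _ => ?_
  rw [Finset.mul_sum]
  refine Finset.sum_congr rfl fun b _ => ?_
  ring

theorem posDef_gram {k : V → V → ℝ} (hk : ∀ u v, k u v = k v u) {E : Submodule ℝ (V →₀ ℝ)}
    (hpos : ∀ χ ∈ E, χ ≠ 0 → 0 < kernelForm k χ χ) {m : ℕ} {χ : Fin m → (V →₀ ℝ)}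
    (hχ : ∀ i, χ i ∈ E) (hli : LinearIndependent ℝ χ) : (gram k χ).PosDef := by
  refine Matrix.PosDef.of_dotProduct_mulVec_pos ?_ fun x hx => ?_
  · ext i j
    simp [gram_apply, kernelForm_comm hk (χ i)]
  · have h1 : Star.star x ⬝ᵥ (gram k χ).mulVec x
        = kernelForm k (∑ i, x i • χ i) (∑ i, x i • χ i) := by
      simp only [map_sum, map_smul, LinearMap.sum_apply, LinearMap.smul_apply, smul_eq_mul,
        dotProduct, Matrix.mulVec, gram_apply, Pi.star_apply, star_trivial, Finset.mul_sum]
      rw [Finset.sum_comm]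
      refine Finset.sum_congr rfl fun i _ => Finset.sum_congr rfl fun j _ => ?_
      ring
    rw [h1]
    refine hpos _ (E.sum_mem fun i _ => E.smul_mem _ (hχ i)) fun h0 => hx ?_
    funext i
    exact Fintype.linearIndependent_iff.1 hli x h0 i

open scoped MatrixOrder in
theorem exists_eq_mul_transpose {m : ℕ} {M : Matrix (Fin m) (Fin m) ℝ} (hM : M.PosDef) :
    ∃ C : Matrix (Fin m) (Fin m) ℝ, M = C * C.transpose := by
  have h0 : 0 ≤ M := hM.posSemidef.nonneg
  refine ⟨CFC.sqrt M, ?_⟩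
  have h1 := (Matrix.nonneg_iff_posSemidef.1 (CFC.sqrt_nonneg M)).isHermitian
  rw [Matrix.IsHermitian, Matrix.conjTranspose_eq_transpose_of_trivial] at h1
  rw [h1, CFC.sqrt_mul_sqrt_self M h0]

/-- A family with a positive definite Gram matrix is obtained from an orthonormal one by an
invertible change of coordinates. -/
theorem exists_gram_eq_one {k : V → V → ℝ} {m : ℕ} {χ : Fin m → (V →₀ ℝ)}
    (hχ : (gram k χ).PosDef) :
    ∃ (C : Matrix (Fin m) (Fin m) ℝ) (ξ : Fin m → (V →₀ ℝ)), (gram k χ).det = C.det ^ 2 ∧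
      C.det ≠ 0 ∧ gram k ξ = 1 ∧ (∀ i, ξ i = ∑ j, C⁻¹ i j • χ j) ∧
      ∀ j, χ j = ∑ i, C j i • ξ i := by
  obtain ⟨C, hC⟩ := exists_eq_mul_transpose hχ
  have hdet2 : (gram k χ).det = C.det ^ 2 := by
    rw [hC, Matrix.det_mul, Matrix.det_transpose, sq]
  have hdet : C.det ≠ 0 := fun h0 => by
    have := hχ.det_pos
    simp [hdet2, h0] at this
  have hunit : IsUnit C.det := isUnit_iff_ne_zero.2 hdet
  refine ⟨C, fun i => ∑ j, C⁻¹ i j • χ j, hdet2, hdet, ?_, fun i => rfl, fun j => ?_⟩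
  · rw [gram_linearCombination k (P := C⁻¹) (ψ := χ) fun i => rfl, hC, ← Matrix.mul_assoc,
      Matrix.nonsing_inv_mul C hunit, Matrix.one_mul, ← Matrix.transpose_mul,
      Matrix.nonsing_inv_mul C hunit, Matrix.transpose_one]
  · simp only [Finset.smul_sum, smul_smul]
    rw [Finset.sum_comm]
    simp_rw [← Finset.sum_smul, ← Matrix.mul_apply, Matrix.mul_nonsing_inv C hunit,
      Matrix.one_apply, ite_smul, one_smul, zero_smul, Finset.sum_ite_eq, Finset.mem_univ,
      if_true]

theorem comb_add (g : V → L2 V) (χ ψ : V →₀ ℝ) : comb g (χ + ψ) = comb g χ + comb g ψ := by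
  classical
  unfold comb
  exact Finsupp.sum_add_index' (by simp) (by intro a b c; push_cast; rw [add_smul])

theorem comb_smul (g : V → L2 V) (c : ℝ) (χ : V →₀ ℝ) : comb g (c • χ) = (c : ℂ) • comb g χ := by
  unfold comb
  rw [Finsupp.sum_smul_index (by simp), Finsupp.smul_sum]
  simp only [Complex.ofReal_mul, mul_smul]

theorem comb_zero (g : V → L2 V) : comb g 0 = 0 := by simp [comb]

theorem comb_sum (g : V → L2 V) {ι : Type*} (s : Finset ι) (χ : ι → (V →₀ ℝ)) :
    comb g (∑ i ∈ s, χ i) = ∑ i ∈ s, comb g (χ i) := by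
  classical
  induction s using Finset.induction_on with
  | empty => simp [comb_zero]
  | insert a s ha ih => rw [Finset.sum_insert ha, Finset.sum_insert ha, comb_add, ih]

theorem comb_apply (g : V → L2 V) (χ : V →₀ ℝ) (v : V) :
    comb g χ v = ∑ u ∈ χ.support, (χ u : ℂ) * g u v := by
  rw [comb, Finsupp.sum, lp.coeFn_sum, Finset.sum_apply]
  refine Finset.sum_congr rfl fun u _ => ?_
  rw [lp.coeFn_smul, Pi.smul_apply, smul_eq_mul]

theorem inner_comb {g : V → L2 V} {k : V → V → ℝ} (hg : ∀ u v, inner ℂ (g u) (g v) = (k u v : ℂ))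
    (χ ψ : V →₀ ℝ) : inner ℂ (comb g χ) (comb g ψ) = (kernelForm k χ ψ : ℂ) := by
  rw [kernelForm_apply, comb, comb, Finsupp.sum, Finsupp.sum, sum_inner, Complex.ofReal_sum]
  refine Finset.sum_congr rfl fun u _ => ?_
  rw [inner_sum, Complex.ofReal_sum]
  refine Finset.sum_congr rfl fun v _ => ?_
  rw [inner_smul_left, inner_smul_right, hg, Complex.conj_ofReal]
  push_cast
  ring

theorem norm_comb_sq {g : V → L2 V} {k : V → V → ℝ} (hg : ∀ u v, inner ℂ (g u) (g v) = (k u v : ℂ))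
    (χ : V →₀ ℝ) : ‖comb g χ‖ ^ 2 = kernelForm k χ χ := by
  have h1 := inner_comb hg χ χ
  rw [inner_self_eq_norm_sq_to_K] at h1
  rw [← Complex.ofReal_inj, ← h1]
  norm_cast

end Forms

/-! ### Resolvents of finitely supported functions -/

section FinResolvent

variable {V : Type*} {T : SimpleGraph V} {h : BoundedDegree T}

theorem sub_comb_greenCol {z : ℂ} (hz : 0 < z.im) (χ : V →₀ ℝ) :
    (adjOp T h - z • (1 : L2 V →L[ℂ] L2 V)) (comb (greenCol T h z) χ) = comb delta χ := by
  rw [comb, Finsupp.sum, map_sum]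
  simp only [map_smul, sub_greenCol hz]
  rfl

theorem sum_comb_greenCol {z : ℂ} (hz : 0 < z.im) (χ : V →₀ ℝ) (v : V) :
    ∑ w ∈ nbrs T h v, comb (greenCol T h z) χ w - z * comb (greenCol T h z) χ v = χ v := by
  rw [← sub_smul_apply, sub_comb_greenCol hz, comb_delta_apply]

theorem inner_greenCol_eq {z : ℂ} (hz : 0 < z.im) (u v : V) :
    inner ℂ (greenCol T h z u) (greenCol T h z v)
      = (((green T h z u v).im / z.im : ℝ) : ℂ) := by
  have h1 := inner_greenCol (H := T) (h := h) hz u v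
  have h2 : (z.im : ℂ) ≠ 0 := by exact_mod_cast hz.ne'
  rw [Complex.ofReal_div, eq_div_iff h2, ← h1, mul_comm]

theorem inner_testVector {lam η : ℝ} (hη : 0 < η) (u v : V) :
    inner ℂ (testVector T h lam η u) (testVector T h lam η v)
      = ((η * (green T h (pt lam η) u v).im : ℝ) : ℂ) := by
  have hz : 0 < (pt lam η).im := by rwa [pt_im]
  rw [testVector, testVector, inner_smul_left, inner_smul_right, inner_greenCol_eq hz, pt_im]
  have h2 : (η : ℂ) ≠ 0 := by exact_mod_cast hη.ne'
  push_cast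
  simp only [map_neg, map_mul, Complex.conj_I, Complex.conj_ofReal]
  field_simp
  linear_combination (-((green T h (pt lam η) u v).im : ℂ)) * Complex.I_sq

theorem comb_greenCol_ne_zero {z : ℂ} (hz : 0 < z.im) {χ : V →₀ ℝ} (hχ : χ ≠ 0) :
    comb (greenCol T h z) χ ≠ 0 := by
  intro h0
  apply hχ
  ext v
  have := sum_comb_greenCol (h := h) hz χ v
  rw [h0] at this
  simpa using this.symm

theorem kernelForm_im_green_pos {z : ℂ} (hz : 0 < z.im) {χ : V →₀ ℝ} (hχ : χ ≠ 0) :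
    0 < kernelForm (fun u v => (green T h z u v).im / z.im) χ χ := by
  rw [← norm_comb_sq (inner_greenCol_eq (h := h) hz)]
  have := norm_pos_iff.2 (comb_greenCol_ne_zero (h := h) hz hχ)
  positivity

theorem kernelForm_const_mul {V : Type*} (k : V → V → ℝ) (c : ℝ) (χ ψ : V →₀ ℝ) :
    kernelForm (fun u v => c * k u v) χ ψ = c * kernelForm k χ ψ := by
  simp only [kernelForm_apply, Finset.mul_sum]
  refine Finset.sum_congr rfl fun u _ => Finset.sum_congr rfl fun v _ => ?_
  ring

variable {n : ℕ} {d : Matrix (Fin n) (Fin n) ℕ} {τ : V → Fin n}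

/-- There are no finitely supported eigenvectors at a regular point, since the entries of the
Green's function stay bounded. -/
theorem IsUniversalCover.eq_zero_of_eigen (hd : IsExpanding d) (hT : IsUniversalCover d T τ)
    {lam : ℝ} (hreg : IsRegularPoint T h lam) {f : V →₀ ℝ}
    (hf : ∀ v, ∑ w ∈ nbrs T h v, f w - lam * f v = 0) : f = 0 := by
  obtain ⟨m, -, -, -, hg⟩ := hT.exists_boundary_kernel hd hreg
  ext x
  have h1 : ∀ η : ℝ, 0 < η → (f x : ℂ) = -(η * Complex.I) *
      ∑ u ∈ f.support, (f u : ℂ) * green T h (pt lam η) x u := by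
    intro η hη
    have hz : 0 < (pt lam η).im := by rwa [pt_im]
    have h2 : comb delta f = (-(η * Complex.I)) • comb (greenCol T h (pt lam η)) f := by
      apply sub_injective (h := h) hz
      rw [map_smul, sub_comb_greenCol hz]
      ext v
      rw [sub_smul_apply, lp.coeFn_smul, Pi.smul_apply, smul_eq_mul]
      simp only [comb_delta_apply]
      have h3 := congrArg (fun r : ℝ => (r : ℂ)) (hf v)
      simp only [Complex.ofReal_sub, Complex.ofReal_sum, Complex.ofReal_mul,
        Complex.ofReal_zero] at h3
      have : pt lam η = lam + η * Complex.I := rfl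
      rw [this]
      linear_combination h3
    have h3 := congrArg (fun g : L2 V => g x) h2
    simp only [comb_delta_apply] at h3
    rw [lp.coeFn_smul, Pi.smul_apply, smul_eq_mul, comb_apply] at h3
    exact h3
  have h2 : Tendsto (fun η : ℝ => -((η : ℂ) * Complex.I) *
      ∑ u ∈ f.support, (f u : ℂ) * green T h (pt lam η) x u) (𝓝[>] 0)
      (𝓝 (-(((0 : ℝ) : ℂ) * Complex.I) *
        ∑ u ∈ f.support, (f u : ℂ) * greenReal T h lam x u)) := by
    refine Tendsto.mul (Tendsto.neg (Tendsto.mul_const _ ?_))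
      (tendsto_finsetSum _ fun u _ => (hg x u).const_mul _)
    exact (Complex.continuous_ofReal.tendsto 0).mono_left nhdsWithin_le_nhds
  have h3 := tendsto_nhds_unique (h2.congr' (f₂ := fun _ => (f x : ℂ)) (by
    filter_upwards [self_mem_nhdsWithin] with η hη using (h1 η hη).symm)) tendsto_const_nhds
  rw [Complex.ofReal_zero, zero_mul, neg_zero, zero_mul] at h3
  exact_mod_cast h3.symm

/-- Every vertex that is not an interior point of `Γ` is the root of a branch that does not
meet `Γ`. -/
def HasFreeBranches (T : SimpleGraph V) (Γ : Set V) : Prop :=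
  ∀ w, w ∉ Γ \ boundary T Γ → ∃ y, T.Adj w y ∧ Disjoint (branch T w y) Γ

theorem sum_mul_sum_nbrs {R : Type*} [CommSemiring R] (S : Finset V) {a b : V → R}
    (ha : ∀ v, v ∉ S → a v = 0) (hb : ∀ v, v ∉ S → b v = 0) :
    ∑ v ∈ S, a v * ∑ w ∈ nbrs T h v, b w = ∑ w ∈ S, (∑ v ∈ nbrs T h w, a v) * b w := by
  classical
  have h1 : ∀ (f : V → R), (∀ v, v ∉ S → f v = 0) → ∀ v,
      ∑ w ∈ nbrs T h v, f w = ∑ w ∈ S, if T.Adj v w then f w else 0 := by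
    intro f hf v
    have e1 : ∑ w ∈ nbrs T h v, f w = ∑ w ∈ (nbrs T h v).filter (· ∈ S), f w := by
      refine (Finset.sum_filter_of_ne fun w _ hw => ?_).symm
      by_contra hwS
      exact hw (hf w hwS)
    rw [e1, ← Finset.sum_filter]
    refine Finset.sum_congr ?_ fun _ _ => rfl
    ext w
    simp [mem_nbrs, and_comm]
  simp_rw [h1 a ha, h1 b hb, Finset.mul_sum, Finset.sum_mul]
  rw [Finset.sum_comm]
  refine Finset.sum_congr rfl fun w _ => Finset.sum_congr rfl fun v _ => ?_
  rw [SimpleGraph.adj_comm]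
  split_ifs <;> simp

/-- The covariance `Im G^λ` is positive definite on `E_Γ`. If it vanishes at `χ`, then `u = G^λ χ`
has no flux through the boundary of `Γ`, so that `u` is supported in the interior, and
`χ = (A - λ) u` is orthogonal to `E_Γ`. -/
theorem IsUniversalCover.kernelForm_cov_pos (hd : IsExpanding d) (hT : IsUniversalCover d T τ)
    {lam : ℝ} (hreg : IsRegularPoint T h lam) {Γ : Set V} (hΓ : Γ.Finite)
    (hfree : HasFreeBranches T Γ) {χ : V →₀ ℝ} (hχ : χ ∈ eigenSpace T h lam Γ) (hχ0 : χ ≠ 0) :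
    0 < kernelForm (fun u v => (greenReal T h lam u v).im) χ χ := by
  classical
  obtain ⟨m, hk, ⟨c, hc, hm⟩, hmlim, hg⟩ := hT.exists_boundary_kernel hd hreg
  by_contra! hneg
  set u : V → ℂ := fun w => ∑ v ∈ χ.support, (χ v : ℂ) * greenReal T h lam w v with hu
  have hu0 : ∀ w, w ∉ Γ \ boundary T Γ → u w = 0 := by
    intro w hw
    obtain ⟨y, hwy, hdisj⟩ := hfree w hw
    have hlim1 : Tendsto (fun η : ℝ => ‖comb (greenCol T h (pt lam η)) χ w‖ ^ 2 *
        (cutGreen T h (pt lam η) w y).im) (𝓝[>] 0) (𝓝 (‖u w‖ ^ 2 * (m w y).im)) := by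
      refine Tendsto.mul (Tendsto.pow (Tendsto.norm ?_) 2)
        ((Complex.continuous_im.tendsto _).comp (hmlim w y hwy))
      simp only [comb_apply]
      exact tendsto_finsetSum _ fun v _ => (hg w v).const_mul _
    have hlim2 : Tendsto (fun η : ℝ => kernelForm (fun u v => (green T h (pt lam η) u v).im) χ χ)
        (𝓝[>] 0) (𝓝 (kernelForm (fun u v => (greenReal T h lam u v).im) χ χ)) :=
      tendsto_kernelForm (fun u v => (Complex.continuous_im.tendsto _).comp (hg u v)) χ χ
    have hle := le_of_tendsto_of_tendsto hlim1 hlim2 (by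
      filter_upwards [self_mem_nhdsWithin] with η hη
      have hz : 0 < (pt lam η).im := by rw [pt_im]; exact hη
      have h1 := norm_sq_mul_im_le (h := h) hT.isTree hz hwy
        (f := comb (greenCol T h (pt lam η)) χ) (fun v hv => by
          rw [sum_comb_greenCol hz, hχ.1 v (Set.disjoint_left.1 hdisj hv)]
          simp)
      rw [norm_comb_sq (inner_greenCol_eq (h := h) hz), ← kernelForm_const_mul] at h1
      refine h1.trans (le_of_eq ?_)
      congr 3
      ext u v
      field_simp)
    have h2 : 0 < (m w y).im := hc.trans_le (hm w y hwy)
    have h3 : ‖u w‖ ^ 2 * (m w y).im ≤ 0 := hle.trans hneg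
    have h4 : ‖u w‖ ^ 2 ≤ 0 := by
      by_contra! h5
      exact absurd (mul_pos h5 h2) (not_lt.2 h3)
    have h5 : ‖u w‖ = 0 := by nlinarith [norm_nonneg (u w)]
    exact norm_eq_zero.1 h5
  have heq : ∀ v, ∑ w ∈ nbrs T h v, u w - lam * u v = χ v := by
    intro v
    simp only [hu]
    rw [Finset.sum_comm, Finset.mul_sum, ← Finset.sum_sub_distrib]
    have h1 : ∀ t, ∑ w ∈ nbrs T h v, (χ t : ℂ) * greenReal T h lam w t
        - lam * ((χ t : ℂ) * greenReal T h lam v t) = if v = t then (χ t : ℂ) else 0 := by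
      intro t
      have h2 := hT.sum_greenReal hd hreg t v
      rw [← Finset.mul_sum]
      calc _ = (χ t : ℂ) * (∑ w ∈ nbrs T h v, greenReal T h lam w t
            - lam * greenReal T h lam v t) := by ring
        _ = _ := by rw [h2]; split_ifs <;> simp
    rw [Finset.sum_congr rfl fun t _ => h1 t, Finset.sum_ite_eq]
    split_ifs with h2
    · rfl
    · simp [Finsupp.notMem_support_iff.1 h2]
  set S := hΓ.toFinset with hS
  have hSm : ∀ v, v ∉ S → v ∉ Γ := fun v hv => by simpa [hS] using hv
  have h1 : ∑ v ∈ S, (χ v : ℂ) * χ v = 0 := by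
    have h2 := sum_mul_sum_nbrs (T := T) (h := h) S (a := fun v => (χ v : ℂ)) (b := u)
      (fun v hv => by simp [hχ.1 v (hSm v hv)])
      (fun v hv => hu0 v fun h0 => hSm v hv h0.1)
    calc _ = ∑ v ∈ S, (χ v : ℂ) * (∑ w ∈ nbrs T h v, u w - lam * u v) :=
          Finset.sum_congr rfl fun v _ => by rw [heq]
      _ = ∑ v ∈ S, ((∑ w ∈ nbrs T h v, (χ w : ℂ)) * u v - lam * χ v * u v) := by
          rw [Finset.sum_sub_distrib, ← h2, ← Finset.sum_sub_distrib]
          exact Finset.sum_congr rfl fun v _ => by ring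
      _ = 0 := by
          refine Finset.sum_eq_zero fun v _ => ?_
          by_cases hv : v ∈ Γ \ boundary T Γ
          · have h3 := congrArg (fun r : ℝ => (r : ℂ)) (hχ.2 v hv)
            simp only [Complex.ofReal_sub, Complex.ofReal_sum, Complex.ofReal_mul,
              Complex.ofReal_zero] at h3
            linear_combination (-u v) * h3
          · rw [hu0 v hv]
            ring
  have h2 : ∑ v ∈ S, χ v * χ v = 0 := by exact_mod_cast h1
  apply hχ0
  ext v
  by_cases hv : v ∈ S
  · have := (Finset.sum_eq_zero_iff_of_nonneg fun v _ => mul_self_nonneg (χ v)).1 h2 v hv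
    simpa using this
  · simpa using hχ.1 v (hSm v hv)

/-- Extension by zero of functions on a finite set. -/
noncomputable def extendZero (Γ : Set V) [Finite Γ] : (Γ → ℝ) →ₗ[ℝ] (V →₀ ℝ) :=
  Finsupp.lmapDomain ℝ ℝ (Subtype.val : Γ → V) ∘ₗ
    (Finsupp.linearEquivFunOnFinite ℝ ℝ Γ).symm.toLinearMap

theorem extendZero_apply_mem {Γ : Set V} [Finite Γ] (f : Γ → ℝ) (v : Γ) :
    extendZero Γ f v = f v := by
  simp only [extendZero, LinearMap.comp_apply, Finsupp.lmapDomain_apply, LinearEquiv.coe_coe]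
  rw [Finsupp.mapDomain_apply Subtype.val_injective]
  simp

theorem extendZero_apply_of_notMem {Γ : Set V} [Finite Γ] (f : Γ → ℝ) {v : V} (hv : v ∉ Γ) :
    extendZero Γ f v = 0 := by
  simp only [extendZero, LinearMap.comp_apply, Finsupp.lmapDomain_apply, LinearEquiv.coe_coe]
  exact Finsupp.mapDomain_of_notMem_range _ _ (by simpa using hv)

/-- The dimension of `E_Γ` is the size of the boundary: its defining relations are linearly
independent, since a relation between them is an eigenvector supported in the interior. -/
theorem IsUniversalCover.exists_basis_eigenSpace (hd : IsExpanding d) (hT : IsUniversalCover d T τ)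
    {lam : ℝ} (hreg : IsRegularPoint T h lam) {Γ : Set V} (hΓ : Γ.Finite) :
    ∃ b : Fin (boundary T Γ).ncard → (V →₀ ℝ), LinearIndependent ℝ b ∧
      (∀ i, b i ∈ eigenSpace T h lam Γ) ∧
      ∀ ψ ∈ eigenSpace T h lam Γ, ∃ x : Fin (boundary T Γ).ncard → ℝ, ψ = ∑ i, x i • b i := by
  classical
  have : Fintype Γ := hΓ.fintype
  have hI : (Γ \ boundary T Γ).Finite := hΓ.subset Set.sdiff_subset
  have : Fintype ↥(Γ \ boundary T Γ) := hI.fintype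
  let L : (Γ → ℝ) →ₗ[ℝ] (↥(Γ \ boundary T Γ) → ℝ) :=
    { toFun := fun χ u => lam * extendZero Γ χ u - ∑ v ∈ nbrs T h u, extendZero Γ χ v
      map_add' := fun χ ψ => by
        funext u
        simp only [map_add, Finsupp.add_apply, Finset.sum_add_distrib, Pi.add_apply]
        ring
      map_smul' := fun c χ => by
        funext u
        simp only [map_smul, Finsupp.smul_apply, smul_eq_mul, ← Finset.mul_sum,
          Pi.smul_apply, RingHom.id_apply]
        ring }
  have hL : ∀ χ u, L χ u = lam * extendZero Γ χ u - ∑ v ∈ nbrs T h u, extendZero Γ χ v :=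
    fun χ u => rfl
  have hext : ∀ ψ ∈ eigenSpace T h lam Γ, extendZero Γ (fun u => ψ u) = ψ := by
    intro ψ hψ
    ext v
    by_cases hv : v ∈ Γ
    · exact extendZero_apply_mem _ ⟨v, hv⟩
    · rw [extendZero_apply_of_notMem _ hv, hψ.1 v hv]
  have hsurj : Function.Surjective L := by
    rw [← LinearMap.dualMap_injective_iff, injective_iff_map_eq_zero]
    intro ξ hξ
    -- The functional `ξ` is given by a vector `f` supported in the interior of `Γ`, and
    -- `ξ ∘ L = 0` says that `f` is an eigenvector.
    set f : V →₀ ℝ := extendZero (Γ \ boundary T Γ) (fun u => ξ (Pi.single u 1)) with hf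
    have hf0 : ∀ v, v ∉ Γ \ boundary T Γ → f v = 0 := fun v => extendZero_apply_of_notMem _
    have hξ' : ∀ y : ↥(Γ \ boundary T Γ) → ℝ, ξ y = ∑ u : ↥(Γ \ boundary T Γ), y u * f u := by
      intro y
      have h1 : y = ∑ u, y u • Pi.single u (1 : ℝ) := by
        funext v
        simp [Finset.sum_apply, Pi.single_apply]
      conv_lhs => rw [h1]
      rw [map_sum]
      refine Finset.sum_congr rfl fun u _ => ?_
      rw [map_smul, smul_eq_mul, hf, extendZero_apply_mem]
    have hfz : f = 0 := by
      refine hT.eq_zero_of_eigen hd hreg fun v => ?_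
      by_cases hv : v ∈ Γ
      · have hsingle : extendZero Γ (Pi.single ⟨v, hv⟩ 1) = Finsupp.single v 1 := by
          ext w
          by_cases hw : w ∈ Γ
          · rw [extendZero_apply_mem _ ⟨w, hw⟩, Pi.single_apply, Finsupp.single_apply]
            simp [eq_comm]
          · rw [extendZero_apply_of_notMem _ hw, Finsupp.single_eq_of_ne]
            rintro rfl
            exact hw hv
        have h1 := LinearMap.congr_fun hξ (Pi.single ⟨v, hv⟩ 1)
        rw [LinearMap.dualMap_apply, hξ', LinearMap.zero_apply] at h1
        simp only [hL, hsingle] at h1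
        have h2 : ∑ u : ↥(Γ \ boundary T Γ), (lam * Finsupp.single v (1 : ℝ) (u : V)
            - ∑ t ∈ nbrs T h u, Finsupp.single v (1 : ℝ) t) * f u
            = ∑ u ∈ hI.toFinset, (lam * Finsupp.single v (1 : ℝ) u
            - ∑ t ∈ nbrs T h u, Finsupp.single v (1 : ℝ) t) * f u := by
          rw [← Finset.sum_coe_sort hI.toFinset]
          refine Fintype.sum_equiv (Equiv.subtypeEquivRight (by simp)) _ _ fun u => rfl
        rw [h2] at h1
        have h3 : ∑ u ∈ hI.toFinset, (lam * Finsupp.single v (1 : ℝ) u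
            - ∑ t ∈ nbrs T h u, Finsupp.single v (1 : ℝ) t) * f u
            = lam * f v - ∑ u ∈ nbrs T h v, f u := by
          simp_rw [sub_mul, Finset.sum_sub_distrib]
          congr 1
          · simp_rw [Finsupp.single_apply, mul_ite, mul_one, mul_zero, ite_mul, zero_mul]
            rw [Finset.sum_ite_eq]
            split_ifs with h4
            · rfl
            · rw [hf0 v (by simpa using h4), mul_zero]
          · simp_rw [Finsupp.single_apply, Finset.sum_ite_eq, ite_mul, one_mul, zero_mul]
            rw [← Finset.sum_filter]
            have h5 : ∑ u ∈ nbrs T h v, f u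
                = ∑ u ∈ (nbrs T h v).filter (· ∈ Γ \ boundary T Γ), f u := by
              refine (Finset.sum_filter_of_ne fun w _ hw => ?_).symm
              by_contra hwS
              exact hw (hf0 w hwS)
            rw [h5]
            refine Finset.sum_congr ?_ fun _ _ => rfl
            ext w
            simp only [Finset.mem_filter, Set.Finite.mem_toFinset, mem_nbrs]
            rw [and_comm, SimpleGraph.adj_comm]
        rw [h3] at h1
        linarith
      · rw [hf0 v fun h0 => hv h0.1, mul_zero, sub_zero]
        refine Finset.sum_eq_zero fun w hw => hf0 w fun h0 => ?_
        exact h0.2 ⟨h0.1, v, hv, ((mem_nbrs h).1 hw).symm⟩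
    ext u
    rw [LinearMap.coe_comp, Function.comp_apply, LinearMap.coe_single, hξ', hfz]
    simp
  have h1 := LinearMap.finrank_range_add_finrank_ker L
  rw [LinearMap.range_eq_top.2 hsurj, finrank_top, Module.finrank_pi, Module.finrank_pi] at h1
  have h3 : (Γ \ boundary T Γ).ncard + (boundary T Γ).ncard = Γ.ncard :=
    Set.ncard_sdiff_add_ncard_of_subset (fun u hu => hu.1) hΓ
  rw [← Nat.card_eq_fintype_card, ← Nat.card_eq_fintype_card, Nat.card_coe_set_eq,
    Nat.card_coe_set_eq] at h1
  let β := Module.finBasisOfFinrankEq ℝ (LinearMap.ker L) (n := (boundary T Γ).ncard) (by omega)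
  refine ⟨fun i => extendZero Γ (β i), ?_, fun i => ⟨fun v hv => extendZero_apply_of_notMem _ hv,
    fun u hu => congrFun (LinearMap.mem_ker.1 (β i).2) ⟨u, hu⟩⟩, fun ψ hψ => ?_⟩
  · rw [Fintype.linearIndependent_iff]
    intro x hx
    refine Fintype.linearIndependent_iff.1 β.linearIndependent x (Subtype.ext ?_)
    rw [Submodule.coe_sum]
    funext u
    have h2 : extendZero Γ (∑ i, x i • (β i : Γ → ℝ)) = 0 := by
      rw [map_sum, ← hx]
      exact Finset.sum_congr rfl fun i _ => map_smul _ _ _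
    have h4 := extendZero_apply_mem (∑ i, x i • (β i : Γ → ℝ)) u
    rw [h2] at h4
    exact h4.symm
  · have hmem : (fun u : Γ => ψ u) ∈ LinearMap.ker L := by
      rw [LinearMap.mem_ker]
      funext u
      rw [hL, hext ψ hψ]
      exact hψ.2 u u.2
    refine ⟨β.repr ⟨_, hmem⟩, ?_⟩
    have h2 := congrArg (fun y : LinearMap.ker L => extendZero Γ (y : Γ → ℝ))
      (β.sum_repr ⟨_, hmem⟩)
    simp only [hext ψ hψ, Submodule.coe_sum, map_sum, Submodule.coe_smul, map_smul] at h2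
    exact h2.symm

end FinResolvent

/-! ### Discretization bases -/

section Bases

variable {V : Type*} {T : SimpleGraph V} {h : BoundedDegree T} {lam : ℝ} {g : V → L2 V}
  {k : V → V → ℝ} {Γ : Set V}

theorem exists_isDiscretizationBasis (hg : ∀ u v, inner ℂ (g u) (g v) = (k u v : ℂ))
    (hk : ∀ u v, k u v = k v u) (hpos : ∀ χ : V →₀ ℝ, χ ≠ 0 → 0 < kernelForm k χ χ)
    {b : Fin (boundary T Γ).ncard → (V →₀ ℝ)} (hli : LinearIndependent ℝ b)
    (hmem : ∀ i, b i ∈ eigenSpace T h lam Γ)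
    (hspan : ∀ ψ ∈ eigenSpace T h lam Γ, ∃ x : Fin (boundary T Γ).ncard → ℝ,
      ψ = ∑ i, x i • b i) :
    ∃ χ, IsDiscretizationBasis T h lam g Γ χ := by
  have hM : (gram k b).PosDef := posDef_gram hk (E := ⊤) (fun χ _ h0 => hpos χ h0)
    (fun i => Submodule.mem_top) hli
  obtain ⟨C, χ, -, -, hgram, hχb, hbχ⟩ := exists_gram_eq_one hM
  refine ⟨χ, ?_, le_antisymm ?_ ?_⟩
  · rw [orthonormal_iff_ite]
    intro i j
    rw [inner_comb hg, ← gram_apply, hgram, Matrix.one_apply]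
    split_ifs <;> simp
  · rw [Submodule.span_le]
    rintro _ ⟨i, rfl⟩
    rw [SetLike.mem_coe, hχb i]
    exact Submodule.sum_mem _ fun j _ => Submodule.smul_mem _ _ (hmem j)
  · intro ψ hψ
    obtain ⟨x, rfl⟩ := hspan ψ hψ
    refine Submodule.sum_mem _ fun j _ => Submodule.smul_mem _ _ ?_
    rw [hbχ j]
    exact Submodule.sum_mem _ fun i _ => Submodule.smul_mem _ _
      (Submodule.subset_span (Set.mem_range_self i))

theorem IsDiscretizationBasis.mem {χ : Fin (boundary T Γ).ncard → (V →₀ ℝ)}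
    (hχ : IsDiscretizationBasis T h lam g Γ χ) (i) : χ i ∈ eigenSpace T h lam Γ := by
  rw [← hχ.span_eq]
  exact Submodule.subset_span (Set.mem_range_self i)

theorem IsDiscretizationBasis.linearIndependent {χ : Fin (boundary T Γ).ncard → (V →₀ ℝ)}
    (hχ : IsDiscretizationBasis T h lam g Γ χ) : LinearIndependent ℝ χ := by
  rw [Fintype.linearIndependent_iff]
  intro x hx i
  have h1 := congrArg (comb g) hx
  rw [comb_sum, comb_zero] at h1
  simp only [comb_smul] at h1
  have := Fintype.linearIndependent_iff.1 hχ.orthonormal.linearIndependent _ h1 i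
  exact_mod_cast this

/-- The determinant of a form along a discretization basis does not depend on that basis. -/
theorem IsDiscretizationBasis.det_gram_mul (hg : ∀ u v, inner ℂ (g u) (g v) = (k u v : ℂ))
    {χ : Fin (boundary T Γ).ncard → (V →₀ ℝ)} (hχ : IsDiscretizationBasis T h lam g Γ χ)
    {b : Fin (boundary T Γ).ncard → (V →₀ ℝ)}
    (hspan : ∀ ψ ∈ eigenSpace T h lam Γ, ∃ x : Fin (boundary T Γ).ncard → ℝ,
      ψ = ∑ i, x i • b i) (K : V → V → ℝ) :
    (gram K χ).det * (gram k b).det = (gram K b).det := by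
  choose x hx using fun i => hspan (χ i) (hχ.mem i)
  set P : Matrix (Fin (boundary T Γ).ncard) (Fin (boundary T Γ).ncard) ℝ := Matrix.of x
  have hPχ : ∀ i, χ i = ∑ j, P i j • b j := hx
  have h1 : gram k χ = 1 := by
    ext i j
    have h2 := orthonormal_iff_ite.1 hχ.orthonormal i j
    rw [inner_comb hg] at h2
    rw [gram_apply, Matrix.one_apply]
    split_ifs at h2 ⊢ <;> exact_mod_cast h2
  have e1 := congrArg Matrix.det h1
  rw [gram_linearCombination k hPχ, Matrix.det_one, Matrix.det_mul, Matrix.det_mul,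
    Matrix.det_transpose] at e1
  rw [gram_linearCombination K hPχ, Matrix.det_mul, Matrix.det_mul, Matrix.det_transpose]
  linear_combination (gram K b).det * e1

end Bases

/-! ### Balls around stars and edges -/

section LocalSets

variable {V : Type*} {T : SimpleGraph V} {h : BoundedDegree T}

theorem finite_dist_le (hT : T.IsTree) (h : BoundedDegree T) (o : V) (k : ℕ) :
    {w | T.dist o w ≤ k}.Finite := by
  induction k with
  | zero =>
    refine (Set.finite_singleton o).subset fun w hw => ?_
    have : T.dist o w = 0 := Nat.le_zero.1 hw
    exact ((hT.connected.dist_eq_zero_iff).1 this).symm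
  | succ k ih =>
    refine (ih.union (ih.biUnion fun u _ => (nbrs T h u).finite_toSet)).subset fun w hw => ?_
    by_cases hwo : w = o
    · left
      subst hwo
      simp
    · obtain ⟨a, ha, hoa⟩ := exists_adj_mem_branch hT hwo
      right
      rw [mem_branch, T.dist_comm, T.dist_comm (u := a)] at hoa
      have hw' : T.dist o w ≤ k + 1 := hw
      refine Set.mem_biUnion (x := a) (show T.dist o a ≤ k by omega) ?_
      exact (mem_nbrs h).2 ha.symm

theorem exists_adj_notMem_branch (hT : T.IsTree) (hmin : ∀ v, 2 ≤ (nbrs T h v).card) (o w : V) :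
    ∃ y, T.Adj w y ∧ o ∉ branch T w y := by
  obtain ⟨y₁, h₁, y₂, h₂, hne⟩ := Finset.one_lt_card.1 (hmin w)
  rw [mem_nbrs] at h₁ h₂
  by_cases h3 : o ∈ branch T w y₁
  · exact ⟨y₂, h₂, fun h4 => hne (eq_of_mem_branch hT h₁ h₂ h3 h4)⟩
  · exact ⟨y₁, h₁, h3⟩

theorem mem_ball_star (hT : T.IsTree) {k : ℕ} {o w : V} :
    w ∈ ball T k (star T o) ↔ T.dist o w ≤ k + 1 := by
  constructor
  · rintro ⟨u, hu, huw⟩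
    rcases hu with rfl | hu
    · omega
    · have h1 := hT.connected.dist_triangle (u := o) (v := u) (w := w)
      rw [SimpleGraph.dist_eq_one_iff_adj.2 hu] at h1
      omega
  · intro hw
    by_cases how : o = w
    · subst how
      exact ⟨o, Set.mem_insert _ _, by simp⟩
    · obtain ⟨a, ha, hwa⟩ := exists_adj_mem_branch hT how
      rw [mem_branch] at hwa
      exact ⟨a, Set.mem_insert_of_mem _ ha, by omega⟩

theorem disjoint_branch_ball_star (hT : T.IsTree) {k : ℕ} {o w y : V} (hwy : T.Adj w y)
    (ho : o ∉ branch T w y) (hw : k + 1 ≤ T.dist o w) :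
    Disjoint (branch T w y) (ball T k (star T o)) := by
  rw [Set.disjoint_left]
  intro s hs hs'
  rw [mem_ball_star hT] at hs'
  have := dist_eq_of_mem_branch hT hwy ho hs
  omega

theorem mem_boundary_ball_star (hT : T.IsTree) (hmin : ∀ v, 2 ≤ (nbrs T h v).card) {k : ℕ}
    {o w : V} : w ∈ boundary T (ball T k (star T o)) ↔ T.dist o w = k + 1 := by
  constructor
  · rintro ⟨hw, v, hv, hwv⟩
    rw [mem_ball_star hT] at hw hv
    have h1 := hT.dist_eq_dist_add_one_of_adj o hwv
    omega
  · intro hw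
    obtain ⟨y, hwy, ho⟩ := exists_adj_notMem_branch hT hmin o w
    refine ⟨(mem_ball_star hT).2 hw.le, y, ?_, hwy⟩
    exact Set.disjoint_left.1 (disjoint_branch_ball_star hT hwy ho hw.ge) (snd_mem_branch hwy)

theorem hasFreeBranches_ball_star (hT : T.IsTree) (hmin : ∀ v, 2 ≤ (nbrs T h v).card) (k : ℕ)
    (o : V) : HasFreeBranches T (ball T k (star T o)) := by
  intro w hw
  obtain ⟨y, hwy, ho⟩ := exists_adj_notMem_branch hT hmin o w
  refine ⟨y, hwy, disjoint_branch_ball_star hT hwy ho ?_⟩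
  by_contra! hlt
  refine hw ⟨(mem_ball_star hT).2 (by omega), fun hb => ?_⟩
  rw [mem_boundary_ball_star hT hmin] at hb
  omega

theorem mem_ball_pair {k : ℕ} {a b w : V} :
    w ∈ ball T k {a, b} ↔ T.dist a w ≤ k ∨ T.dist b w ≤ k := by
  simp [ball]

theorem exists_disjoint_branch_ball_pair (hT : T.IsTree) (hmin : ∀ v, 2 ≤ (nbrs T h v).card)
    {k : ℕ} {a b w : V} (hab : T.Adj a b) (hw : w ∉ branch T a b) (hk : k ≤ T.dist a w) :
    ∃ y, T.Adj w y ∧ Disjoint (branch T w y) (ball T k {a, b}) := by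
  have hwb : w ≠ b := by
    rintro rfl
    exact hw (snd_mem_branch hab)
  obtain ⟨y, hwy, hb⟩ := exists_adj_notMem_branch hT hmin b w
  have ha : a ∉ branch T w y := fun ha =>
    hwb (eq_of_adj_branch hT hwy hab ha hb).2.symm
  refine ⟨y, hwy, ?_⟩
  rw [Set.disjoint_left]
  intro s hs hs'
  rw [mem_ball_pair] at hs'
  have h1 := dist_eq_of_mem_branch hT hwy ha hs
  have h2 := dist_eq_of_mem_branch hT hwy hb hs
  have h3 := dist_of_notMem_branch hT hab hw
  omega

theorem mem_boundary_ball_pair_of_notMem (hT : T.IsTree) (hmin : ∀ v, 2 ≤ (nbrs T h v).card)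
    {k : ℕ} {a b w : V} (hab : T.Adj a b) (hw : w ∉ branch T a b) :
    w ∈ boundary T (ball T k {a, b}) ↔ T.dist a w = k := by
  have h3 := dist_of_notMem_branch hT hab hw
  constructor
  · rintro ⟨hwΓ, v, hv, hwv⟩
    rw [mem_ball_pair] at hwΓ hv
    have h1 := hT.dist_eq_dist_add_one_of_adj a hwv
    omega
  · intro hk
    obtain ⟨y, hwy, hd⟩ := exists_disjoint_branch_ball_pair hT hmin hab hw hk.ge
    exact ⟨mem_ball_pair.2 (Or.inl hk.le), y,
      Set.disjoint_left.1 hd (snd_mem_branch hwy), hwy⟩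

theorem mem_boundary_ball_pair (hT : T.IsTree) (hmin : ∀ v, 2 ≤ (nbrs T h v).card)
    {k : ℕ} {a b w : V} (hab : T.Adj a b) :
    w ∈ boundary T (ball T k {a, b}) ↔
      (w ∈ branch T b a ∧ T.dist a w = k) ∨ (w ∈ branch T a b ∧ T.dist b w = k) := by
  rw [← notMem_branch_iff hT hab]
  by_cases hw : w ∈ branch T a b
  · have hw' : w ∉ branch T b a := fun h0 => (notMem_branch_iff hT hab).2 h0 hw
    rw [Set.pair_comm, mem_boundary_ball_pair_of_notMem hT hmin hab.symm hw']
    tauto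
  · rw [mem_boundary_ball_pair_of_notMem hT hmin hab hw]
    tauto

theorem hasFreeBranches_ball_pair (hT : T.IsTree) (hmin : ∀ v, 2 ≤ (nbrs T h v).card) (k : ℕ)
    {a b : V} (hab : T.Adj a b) : HasFreeBranches T (ball T k {a, b}) := by
  have key : ∀ {a b w : V}, T.Adj a b → w ∉ branch T a b →
      w ∉ ball T k {a, b} \ boundary T (ball T k {a, b}) →
      ∃ y, T.Adj w y ∧ Disjoint (branch T w y) (ball T k {a, b}) := by
    intro a b w hab hb hw
    refine exists_disjoint_branch_ball_pair hT hmin hab hb ?_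
    by_contra! hlt
    refine hw ⟨mem_ball_pair.2 (Or.inl hlt.le), fun h0 => ?_⟩
    rw [mem_boundary_ball_pair_of_notMem hT hmin hab hb] at h0
    omega
  intro w hw
  by_cases hb : w ∈ branch T a b
  · have hb' : w ∉ branch T b a := fun h0 => (notMem_branch_iff hT hab).2 h0 hb
    rw [Set.pair_comm] at hw ⊢
    exact key hab.symm hb' hw
  · exact key hab hb hw

theorem localSets_finite_hasFreeBranches (hT : T.IsTree) (hmin : ∀ v, 2 ≤ (nbrs T h v).card)
    {k : ℕ} {Γ : Set V} (hΓ : Γ ∈ localSets T k) : Γ.Finite ∧ HasFreeBranches T Γ := by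
  rcases hΓ with ⟨o, rfl⟩ | ⟨a, b, hab, rfl⟩
  · refine ⟨(finite_dist_le hT h o (k + 1)).subset fun w hw => (mem_ball_star hT).1 hw,
      hasFreeBranches_ball_star hT hmin k o⟩
  · refine ⟨((finite_dist_le hT h a k).union (finite_dist_le hT h b k)).subset
      fun w hw => mem_ball_pair.1 hw, hasFreeBranches_ball_pair hT hmin k hab⟩

/-- The vertices at distance `k` from the root `y` of the branch of `y` seen from `x`. -/
noncomputable def level (hT : T.IsTree) (h : BoundedDegree T) (k : ℕ) (x y : V) : Finset V :=
  Set.Finite.toFinset (s := {w | w ∈ branch T x y ∧ T.dist y w = k})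
    ((finite_dist_le hT h y k).subset fun _ hw => hw.2.le)

theorem mem_level (hT : T.IsTree) {k : ℕ} {x y w : V} :
    w ∈ level hT h k x y ↔ w ∈ branch T x y ∧ T.dist y w = k := by
  simp [level]

theorem card_level_zero (hT : T.IsTree) {x y : V} (hxy : T.Adj x y) :
    (level hT h 0 x y).card = 1 := by
  rw [Finset.card_eq_one]
  refine ⟨y, ?_⟩
  ext w
  rw [mem_level, Finset.mem_singleton, hT.connected.dist_eq_zero_iff]
  constructor
  · rintro ⟨-, rfl⟩
    rfl
  · rintro rfl
    exact ⟨snd_mem_branch hxy, rfl⟩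

theorem pairwiseDisjoint_level (hT : T.IsTree) (k : ℕ) (y : V) :
    Set.PairwiseDisjoint (nbrs T h y : Set V) (level hT h k y) := by
  intro a ha b hb hab
  rw [Function.onFun, Finset.disjoint_left]
  intro w hwa hwb
  rw [mem_level] at hwa hwb
  exact hab (eq_of_mem_branch hT ((mem_nbrs h).1 ha) ((mem_nbrs h).1 hb) hwa.1 hwb.1)

theorem card_level_succ (hT : T.IsTree) {k : ℕ} {x y : V} (hxy : T.Adj x y) [DecidableEq V] :
    (level hT h (k + 1) x y).card = ∑ c ∈ (nbrs T h y).erase x, (level hT h k y c).card := by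
  rw [← Finset.card_biUnion fun a ha b hb hab => pairwiseDisjoint_level hT k y
    (Finset.mem_of_mem_erase ha) (Finset.mem_of_mem_erase hb) hab]
  congr 1
  ext w
  simp only [mem_level, Finset.mem_biUnion, Finset.mem_erase, mem_nbrs]
  constructor
  · rintro ⟨hw, hk⟩
    have hyw : y ≠ w := by
      rintro rfl
      simp at hk
    obtain ⟨c, hc, hwc⟩ := exists_adj_mem_branch hT hyw
    refine ⟨c, ⟨?_, hc⟩, hwc, ?_⟩
    · rintro rfl
      exact (notMem_branch_iff hT hc).2 hw hwc
    · rw [mem_branch] at hwc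
      omega
  · rintro ⟨c, ⟨hcx, hc⟩, hwc, hk⟩
    have h1 := hwc
    rw [mem_branch] at h1
    refine ⟨?_, by omega⟩
    by_contra hw
    rw [notMem_branch_iff hT hxy] at hw
    exact hcx (eq_of_mem_branch hT hc hxy.symm hwc hw)

theorem ncard_boundary_ball_star (hT : T.IsTree) (hmin : ∀ v, 2 ≤ (nbrs T h v).card) (k : ℕ)
    (o : V) :
    (boundary T (ball T k (star T o))).ncard = ∑ y ∈ nbrs T h o, (level hT h k o y).card := by
  classical
  rw [← Finset.card_biUnion fun a ha b hb hab => pairwiseDisjoint_level hT k o ha hb hab,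
    ← Set.ncard_coe_finset]
  congr 1
  ext w
  simp only [Finset.coe_biUnion, Set.mem_iUnion, Finset.mem_coe, mem_level, mem_nbrs,
    mem_boundary_ball_star hT hmin, exists_prop]
  constructor
  · intro hk
    have how : o ≠ w := by
      rintro rfl
      simp at hk
    obtain ⟨c, hc, hwc⟩ := exists_adj_mem_branch hT how
    refine ⟨c, hc, hwc, ?_⟩
    rw [mem_branch] at hwc
    omega
  · rintro ⟨c, hc, hwc, hk⟩
    rw [mem_branch] at hwc
    omega

theorem ncard_boundary_ball_pair (hT : T.IsTree) (hmin : ∀ v, 2 ≤ (nbrs T h v).card) (k : ℕ)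
    {a b : V} (hab : T.Adj a b) : (boundary T (ball T k {a, b})).ncard
      = (level hT h k a b).card + (level hT h k b a).card := by
  classical
  rw [← Finset.card_union_of_disjoint, ← Set.ncard_coe_finset]
  · congr 1
    ext w
    rw [mem_boundary_ball_pair hT hmin hab, Finset.mem_coe, Finset.mem_union, mem_level, mem_level,
      or_comm]
  · rw [Finset.disjoint_left]
    intro w h1 h2
    rw [mem_level] at h1 h2
    exact (notMem_branch_iff hT hab).2 h2.1 h1.1

variable {n : ℕ} {d : Matrix (Fin n) (Fin n) ℕ} {τ : V → Fin n}

theorem IsUniversalCover.exists_card_level (hT : IsUniversalCover d T τ) (k : ℕ) :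
    ∃ N : Fin n → Fin n → ℝ, ∀ x y, T.Adj x y →
      ((level hT.isTree h k x y).card : ℝ) = N (τ x) (τ y) := by
  classical
  induction k with
  | zero => exact ⟨fun _ _ => 1, fun x y hxy => by rw [card_level_zero hT.isTree hxy]; simp⟩
  | succ k ih =>
    obtain ⟨N, hN⟩ := ih
    refine ⟨fun i j => (∑ l, d j l • N j l) - N j i, fun x y hxy => ?_⟩
    have e1 := hT.sum_nbrs (h := h) (N (τ y)) y
    rw [card_level_succ hT.isTree hxy, Nat.cast_sum,
      Finset.sum_erase_eq_sub ((mem_nbrs h).2 hxy.symm), hN y x hxy.symm]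
    beta_reduce
    rw [← e1]
    congr 1
    exact Finset.sum_congr rfl fun c hc => hN y c ((mem_nbrs h).1 hc)

/-- The dimensions of the spaces `E_Γ` cancel in the average over the root: both boundaries count
paths of length `k + 1`, from one end and from either end, and `q_i d_ij = q_j d_ji`. -/
theorem IsUniversalCover.sum_ncard_boundary (hd : IsExpanding d) (hT : IsUniversalCover d T τ)
    {q : Fin n → ℝ} (hq : IsRootLaw d q) {o : Fin n → V} (ho : ∀ i, τ (o i) = i) (k : ℕ) :
    ∑ i, q i * (((boundary T (ball T k (star T (o i)))).ncard : ℝ)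
      - 1 / 2 * ∑ x ∈ nbrs T h (o i), ((boundary T (ball T k {o i, x})).ncard : ℝ)) = 0 := by
  have hmin := hT.two_le_card_nbrs (h := h) hd
  obtain ⟨N, hN⟩ := hT.exists_card_level (h := h) k
  have h1 : ∀ i, ((boundary T (ball T k (star T (o i)))).ncard : ℝ) = ∑ j, d i j • N i j := by
    intro i
    have e1 := hT.sum_nbrs (h := h) (N i) (o i)
    rw [ho] at e1
    rw [ncard_boundary_ball_star hT.isTree hmin, Nat.cast_sum, ← e1]
    refine Finset.sum_congr rfl fun y hy => ?_
    rw [hN (o i) y ((mem_nbrs h).1 hy), ho]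
  have h2 : ∀ i, ∑ x ∈ nbrs T h (o i), ((boundary T (ball T k {o i, x})).ncard : ℝ)
      = ∑ j, d i j • (N i j + N j i) := by
    intro i
    have e1 := hT.sum_nbrs (h := h) (fun j => N i j + N j i) (o i)
    rw [ho] at e1
    rw [← e1]
    refine Finset.sum_congr rfl fun y hy => ?_
    rw [mem_nbrs] at hy
    rw [ncard_boundary_ball_pair hT.isTree hmin k hy, Nat.cast_add, hN (o i) y hy,
      hN y (o i) hy.symm, ho]
  simp_rw [h1, h2, nsmul_eq_mul]
  have h3 : ∑ i, ∑ j, q i * d i j * N j i = ∑ i, ∑ j, q i * d i j * N i j := by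
    rw [Finset.sum_comm]
    exact Finset.sum_congr rfl fun i _ => Finset.sum_congr rfl fun j _ => by rw [hq.balance j i]
  have h4 : ∀ i, q i * (∑ j, (d i j : ℝ) * N i j - 1 / 2 * ∑ j, (d i j : ℝ) * (N i j + N j i))
      = 1 / 2 * (∑ j, q i * d i j * N i j - ∑ j, q i * d i j * N j i) := by
    intro i
    simp_rw [Finset.mul_sum, ← Finset.sum_sub_distrib, Finset.mul_sum]
    exact Finset.sum_congr rfl fun j _ => by ring
  simp_rw [h4]
  rw [← Finset.mul_sum, Finset.sum_sub_distrib, h3, sub_self, mul_zero]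

end LocalSets

/-! ### Entropy of finely discretized densities -/

section Discretization

variable {m : ℕ}

/-- The discretization of `ℝ^m` at scale `a`, in which each point is rounded down to the grid
`a⁻¹ ℤ^m`. -/
noncomputable def gridFloor (a : ℝ) (x : Fin m → ℝ) : Fin m → ℝ := fun j => (⌊a * x j⌋ : ℝ) / a

theorem measurable_gridFloor (a : ℝ) : Measurable (gridFloor a : (Fin m → ℝ) → Fin m → ℝ) := by
  refine measurable_pi_iff.2 fun j => ?_
  have h1 : Measurable fun x : Fin m → ℝ => ⌊a * x j⌋ :=
    Int.measurable_floor.comp (measurable_const.mul (measurable_pi_apply j))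
  exact ((measurable_from_top (f := fun z : ℤ => (z : ℝ))).comp h1).div_const a

theorem gridFloor_eq_iff {a : ℝ} (ha : 0 < a) (x y : Fin m → ℝ) :
    gridFloor a y = gridFloor a x ↔
      y ∈ Set.univ.pi fun j => Set.Ico ((⌊a * x j⌋ : ℝ) / a) (((⌊a * x j⌋ : ℝ) + 1) / a) := by
  simp only [Set.mem_univ_pi, Set.mem_Ico, div_le_iff₀ ha, lt_div_iff₀ ha]
  rw [funext_iff]
  refine forall_congr' fun j => ?_
  simp only [gridFloor]
  rw [div_left_inj' ha.ne', Int.cast_inj, Int.floor_eq_iff, mul_comm a (y j)]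

theorem volume_gridCell {a : ℝ} (ha : 0 < a) (x : Fin m → ℝ) :
    volume (gridFloor a ⁻¹' {gridFloor a x}) = ENNReal.ofReal (a⁻¹ ^ m) := by
  have h1 : gridFloor a ⁻¹' {gridFloor a x} =
      Set.univ.pi fun j => Set.Ico ((⌊a * x j⌋ : ℝ) / a) (((⌊a * x j⌋ : ℝ) + 1) / a) := by
    ext y
    simp only [Set.mem_preimage, Set.mem_singleton_iff]
    exact gridFloor_eq_iff ha x y
  rw [h1, volume_pi_pi]
  have h2 : ∀ j, ((⌊a * x j⌋ : ℝ) + 1) / a - (⌊a * x j⌋ : ℝ) / a = a⁻¹ := by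
    intro j
    field_simp
    ring
  simp only [Real.volume_Ico, h2, Finset.prod_const, Finset.card_univ, Fintype.card_fin]
  rw [ENNReal.ofReal_pow (by positivity)]

theorem norm_sub_le_of_gridFloor_eq {a : ℝ} (ha : 0 < a) {x y : Fin m → ℝ}
    (hxy : gridFloor a y = gridFloor a x) : ‖x - y‖ ≤ a⁻¹ := by
  refine (pi_norm_le_iff_of_nonneg (by positivity)).2 fun j => ?_
  have hy := (gridFloor_eq_iff ha x y).1 hxy j (Set.mem_univ j)
  have hx := (gridFloor_eq_iff ha x x).1 rfl j (Set.mem_univ j)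
  have h2 : ((⌊a * x j⌋ : ℝ) + 1) / a - (⌊a * x j⌋ : ℝ) / a = a⁻¹ := by
    field_simp
    ring
  rw [Pi.sub_apply, Real.norm_eq_abs, abs_le]
  constructor <;> linarith [hy.1, hy.2, hx.1, hx.2]

/-- On a grid cell of volume `a⁻ᵐ` a slowly varying log-density is almost constant, so that the
surprisal of the cell is close to `m log a` plus the negative log-density. -/
theorem abs_surprisal_gridFloor_le {P : Measure (Fin m → ℝ)} {ψ : (Fin m → ℝ) → ℝ}
    (hP : P = volume.withDensity fun x => ENNReal.ofReal (Real.exp (-ψ x)))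
    {K : ℝ} (hK : 0 ≤ K)
    (hψ : ∀ x y, |ψ x - ψ y| ≤ K * ‖x - y‖ * (‖x‖ + ‖x - y‖)) {a : ℝ} (ha : 0 < a)
    (x : Fin m → ℝ) :
    |surprisal (P.map (gridFloor a)) (gridFloor a x) - m * Real.log a - ψ x|
      ≤ K * a⁻¹ * (‖x‖ + a⁻¹) := by
  set Q := gridFloor a ⁻¹' {gridFloor a x} with hQ
  set δ := K * a⁻¹ * (‖x‖ + a⁻¹) with hδ
  have hQm : MeasurableSet Q := measurable_gridFloor a (measurableSet_singleton _)
  have hQδ : ∀ y ∈ Q, |ψ x - ψ y| ≤ δ := by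
    intro y hy
    have h1 := norm_sub_le_of_gridFloor_eq ha (hy : gridFloor a y = gridFloor a x)
    refine (hψ x y).trans ?_
    rw [hδ]
    gcongr
  have hPQ : P Q = ∫⁻ y in Q, ENNReal.ofReal (Real.exp (-ψ y)) := by
    rw [hP, withDensity_apply _ hQm]
  have hvol : volume Q = ENNReal.ofReal (a⁻¹ ^ m) := volume_gridCell ha x
  have hup : P Q ≤ ENNReal.ofReal (Real.exp (-ψ x + δ) * a⁻¹ ^ m) := by
    rw [hPQ, ENNReal.ofReal_mul (Real.exp_pos _).le, ← hvol, ← setLIntegral_const]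
    refine setLIntegral_mono' hQm fun y hy => ENNReal.ofReal_le_ofReal (Real.exp_le_exp.2 ?_)
    linarith [(abs_le.1 (hQδ y hy)).2]
  have hlo : ENNReal.ofReal (Real.exp (-ψ x - δ) * a⁻¹ ^ m) ≤ P Q := by
    rw [hPQ, ENNReal.ofReal_mul (Real.exp_pos _).le, ← hvol, ← setLIntegral_const]
    refine setLIntegral_mono' hQm fun y hy => ENNReal.ofReal_le_ofReal (Real.exp_le_exp.2 ?_)
    linarith [(abs_le.1 (hQδ y hy)).1]
  have hfin : P Q ≠ ∞ := ne_top_of_le_ne_top ENNReal.ofReal_ne_top hup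
  have hup' : P.real Q ≤ Real.exp (-ψ x + δ) * a⁻¹ ^ m :=
    ENNReal.toReal_le_of_le_ofReal (by positivity) hup
  have hlo' : Real.exp (-ψ x - δ) * a⁻¹ ^ m ≤ P.real Q :=
    (ENNReal.ofReal_le_iff_le_toReal hfin).1 hlo
  have hpos : 0 < Real.exp (-ψ x - δ) * a⁻¹ ^ m := by positivity
  have hlog : ∀ t : ℝ, Real.log (Real.exp t * a⁻¹ ^ m) = t - m * Real.log a := by
    intro t
    rw [Real.log_mul (Real.exp_ne_zero _) (by positivity), Real.log_exp, Real.log_pow,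
      Real.log_inv]
    ring
  have h1 := Real.log_le_log hpos hlo'
  have h2 := Real.log_le_log (hpos.trans_le hlo') hup'
  rw [hlog] at h1 h2
  have hs : surprisal (P.map (gridFloor a)) (gridFloor a x) = -Real.log (P.real Q) := by
    rw [surprisal, map_measureReal_apply (measurable_gridFloor a) (measurableSet_singleton _)]
  rw [hs, abs_le]
  constructor <;> linarith

theorem countable_range_gridFloor (a : ℝ) :
    (Set.range (gridFloor a : (Fin m → ℝ) → Fin m → ℝ)).Countable := by
  refine (Set.countable_range fun (z : Fin m → ℤ) (j : Fin m) => (z j : ℝ) / a).mono ?_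
  rintro _ ⟨x, rfl⟩
  exact ⟨fun j => ⌊a * x j⌋, rfl⟩

theorem aestronglyMeasurable_surprisal_gridFloor (P : Measure (Fin m → ℝ)) (a : ℝ) :
    AEStronglyMeasurable (surprisal (P.map (gridFloor a))) (P.map (gridFloor a)) := by
  classical
  set S := Set.range (gridFloor a : (Fin m → ℝ) → Fin m → ℝ) with hS
  have hSc : S.Countable := countable_range_gridFloor a
  have hmeas : Measurable (S.indicator (surprisal (P.map (gridFloor a)))) := by
    refine (measurable_zero (α := ℝ)).measurable_of_countable_ne (hSc.mono fun x hx => ?_)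
    by_contra hxS
    exact hx (by simp [hxS])
  refine ⟨_, hmeas.stronglyMeasurable, ?_⟩
  have hae : S ∈ ae (P.map (gridFloor a)) :=
    (mem_ae_map_iff (measurable_gridFloor a).aemeasurable hSc.measurableSet).2
      (Eventually.of_forall fun x => Set.mem_range_self x)
  filter_upwards [hae] with x hx
  rw [Set.indicator_of_mem hx]

theorem integrable_surprisal_gridFloor {P : Measure (Fin m → ℝ)} [IsProbabilityMeasure P]
    {ψ : (Fin m → ℝ) → ℝ}
    (hP : P = volume.withDensity fun x => ENNReal.ofReal (Real.exp (-ψ x)))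
    {K : ℝ} (hK : 0 ≤ K)
    (hψ : ∀ x y, |ψ x - ψ y| ≤ K * ‖x - y‖ * (‖x‖ + ‖x - y‖))
    (hint : Integrable ψ P) (hnorm : Integrable (fun x => ‖x‖) P) {a : ℝ} (ha : 0 < a) :
    Integrable (surprisal (P.map (gridFloor a))) (P.map (gridFloor a)) := by
  have hm := (measurable_gridFloor (m := m) a).aemeasurable (μ := P)
  have hs := aestronglyMeasurable_surprisal_gridFloor P a
  rw [integrable_map_measure hs hm]
  have h1 : Integrable (fun x => K * a⁻¹ * (‖x‖ + a⁻¹) + |m * Real.log a| + |ψ x|) P :=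
    (((hnorm.add (integrable_const _)).const_mul _).add (integrable_const _)).add hint.abs
  refine h1.mono' (hs.comp_aemeasurable hm) (Eventually.of_forall fun x => ?_)
  have h2 := abs_surprisal_gridFloor_le hP hK hψ ha x
  have h3 := abs_add_three (surprisal (P.map (gridFloor a)) (gridFloor a x)
    - m * Real.log a - ψ x) (m * Real.log a) (ψ x)
  rw [Function.comp_apply, Real.norm_eq_abs]
  have h4 : surprisal (P.map (gridFloor a)) (gridFloor a x) - m * Real.log a - ψ x
    + m * Real.log a + ψ x = surprisal (P.map (gridFloor a)) (gridFloor a x) := by ring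
  rw [h4] at h3
  linarith

/-- The Shannon entropy of the discretization at scale `a` is `m log a` plus the differential
entropy, up to an error that vanishes as `a → ∞`. -/
theorem tendsto_shannonEntropy_gridFloor {P : Measure (Fin m → ℝ)} [IsProbabilityMeasure P]
    {ψ : (Fin m → ℝ) → ℝ}
    (hP : P = volume.withDensity fun x => ENNReal.ofReal (Real.exp (-ψ x)))
    {K : ℝ} (hK : 0 ≤ K)
    (hψ : ∀ x y, |ψ x - ψ y| ≤ K * ‖x - y‖ * (‖x‖ + ‖x - y‖))
    (hint : Integrable ψ P) (hnorm : Integrable (fun x => ‖x‖) P) :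
    Tendsto (fun a => shannonEntropy (P.map (gridFloor a)) - m * Real.log a) atTop
      (𝓝 (∫ x, ψ x ∂P)) := by
  rw [tendsto_iff_norm_sub_tendsto_zero]
  have hlim : Tendsto (fun a : ℝ => K * a⁻¹ * ((∫ x, ‖x‖ ∂P) + a⁻¹)) atTop (𝓝 0) := by
    have h0 : Tendsto (fun a : ℝ => a⁻¹) atTop (𝓝 0) := tendsto_inv_atTop_zero
    simpa using (h0.const_mul K).mul (h0.const_add (∫ x, ‖x‖ ∂P))
  refine squeeze_zero' (Eventually.of_forall fun a => norm_nonneg _) ?_ hlim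
  filter_upwards [eventually_gt_atTop 0] with a ha
  have hm := (measurable_gridFloor (m := m) a).aemeasurable (μ := P)
  have hs := aestronglyMeasurable_surprisal_gridFloor P a
  have hi : Integrable (fun x => surprisal (P.map (gridFloor a)) (gridFloor a x)) P :=
    (integrable_map_measure hs hm).1
      (integrable_surprisal_gridFloor hP hK hψ hint hnorm ha)
  have hc : Integrable (fun _ : Fin m → ℝ => m * Real.log a) P := integrable_const _
  have hic : Integrable (fun x =>
      surprisal (P.map (gridFloor a)) (gridFloor a x) - m * Real.log a) P := hi.sub hc
  have h1 : shannonEntropy (P.map (gridFloor a)) - m * Real.log a - ∫ x, ψ x ∂P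
      = ∫ x, (surprisal (P.map (gridFloor a)) (gridFloor a x) - m * Real.log a - ψ x) ∂P := by
    rw [shannonEntropy, integral_map hm hs, integral_sub hic hint,
      integral_sub hi hc, integral_const]
    simp
  rw [h1]
  have h2 : ∫ x, K * a⁻¹ * (‖x‖ + a⁻¹) ∂P = K * a⁻¹ * ((∫ x, ‖x‖ ∂P) + a⁻¹) := by
    rw [integral_const_mul, integral_add hnorm (integrable_const _), integral_const]
    simp
  rw [← h2]
  exact norm_integral_le_of_norm_le ((hnorm.add (integrable_const _)).const_mul _)
    (Eventually.of_forall fun x => abs_surprisal_gridFloor_le hP hK hψ ha x)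

end Discretization

/-! ### Gaussian densities -/

section Gaussian

variable {m : ℕ}

theorem gaussianPDFReal_zero_one (x : ℝ) :
    gaussianPDFReal 0 1 x = Real.exp (-(Real.log (2 * Real.pi) / 2 + x ^ 2 / 2)) := by
  rw [gaussianPDFReal, neg_add, Real.exp_add]
  congr 1
  · rw [Real.exp_neg, ← Real.log_sqrt (by positivity), Real.exp_log (by positivity)]
    simp
  · simp [neg_div]

theorem pi_gaussianReal_eq_withDensity :
    Measure.pi (fun _ : Fin m => gaussianReal 0 1) = volume.withDensity fun x =>
      ENNReal.ofReal (Real.exp (-(m * (Real.log (2 * Real.pi) / 2) + (∑ i, x i ^ 2) / 2))) := by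
  have hprod : ∀ x : Fin m → ℝ,
      Real.exp (-(m * (Real.log (2 * Real.pi) / 2) + (∑ i, x i ^ 2) / 2))
        = ∏ i, gaussianPDFReal 0 1 (x i) := by
    intro x
    simp only [gaussianPDFReal_zero_one]
    rw [← Real.exp_sum, Finset.sum_neg_distrib, Finset.sum_add_distrib, Finset.sum_const,
      ← Finset.sum_div]
    simp
  refine (Measure.pi_eq (μ := fun _ : Fin m => gaussianReal 0 1) fun s hs => ?_)
  have hint : ∀ i, Integrable ((s i).indicator (gaussianPDFReal 0 1)) := fun i =>
    (integrable_gaussianPDFReal 0 1).indicator (hs i)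
  have hnn : ∀ i x, 0 ≤ (s i).indicator (gaussianPDFReal 0 1) x := fun i x =>
    Set.indicator_nonneg (fun y _ => gaussianPDFReal_nonneg 0 1 y) x
  have hind : ∀ x : Fin m → ℝ, (Set.univ.pi s).indicator
      (fun x => ENNReal.ofReal (∏ i, gaussianPDFReal 0 1 (x i))) x
      = ENNReal.ofReal (∏ i, (s i).indicator (gaussianPDFReal 0 1) (x i)) := by
    intro x
    by_cases hx : x ∈ Set.univ.pi s
    · rw [Set.indicator_of_mem hx]
      congr 1
      exact Finset.prod_congr rfl fun i _ => by
        rw [Set.indicator_of_mem (hx i (Set.mem_univ i))]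
    · rw [Set.indicator_of_notMem hx]
      simp only [Set.mem_univ_pi, not_forall] at hx
      obtain ⟨i, hi⟩ := hx
      rw [Finset.prod_eq_zero (Finset.mem_univ i) (Set.indicator_of_notMem hi _),
        ENNReal.ofReal_zero]
  have hprodint : Integrable fun x : Fin m → ℝ =>
      ∏ i, (s i).indicator (gaussianPDFReal 0 1) (x i) := Integrable.fintype_prod hint
  simp only [hprod]
  rw [withDensity_apply _ (MeasurableSet.univ_pi hs),
    ← lintegral_indicator (MeasurableSet.univ_pi hs), lintegral_congr hind,
    ← ofReal_integral_eq_lintegral_ofReal hprodint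
      (Eventually.of_forall fun x => Finset.prod_nonneg fun i _ => hnn i _),
    integral_fintype_prod_volume_eq_prod, ENNReal.ofReal_prod_of_nonneg
      fun i _ => integral_nonneg (hnn i)]
  refine Finset.prod_congr rfl fun i _ => ?_
  rw [gaussianReal_apply_eq_integral 0 one_ne_zero, integral_indicator (hs i)]

/-- The negative logarithm of the density of the centered Gaussian law with covariance matrix
`C * Cᵀ`. -/
noncomputable def negLogDensity (C : Matrix (Fin m) (Fin m) ℝ) (x : Fin m → ℝ) : ℝ :=
  m * (Real.log (2 * Real.pi) / 2) + Real.log |C.det| + (∑ i, (C⁻¹.mulVec x) i ^ 2) / 2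

theorem measurable_mulVec (C : Matrix (Fin m) (Fin m) ℝ) : Measurable fun x => C.mulVec x :=
  (Matrix.mulVecLin C).continuous_of_finiteDimensional.measurable

theorem measurable_negLogDensity (C : Matrix (Fin m) (Fin m) ℝ) :
    Measurable (negLogDensity C) := by
  have := measurable_mulVec C⁻¹
  unfold negLogDensity
  fun_prop

theorem map_mulVec_pi_gaussianReal {C : Matrix (Fin m) (Fin m) ℝ} (hC : C.det ≠ 0) :
    (Measure.pi fun _ : Fin m => gaussianReal 0 1).map (fun x => C.mulVec x)
      = volume.withDensity fun x => ENNReal.ofReal (Real.exp (-negLogDensity C x)) := by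
  have hCm := measurable_mulVec C
  have hD := measurable_negLogDensity C
  have hvol : (volume : Measure (Fin m → ℝ)).map (fun x => C.mulVec x)
      = ENNReal.ofReal |C.det⁻¹| • volume := by
    exact Real.map_matrix_volume_pi_eq_smul_volume_pi hC
  ext S hS
  rw [Measure.map_apply hCm hS, pi_gaussianReal_eq_withDensity, withDensity_apply _ (hCm hS),
    withDensity_apply _ hS]
  have hcomp : ∀ x : Fin m → ℝ,
      ENNReal.ofReal (Real.exp (-(m * (Real.log (2 * Real.pi) / 2) + (∑ i, x i ^ 2) / 2)))
      = ENNReal.ofReal |C.det| *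
        ENNReal.ofReal (Real.exp (-negLogDensity C (C.mulVec x))) := by
    intro x
    rw [← ENNReal.ofReal_mul (abs_nonneg _)]
    congr 1
    have h1 : C⁻¹.mulVec (C.mulVec x) = x := by
      rw [Matrix.mulVec_mulVec, Matrix.nonsing_inv_mul C (isUnit_iff_ne_zero.2 hC),
        Matrix.one_mulVec]
    rw [negLogDensity, h1]
    have h2 : |C.det| = Real.exp (Real.log |C.det|) := (Real.exp_log (abs_pos.2 hC)).symm
    conv_rhs => lhs; rw [h2]
    rw [← Real.exp_add]
    congr 1
    ring
  simp only [hcomp]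
  have hmeas : Measurable fun y => ENNReal.ofReal |C.det| *
      ENNReal.ofReal (Real.exp (-negLogDensity C y)) := by fun_prop
  rw [← setLIntegral_map hS hmeas hCm, hvol, Measure.restrict_smul, lintegral_smul_measure,
    lintegral_const_mul _ (by fun_prop), smul_eq_mul, ← mul_assoc,
    ← ENNReal.ofReal_mul (abs_nonneg _), ← abs_mul, inv_mul_cancel₀ hC]
  simp

theorem abs_negLogDensity_sub_le (C : Matrix (Fin m) (Fin m) ℝ) :
    ∃ K, 0 ≤ K ∧ ∀ x y, |negLogDensity C x - negLogDensity C y|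
      ≤ K * ‖x - y‖ * (‖x‖ + ‖x - y‖) := by
  set L := LinearMap.toContinuousLinearMap (Matrix.mulVecLin C⁻¹) with hL
  have hLx : ∀ x, C⁻¹.mulVec x = L x := fun x => rfl
  refine ⟨m * ‖L‖ ^ 2, by positivity, fun x y => ?_⟩
  have h1 : negLogDensity C x - negLogDensity C y
      = (∑ i, L (x - y) i * (2 * L x i - L (x - y) i)) / 2 := by
    simp only [negLogDensity, hLx, map_sub, Pi.sub_apply]
    rw [add_sub_add_left_eq_sub, ← sub_div, ← Finset.sum_sub_distrib]
    congr 1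
    exact Finset.sum_congr rfl fun i _ => by ring
  have h2 : ∀ v i, |L v i| ≤ ‖L‖ * ‖v‖ := fun v i =>
    (norm_le_pi_norm (L v) i).trans (L.le_opNorm v)
  have h3 : |∑ i, L (x - y) i * (2 * L x i - L (x - y) i)|
      ≤ ∑ _i : Fin m, (‖L‖ * ‖x - y‖) * (2 * (‖L‖ * ‖x‖) + ‖L‖ * ‖x - y‖) := by
    refine (Finset.abs_sum_le_sum_abs _ _).trans (Finset.sum_le_sum fun i _ => ?_)
    rw [abs_mul]
    refine mul_le_mul (h2 _ _) ?_ (abs_nonneg _) (by positivity)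
    refine (abs_sub _ _).trans ?_
    rw [abs_mul, abs_two]
    linarith [h2 x i, h2 (x - y) i]
  rw [h1, abs_div, abs_two]
  simp only [Finset.sum_const, Finset.card_univ, Fintype.card_fin, nsmul_eq_mul] at h3
  have h4 : 0 ≤ m * ‖L‖ ^ 2 * ‖x - y‖ * ‖x - y‖ := by positivity
  nlinarith [h3, h4]

theorem integral_negLogDensity {C : Matrix (Fin m) (Fin m) ℝ} (hC : C.det ≠ 0) :
    Integrable (negLogDensity C)
      ((Measure.pi fun _ : Fin m => gaussianReal 0 1).map fun x => C.mulVec x) ∧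
    ∫ x, negLogDensity C x ∂((Measure.pi fun _ : Fin m => gaussianReal 0 1).map
      fun x => C.mulVec x) = m * (Real.log (2 * Real.pi) / 2 + 1 / 2) + Real.log |C.det| := by
  have hCm := (measurable_mulVec C).aemeasurable
    (μ := Measure.pi fun _ : Fin m => gaussianReal 0 1)
  have hD := (measurable_negLogDensity C).aestronglyMeasurable
    (μ := (Measure.pi fun _ : Fin m => gaussianReal 0 1).map fun x => C.mulVec x)
  have hcomp : ∀ x : Fin m → ℝ, negLogDensity C (C.mulVec x)
      = m * (Real.log (2 * Real.pi) / 2) + Real.log |C.det| + (∑ i, x i ^ 2) / 2 := by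
    intro x
    rw [negLogDensity, Matrix.mulVec_mulVec,
      Matrix.nonsing_inv_mul C (isUnit_iff_ne_zero.2 hC), Matrix.one_mulVec]
  have hsq : ∀ i : Fin m, Integrable (fun x : Fin m → ℝ => x i ^ 2)
      (Measure.pi fun _ : Fin m => gaussianReal 0 1) := fun i =>
    integrable_comp_eval (μ := fun _ : Fin m => gaussianReal 0 1) (i := i)
      (f := fun y : ℝ => y ^ 2) (memLp_id_gaussianReal 2).integrable_sq
  have hint1 : ∫ y : ℝ, y ^ 2 ∂(gaussianReal 0 1) = 1 := by
    have h1 := variance_id_gaussianReal (μ := 0) (v := 1)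
    rw [variance_of_integral_eq_zero aemeasurable_id (by simp)] at h1
    simpa using h1
  have hsq1 : ∀ i : Fin m, ∫ x : Fin m → ℝ, x i ^ 2
      ∂(Measure.pi fun _ : Fin m => gaussianReal 0 1) = 1 := fun i => by
    rw [integral_comp_eval (μ := fun _ : Fin m => gaussianReal 0 1)
      (f := fun y : ℝ => y ^ 2) (by fun_prop), hint1]
  have hs : Integrable (fun x : Fin m → ℝ => (∑ i, x i ^ 2) / 2)
      (Measure.pi fun _ : Fin m => gaussianReal 0 1) :=
    (integrable_finsetSum _ fun i _ => hsq i).div_const 2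
  constructor
  · rw [integrable_map_measure hD hCm]
    simp only [Function.comp_def, hcomp]
    exact (integrable_const _).add hs
  · rw [integral_map hCm hD]
    simp only [hcomp]
    rw [integral_add (integrable_const _) hs, integral_const, integral_div,
      integral_finsetSum _ fun i _ => hsq i]
    simp only [hsq1]
    simp
    ring

/-! ### Finite dimensional marginals of the Gaussian wave -/

variable {V : Type*} {μ : Measure (V → ℝ)} {K : V → V → ℝ}

theorem hasGaussianLaw_pairing (hμ : IsGaussianProcess (fun (v : V) (φ : V → ℝ) => φ v) μ)
    (ξ : Fin m → (V →₀ ℝ)) :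
    HasGaussianLaw (fun φ j => (ξ j).sum fun u c => c * φ u) μ := by
  classical
  set I : Finset V := Finset.univ.biUnion fun j => (ξ j).support with hI
  let L : (I → ℝ) →L[ℝ] (Fin m → ℝ) :=
    ContinuousLinearMap.pi fun j => ∑ u : I, (ξ j u) • ContinuousLinearMap.proj u
  have h1 := (hμ.hasGaussianLaw I).map_fun L
  have heq : (fun (φ : V → ℝ) (j : Fin m) => (ξ j).sum fun u c => c * φ u)
      = fun φ => L (I.restrict fun v => φ v) := by
    funext φ j
    have hsub : (ξ j).support ⊆ I := Finset.subset_biUnion_of_mem (fun j => (ξ j).support)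
      (Finset.mem_univ j)
    rw [Finsupp.sum_of_support_subset _ hsub _ (by simp)]
    simp only [L, ContinuousLinearMap.coe_pi', sum_apply,
      smul_apply, ContinuousLinearMap.proj_apply, smul_eq_mul]
    exact (Finset.sum_coe_sort I fun u => ξ j u * φ u).symm
  rw [heq]
  exact h1

theorem integral_pairing_mul_pairing (hL : ∀ v, MemLp (fun φ : V → ℝ => φ v) 2 μ)
    (hcov : ∀ x y, ∫ φ, φ x * φ y ∂μ = K x y) (ξ ζ : V →₀ ℝ) :
    ∫ φ, (ξ.sum fun u c => c * φ u) * (ζ.sum fun u c => c * φ u) ∂μ = kernelForm K ξ ζ := by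
  have hint : ∀ u v, Integrable (fun φ : V → ℝ => ξ u * (ζ v * (φ u * φ v))) μ := fun u v =>
    (((hL u).integrable_mul (hL v)).const_mul _).const_mul _
  rw [kernelForm_apply]
  simp only [Finsupp.sum, Finset.sum_mul_sum]
  have h1 : ∀ (φ : V → ℝ) (u v : V), ξ u * φ u * (ζ v * φ v) = ξ u * (ζ v * (φ u * φ v)) :=
    fun φ u v => by ring
  simp only [h1]
  rw [integral_finsetSum _ fun u _ => integrable_finsetSum _ fun v _ => hint u v]
  refine Finset.sum_congr rfl fun u _ => ?_
  rw [integral_finsetSum _ fun v _ => hint u v]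
  refine Finset.sum_congr rfl fun v _ => ?_
  rw [integral_const_mul, integral_const_mul, hcov]

theorem integral_pairing_eq_zero (hL : ∀ v, Integrable (fun φ : V → ℝ => φ v) μ)
    (hzero : ∀ v, ∫ φ, φ v ∂μ = 0) (ξ : V →₀ ℝ) :
    ∫ φ, (ξ.sum fun u c => c * φ u) ∂μ = 0 := by
  simp only [Finsupp.sum]
  rw [integral_finsetSum _ fun v _ => (hL v).const_mul _]
  simp [integral_const_mul, hzero]

theorem map_pairing_eq_pi_gaussianReal (hμ : IsGaussianProcess (fun (v : V) (φ : V → ℝ) => φ v) μ)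
    (hL : ∀ v, MemLp (fun φ : V → ℝ => φ v) 2 μ) (hzero : ∀ v, ∫ φ, φ v ∂μ = 0)
    (hcov : ∀ x y, ∫ φ, φ x * φ y ∂μ = K x y) {ξ : Fin m → (V →₀ ℝ)} (hξ : gram K ξ = 1) :
    μ.map (fun φ j => (ξ j).sum fun u c => c * φ u)
      = Measure.pi fun _ : Fin m => gaussianReal 0 1 := by
  have hprob := hμ.isProbabilityMeasure
  set X : Fin m → (V → ℝ) → ℝ := fun j φ => (ξ j).sum fun u c => c * φ u with hX
  have hG : HasGaussianLaw (fun φ j => X j φ) μ := hasGaussianLaw_pairing hμ ξ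
  have hmean : ∀ j, μ[X j] = 0 := fun j =>
    integral_pairing_eq_zero (fun v => (hL v).integrable (by norm_num)) hzero (ξ j)
  have hcovX : ∀ i j, cov[X i, X j; μ] = if i = j then 1 else 0 := by
    intro i j
    rw [covariance]
    simp only [hmean, sub_zero]
    rw [← Matrix.one_apply, ← hξ, gram_apply]
    exact integral_pairing_mul_pairing hL hcov (ξ i) (ξ j)
  have hind : iIndepFun X μ := hG.iIndepFun_of_covariance_eq_zero fun i j hij => by
    rw [hcovX, if_neg hij]
  rw [(iIndepFun_iff_map_fun_eq_pi_map fun j => (hG.eval j).aemeasurable).1 hind]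
  congr 1
  funext j
  rw [(hG.eval j).map_eq_gaussianReal, hmean j, ← covariance_self (hG.eval j).aemeasurable,
    hcovX, if_pos rfl, Real.toNNReal_one]

/-- For a centered Gaussian process with covariance kernel `K`, the discretized pairings have
finite entropy, and this entropy is asymptotic to `m log a` plus the differential entropy, in
which `K` enters through half the logarithm of the Gram determinant. -/
theorem integrable_surprisal_and_tendsto_shannonEntropy
    (hμ : IsGaussianProcess (fun (v : V) (φ : V → ℝ) => φ v) μ)
    (hL : ∀ v, MemLp (fun φ : V → ℝ => φ v) 2 μ) (hzero : ∀ v, ∫ φ, φ v ∂μ = 0)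
    (hcov : ∀ x y, ∫ φ, φ x * φ y ∂μ = K x y) {χ : Fin m → (V →₀ ℝ)} (hχ : (gram K χ).PosDef) :
    (∀ a : ℝ, 0 < a → Integrable (surprisal (discretize μ χ a)) (discretize μ χ a)) ∧
    Tendsto (fun a => shannonEntropy (discretize μ χ a) - m * Real.log a) atTop
      (𝓝 (m * (Real.log (2 * Real.pi) / 2 + 1 / 2) + 1 / 2 * Real.log (gram K χ).det)) := by
  have hprob := hμ.isProbabilityMeasure
  obtain ⟨C, ξ, hdet2, hdet, hgram, -, hχξ⟩ := exists_gram_eq_one hχ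
  set X : (V → ℝ) → Fin m → ℝ := fun φ j => (χ j).sum fun u c => c * φ u with hX
  have hXm : Measurable X := by
    refine measurable_pi_iff.2 fun j => ?_
    simp only [hX, Finsupp.sum]
    fun_prop
  have hZm : Measurable fun (φ : V → ℝ) (j : Fin m) => (ξ j).sum fun u c => c * φ u := by
    refine measurable_pi_iff.2 fun j => ?_
    simp only [Finsupp.sum]
    fun_prop
  have hXZ : X = (fun x => C.mulVec x) ∘
      fun (φ : V → ℝ) (j : Fin m) => (ξ j).sum fun u c => c * φ u := by
    funext φ j
    have hlin : ∀ ζ : V →₀ ℝ, (ζ.sum fun u c => c * φ u) = Finsupp.linearCombination ℝ φ ζ :=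
      fun ζ => by simp [Finsupp.linearCombination_apply]
    simp only [hX, Function.comp_apply, Matrix.mulVec, dotProduct, hlin]
    rw [hχξ j, map_sum]
    simp
  have hP : μ.map X = volume.withDensity
      fun x => ENNReal.ofReal (Real.exp (-negLogDensity C x)) := by
    rw [hXZ, ← Measure.map_map (measurable_mulVec C) hZm,
      map_pairing_eq_pi_gaussianReal hμ hL hzero hcov hgram, map_mulVec_pi_gaussianReal hdet]
  have hdisc : ∀ a, discretize μ χ a = (μ.map X).map (gridFloor a) := fun a => by
    rw [Measure.map_map (measurable_gridFloor a) hXm]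
    rfl
  have hPprob : IsProbabilityMeasure (μ.map X) := Measure.isProbabilityMeasure_map hXm.aemeasurable
  have hnorm : Integrable (fun x => ‖x‖) (μ.map X) := by
    have h1 := (hasGaussianLaw_pairing hμ χ).isGaussian_map
    exact (IsGaussian.integrable_id (μ := μ.map X)).norm
  obtain ⟨B, hB, hψ⟩ := abs_negLogDensity_sub_le C
  obtain ⟨hint, hval⟩ := integral_negLogDensity hdet
  rw [map_mulVec_pi_gaussianReal hdet, ← hP] at hint hval
  simp only [hdisc]
  refine ⟨fun a ha => integrable_surprisal_gridFloor hP hB hψ hint hnorm ha, ?_⟩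
  have h1 := tendsto_shannonEntropy_gridFloor hP hB hψ hint hnorm
  have h2 : 1 / 2 * Real.log (gram K χ).det = Real.log |C.det| := by
    rw [hdet2, ← sq_abs, Real.log_pow]
    push_cast
    ring
  rw [h2, ← hval]
  exact h1

end Gaussian

/-! ### The difference of entropies between stars and edges -/

section StarEdge

variable {V : Type*} {n : ℕ} {d : Matrix (Fin n) (Fin n) ℕ} {T : SimpleGraph V}
  {h : BoundedDegree T} {τ : V → Fin n} {lam : ℝ}

/-- The combination `𝔼_o[F(B_k(C_o)) - ½ ∑_{x ∼ o} F(B_k(e_{ox}))]` of the values of a function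
of vertex sets. -/
noncomputable def starEdge (T : SimpleGraph V) (h : BoundedDegree T) (q : Fin n → ℝ)
    (o : Fin n → V) (k : ℕ) (F : Set V → ℝ) : ℝ :=
  ∑ i, q i * (F (ball T k (star T (o i))) - 1 / 2 * ∑ x ∈ nbrs T h (o i), F (ball T k {o i, x}))

theorem starEdge_add_mul (q : Fin n → ℝ) (o : Fin n → V) (k : ℕ) (F G : Set V → ℝ) (c : ℝ) :
    starEdge T h q o k (fun Γ => F Γ + G Γ * c)
      = starEdge T h q o k F + starEdge T h q o k G * c := by
  simp only [starEdge, Finset.sum_add_distrib, ← Finset.sum_mul]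
  rw [Finset.sum_mul, ← Finset.sum_add_distrib]
  exact Finset.sum_congr rfl fun i _ => by ring

theorem ball_star_mem_localSets (k : ℕ) (v : V) : ball T k (star T v) ∈ localSets T k :=
  Or.inl ⟨v, rfl⟩

theorem ball_pair_mem_localSets (k : ℕ) {v x : V} (hx : x ∈ nbrs T h v) :
    ball T k {v, x} ∈ localSets T k :=
  Or.inr ⟨v, x, (mem_nbrs h).1 hx, rfl⟩

theorem starEdge_congr {q : Fin n → ℝ} {o : Fin n → V} {k : ℕ} {F G : Set V → ℝ}
    (hFG : ∀ Γ ∈ localSets T k, F Γ = G Γ) :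
    starEdge T h q o k F = starEdge T h q o k G := by
  refine Finset.sum_congr rfl fun i _ => ?_
  rw [hFG _ (ball_star_mem_localSets k _),
    Finset.sum_congr rfl fun x hx => hFG _ (ball_pair_mem_localSets k hx)]

theorem tendsto_starEdge {q : Fin n → ℝ} {o : Fin n → V} {k : ℕ} {ι : Type*} {l : Filter ι}
    {F : ι → Set V → ℝ} {G : Set V → ℝ}
    (hFG : ∀ Γ ∈ localSets T k, Tendsto (fun a => F a Γ) l (𝓝 (G Γ))) :
    Tendsto (fun a => starEdge T h q o k (F a)) l (𝓝 (starEdge T h q o k G)) :=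
  tendsto_finsetSum _ fun _ _ => ((hFG _ (ball_star_mem_localSets k _)).sub
    ((tendsto_finsetSum _ fun _ hx =>
      hFG _ (ball_pair_mem_localSets k hx)).const_mul _)).const_mul _

theorem gram_const_mul (K : V → V → ℝ) (c : ℝ) {m : ℕ} (χ : Fin m → (V →₀ ℝ)) :
    gram (fun u v => c * K u v) χ = c • gram K χ := by
  ext i j
  rw [gram_apply, kernelForm_const_mul, Matrix.smul_apply, smul_eq_mul, gram_apply]

theorem IsUniversalCover.hasDelta (hd : IsExpanding d) (hT : IsUniversalCover d T τ)
    {q : Fin n → ℝ} (hq : IsRootLaw d q) {o : Fin n → V} (ho : ∀ i, τ (o i) = i)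
    (hreg : IsRegularPoint T h lam) {μ : Measure (V → ℝ)} (hμ : IsGaussianWave T h lam μ) {k : ℕ}
    {b : ∀ Γ : Set V, Fin (boundary T Γ).ncard → (V →₀ ℝ)}
    (hb : ∀ Γ ∈ localSets T k, LinearIndependent ℝ (b Γ) ∧
      (∀ i, b Γ i ∈ eigenSpace T h lam Γ) ∧
      ∀ ψ ∈ eigenSpace T h lam Γ, ∃ x : Fin (boundary T Γ).ncard → ℝ, ψ = ∑ i, x i • b Γ i)
    {η : ℝ} (hη : 0 < η) :
    HasDelta T h lam q o k (testVector T h lam η) μ (starEdge T h q o k fun Γ =>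
      1 / 2 * (Real.log (gram (fun u v => (greenReal T h lam u v).im) (b Γ)).det
        - Real.log (gram (fun u v => (green T h (pt lam η) u v).im) (b Γ)).det)) := by
  have hmin := hT.two_le_card_nbrs (h := h) hd
  obtain ⟨m, hker, -, -, -⟩ := hT.exists_boundary_kernel hd hreg
  have hz : 0 < (pt lam η).im := by rwa [pt_im]
  set K : V → V → ℝ := fun u v => (greenReal T h lam u v).im with hK
  set M : V → V → ℝ := fun u v => (green T h (pt lam η) u v).im with hM
  have hKsymm : ∀ u v, K u v = K v u := fun u v => by simp only [hK, hker.symm u v]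
  have hMsymm : ∀ u v, M u v = M v u := fun u v => by simp only [hM, green_symm hz u v]
  have hMpos : ∀ χ : V →₀ ℝ, χ ≠ 0 → 0 < kernelForm M χ χ := by
    intro χ hχ
    have h1 := kernelForm_im_green_pos (h := h) hz hχ
    have h2 : M = fun u v => η * ((green T h (pt lam η) u v).im / (pt lam η).im) := by
      funext u v
      rw [pt_im, mul_div_cancel₀ _ hη.ne']
    rw [h2, kernelForm_const_mul]
    exact mul_pos hη h1
  have hg : ∀ u v, inner ℂ (testVector T h lam η u) (testVector T h lam η v)
      = ((η * M u v : ℝ) : ℂ) := inner_testVector hη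
  have hpos : ∀ χ : V →₀ ℝ, χ ≠ 0 → 0 < kernelForm (fun u v => η * M u v) χ χ := fun χ hχ => by
    rw [kernelForm_const_mul]
    exact mul_pos hη (hMpos χ hχ)
  have hKpos : ∀ Γ ∈ localSets T k, ∀ χ ∈ eigenSpace T h lam Γ, χ ≠ 0 → 0 < kernelForm K χ χ := by
    intro Γ hΓ χ hχ hχ0
    obtain ⟨hfin, hfree⟩ := localSets_finite_hasFreeBranches hT.isTree hmin hΓ
    exact hT.kernelForm_cov_pos hd hreg hfin hfree hχ hχ0
  refine ⟨fun Γ hΓ => exists_isDiscretizationBasis hg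
    (fun u v => by rw [hMsymm u v]) hpos (hb Γ hΓ).1 (hb Γ hΓ).2.1 (hb Γ hΓ).2.2, fun χ hχ => ?_⟩
  have hent := fun Γ (hΓ : Γ ∈ localSets T k) =>
    integrable_surprisal_and_tendsto_shannonEntropy hμ.gaussian hμ.memLp hμ.centered hμ.covariance
      (posDef_gram hKsymm (hKpos Γ hΓ) (hχ Γ hΓ).mem (hχ Γ hΓ).linearIndependent)
  refine ⟨fun Γ hΓ => (hent Γ hΓ).1, ?_⟩
  -- Terms proportional to the number of boundary vertices cancel by the edge balance.
  have hcancel : ∀ (F : Set V → ℝ) (c : ℝ),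
      starEdge T h q o k (fun Γ => F Γ + ((boundary T Γ).ncard : ℝ) * c)
        = starEdge T h q o k F := by
    intro F c
    rw [starEdge_add_mul]
    have h0 : starEdge T h q o k (fun Γ => ((boundary T Γ).ncard : ℝ)) = 0 :=
      hT.sum_ncard_boundary hd hq ho k
    rw [h0, zero_mul, add_zero]
  have hlim := tendsto_starEdge (h := h) (q := q) (o := o) fun Γ hΓ => (hent Γ hΓ).2
  have hval : ∀ Γ ∈ localSets T k,
      ((boundary T Γ).ncard : ℝ) * (Real.log (2 * Real.pi) / 2 + 1 / 2)
        + 1 / 2 * Real.log (gram K (χ Γ)).det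
      = 1 / 2 * (Real.log (gram K (b Γ)).det - Real.log (gram M (b Γ)).det)
        + ((boundary T Γ).ncard : ℝ)
          * (Real.log (2 * Real.pi) / 2 + 1 / 2 - 1 / 2 * Real.log η) := by
    intro Γ hΓ
    obtain ⟨hli, hmem, hspan⟩ := hb Γ hΓ
    have hdet := (hχ Γ hΓ).det_gram_mul hg hspan K
    have hd1 := (posDef_gram hKsymm (hKpos Γ hΓ) (hχ Γ hΓ).mem (hχ Γ hΓ).linearIndependent).det_pos
    have hd2 := (posDef_gram hMsymm (E := ⊤) (fun χ _ h0 => hMpos χ h0)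
      (fun i => Submodule.mem_top) hli).det_pos
    rw [gram_const_mul, Matrix.det_smul, Fintype.card_fin] at hdet
    rw [← hdet, Real.log_mul hd1.ne' (by positivity), Real.log_mul (by positivity) hd2.ne',
      Real.log_pow]
    ring
  rw [starEdge_congr hval, hcancel] at hlim
  refine hlim.congr fun a => ?_
  rw [← hcancel _ (Real.log a)]
  simp only [sub_add_cancel]
  rfl

theorem IsUniversalCover.tendsto_starEdge_log_det (hd : IsExpanding d)
    (hT : IsUniversalCover d T τ) (q : Fin n → ℝ) (o : Fin n → V)
    (hreg : IsRegularPoint T h lam) {k : ℕ}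
    {b : ∀ Γ : Set V, Fin (boundary T Γ).ncard → (V →₀ ℝ)}
    (hb : ∀ Γ ∈ localSets T k, LinearIndependent ℝ (b Γ) ∧
      (∀ i, b Γ i ∈ eigenSpace T h lam Γ)) :
    Tendsto (fun η => starEdge T h q o k fun Γ =>
      1 / 2 * (Real.log (gram (fun u v => (greenReal T h lam u v).im) (b Γ)).det
        - Real.log (gram (fun u v => (green T h (pt lam η) u v).im) (b Γ)).det))
      (𝓝[>] 0) (𝓝 0) := by
  have hmin := hT.two_le_card_nbrs (h := h) hd
  obtain ⟨m, hker, -, -, hlim⟩ := hT.exists_boundary_kernel hd hreg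
  have h0 : starEdge T h q o k (fun _ => 0) = 0 := by simp [starEdge]
  refine (tendsto_starEdge (G := fun _ => 0) fun Γ hΓ => ?_).trans (congrArg 𝓝 h0).le
  obtain ⟨hfin, hfree⟩ := localSets_finite_hasFreeBranches hT.isTree hmin hΓ
  have hpos := (posDef_gram (k := fun u v => (greenReal T h lam u v).im)
    (fun u v => by rw [hker.symm u v])
    (fun χ hχ hχ0 => hT.kernelForm_cov_pos hd hreg hfin hfree hχ hχ0) (hb Γ hΓ).2
    (hb Γ hΓ).1).det_pos
  have hgram : Tendsto (fun η => gram (fun u v => (green T h (pt lam η) u v).im) (b Γ)) (𝓝[>] 0)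
      (𝓝 (gram (fun u v => (greenReal T h lam u v).im) (b Γ))) := by
    refine tendsto_pi_nhds.2 fun i => tendsto_pi_nhds.2 fun j => ?_
    exact tendsto_kernelForm (fun u v =>
      (Complex.continuous_im.tendsto _).comp (hlim u v)) (b Γ i) (b Γ j)
  have hdet := ((continuous_id.matrix_det.tendsto _).comp hgram).log hpos.ne'
  have := (hdet.const_sub
    (Real.log (gram (fun u v => (greenReal T h lam u v).im) (b Γ)).det)).const_mul (1 / 2)
  simpa using this

end StarEdge

end GaussianWave

theorem mainTheorem5 {V : Type*} {n : ℕ} (d : Matrix (Fin n) (Fin n) ℕ)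
    (hd : GaussianWave.IsExpanding d) (q : Fin n → ℝ) (hq : GaussianWave.IsRootLaw d q)
    (T : SimpleGraph V) (τ : V → Fin n) (hT : GaussianWave.IsUniversalCover d T τ)
    (o : Fin n → V) (ho : ∀ i, τ (o i) = i)
    (lam : ℝ)
    (hlam : lam ∈ GaussianWave.spec T hT.boundedDegree \
      GaussianWave.exceptionalSet T hT.boundedDegree)
    (μ : Measure (V → ℝ)) (hμ : GaussianWave.IsGaussianWave T hT.boundedDegree lam μ) :
    ∃ ν : ℝ → Measure (V → ℝ),
      (∀ η : ℝ, 0 < η → GaussianWave.IsTransform μ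
        (GaussianWave.testVector T hT.boundedDegree lam η) (ν η)) ∧
      ∀ k : ℕ, ∃ Δ : ℝ → ℝ,
        (∀ η : ℝ, 0 < η → GaussianWave.HasDelta T hT.boundedDegree lam q o k
          (GaussianWave.testVector T hT.boundedDegree lam η) (ν η) (Δ η)) ∧
        Tendsto Δ (𝓝[>] (0 : ℝ)) (𝓝 0) := by
  classical
  have hreg : GaussianWave.IsRegularPoint T hT.boundedDegree lam :=
    not_not.1 fun hn => hlam.2 ⟨hlam.1, hn⟩
  have hmin := hT.two_le_card_nbrs (h := hT.boundedDegree) hd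
  -- The transform of the wave is the wave itself.
  refine ⟨fun _ => μ, fun η hη => hT.isTransform_self hd hreg hμ.toIsEigenvectorProcess hη,
    fun k => ?_⟩
  have hex : ∀ Γ : Set V, ∃ b : Fin (GaussianWave.boundary T Γ).ncard → (V →₀ ℝ),
      Γ ∈ GaussianWave.localSets T k → LinearIndependent ℝ b ∧
      (∀ i, b i ∈ GaussianWave.eigenSpace T hT.boundedDegree lam Γ) ∧
      ∀ ψ ∈ GaussianWave.eigenSpace T hT.boundedDegree lam Γ,
        ∃ x : Fin (GaussianWave.boundary T Γ).ncard → ℝ, ψ = ∑ i, x i • b i := by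
    intro Γ
    by_cases hΓ : Γ ∈ GaussianWave.localSets T k
    · obtain ⟨b, hb⟩ := hT.exists_basis_eigenSpace hd hreg
        (GaussianWave.localSets_finite_hasFreeBranches hT.isTree hmin hΓ).1
      exact ⟨b, fun _ => hb⟩
    · exact ⟨0, fun h0 => absurd h0 hΓ⟩
  choose b hb using hex
  exact ⟨_, fun η hη => hT.hasDelta hd hq ho hreg hμ hb hη,
    hT.tendsto_starEdge_log_det hd q o hreg fun Γ hΓ => ⟨(hb Γ hΓ).1, (hb Γ hΓ).2.1⟩⟩
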